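/- **Setting.** Let $\mathcal L$ be the free Lie algebra (over $\mathbb R$) on generators $F=Y_1,Y_3,Y_5,\dots$, graded by giving $Y_{2k+1}$ degree $2k+1$; let $\mathcal L_m$ be its homogeneous component of degree $m$, $c(m)=\dim\mathcal L_m$, $N^{[r]}=\sum_{m=1}^r c(m)$, and let $\{E_{m,k}\}_{k=1}^{c(m)}$ be a basis of $\mathcal L_m$ for every $m$, with $E_{1,1}=F$. Let $\alpha_1,\dots,\alpha_s\in\mathbb C$ satisfy $\alpha_{s+1-j}=\bar\alpha_j$ for all $j$. Define the formal series $V(h)$ by $$\exp(V(h))=\exp\Big(\sum_{k\ge0}\alpha_1^{2k+1}h^{2k+1}Y_{2k+1}\Big)\cdots\exp\Big(\sum_{k\ge0}\alpha_s^{2k+1}h^{2k+1}Y_{2k+1}\Big),$$ and let $w_{m,k}\in\mathbb C$ be its (existing and unique) coordinates, $V(h)=\sum_{m\ge1}h^m\sum_{k=1}^{c(m)}w_{m,k}E_{m,k}$. The order conditions at order $h^m$ are $w_{1,1}=1$ if $m=1$, and $w_{m,k}=0$ for $1\le k\le c(m)$ if $m>1$. For a real analytic system $x'=f(x)$ in $\mathbb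 R^d$ with flow $\varphi_h$ and a time-symmetric second-order method $\mathcal S_h$ for it (that is, $\mathcal S_h=\varphi_h+\mathcal O(h^3)$ and $\mathcal S_h\circ\mathcal S_{-h}=\mathrm{id}$), analytic in $h$ and $x$ and real for real $h$ and $x$, let $\psi_h=\mathcal S_{\alpha_sh}\circ\cdots\circ\mathcal S_{\alpha_1h}$ be the symmetric-conjugate composition and $\hat R_h=\Re(\psi_h)$ its projection on the real axis at each step ($h$ and $x$ real). An integrator $R_h$ has order $r$ if $R_h=\varphi_h+\mathcal O(h^{r+1})$, and pseudo-symmetry order $p$ if $R_h^*=R_h+\mathcal O(h^{p+1})$, where $R_h^*=(R_{-h})^{-1}$; the $\mathcal O$-terms are as $h\to0$, locally uniform in $x$. **Proposition.** Let $n,q\ge0$ be integers with $4n-(4q+1)>2n$, equivalently $2n>4q+1$. 1. The coefficients $w_{2n-2j,k}$, $0\le j\le q$, $1\le k\le c(2n-2j)$, are purely imaginary. 2. The following are equivalent: (i) the order conditions at all orders $h^m$, $1\le m\le 2n$, $m\notin\{2n,2n-2,\dots,2n-2q\}$, are satisfied; (ii) for every $d$, every such system $x'=f(x)$ in $\mathbb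 R^d$ and every such method $\mathcal S_h$ for it, $\hat R_h$ has order $2n$ and pseudo-symmetry order $4n-(4q+1)$. In particular the conditions (i) suffice for order $2n$ and pseudo-symmetry order $4n-(4q+1)$ after projection on the real axis. 3. The number of order conditions in (i) is $$N^{[2n]}-\sum_{j=0}^{q}c(2n-2j).$$ -/

import Mathlib

open Filter Topology Asymptotics

noncomputable section

namespace SymConj

/-! ### Integrators near a point of the phase space

A one-step integrator on `ℝ^d` is a family `ψ h : ℝ^d → ℝ^d`. All notions are local: they concern
small `h` and initial values `x` close to a given point `x₀`. -/

/-- `φ` is the flow of `x' = f x` for small times and initial values near `x₀`. -/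
structure IsLocalFlow {d : ℕ} (f : (Fin d → ℝ) → (Fin d → ℝ)) (x₀ : Fin d → ℝ)
    (φ : ℝ → (Fin d → ℝ) → (Fin d → ℝ)) : Prop where
  continuousAt : ContinuousAt (fun p : ℝ × (Fin d → ℝ) => φ p.1 p.2) (0, x₀)
  initial : ∀ᶠ x in 𝓝 x₀, φ 0 x = x
  hasDerivAt : ∀ᶠ p : ℝ × (Fin d → ℝ) in 𝓝 (0, x₀),
    HasDerivAt (fun t => φ t p.2) (f (φ p.1 p.2)) p.1

/-- The integrator `ψ` for `x' = f x` has order (at least) `r` near `x₀`: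
`ψ_h(x) = φ_h(x) + O(h^{r+1})`, uniformly for `x` near `x₀`, with `φ` the exact flow. -/
def HasOrder {d : ℕ} (f : (Fin d → ℝ) → (Fin d → ℝ)) (x₀ : Fin d → ℝ)
    (ψ : ℝ → (Fin d → ℝ) → (Fin d → ℝ)) (r : ℕ) : Prop :=
  ∃ φ : ℝ → (Fin d → ℝ) → (Fin d → ℝ), IsLocalFlow f x₀ φ ∧
    (fun p : ℝ × (Fin d → ℝ) => ψ p.1 p.2 - φ p.1 p.2) =O[𝓝 (0, x₀)]
      (fun p : ℝ × (Fin d → ℝ) => p.1 ^ (r + 1))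

/-- `ψ'` is the adjoint integrator of `ψ` near `x₀`, that is, `ψ'_h = (ψ_{-h})⁻¹`. -/
structure IsAdjoint {d : ℕ} (x₀ : Fin d → ℝ)
    (ψ ψ' : ℝ → (Fin d → ℝ) → (Fin d → ℝ)) : Prop where
  continuousAt : Tendsto (fun p : ℝ × (Fin d → ℝ) => ψ' p.1 p.2) (𝓝 (0, x₀)) (𝓝 x₀)
  right_inv : ∀ᶠ p : ℝ × (Fin d → ℝ) in 𝓝 (0, x₀), ψ (-p.1) (ψ' p.1 p.2) = p.2
  left_inv : ∀ᶠ p : ℝ × (Fin d → ℝ) in 𝓝 (0, x₀), ψ' p.1 (ψ (-p.1) p.2) = p.2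

/-- `ψ` is pseudo-symmetric of pseudo-symmetry order (at least) `q` near `x₀`: the adjoint exists
and `ψ*_h = ψ_h + O(h^{q+1})`, uniformly for initial values near `x₀`. -/
def IsPseudoSymmetric {d : ℕ} (x₀ : Fin d → ℝ)
    (ψ : ℝ → (Fin d → ℝ) → (Fin d → ℝ)) (q : ℕ) : Prop :=
  ∃ ψ' : ℝ → (Fin d → ℝ) → (Fin d → ℝ), IsAdjoint x₀ ψ ψ' ∧
    (fun p : ℝ × (Fin d → ℝ) => ψ' p.1 p.2 - ψ p.1 p.2) =O[𝓝 (0, x₀)]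
      (fun p : ℝ × (Fin d → ℝ) => p.1 ^ (q + 1))

/-- A point of `ℝ^d`, seen as a point of `ℂ^d`. -/
def complexify {d : ℕ} (x : Fin d → ℝ) : Fin d → ℂ := fun i => (x i : ℂ)

/-- Projection on the real axis at each step: a real step `h` of the complex integrator `ψ` from
the real point `x`, followed by taking the real part of the result. -/
def realPart {d : ℕ} (ψ : ℂ → (Fin d → ℂ) → (Fin d → ℂ)) (h : ℝ) (x : Fin d → ℝ) :
    Fin d → ℝ :=
  fun i => (ψ (h : ℂ) (complexify x) i).re

/-- `S` is a time-symmetric second-order method for the real system `x' = f x` near `x₀`. As it is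
to be used with complex steps, `S` is holomorphic in the step and the state; it maps real points
to real points when the step is real. -/
structure IsTimeSymmetricOrderTwo {d : ℕ} (f : (Fin d → ℝ) → (Fin d → ℝ)) (x₀ : Fin d → ℝ)
    (S : ℂ → (Fin d → ℂ) → (Fin d → ℂ)) : Prop where
  analyticAt_field : AnalyticAt ℝ f x₀
  analyticAt : AnalyticAt ℂ (fun p : ℂ × (Fin d → ℂ) => S p.1 p.2) (0, complexify x₀)
  real : ∀ᶠ p : ℝ × (Fin d → ℝ) in 𝓝 (0, x₀), ∀ i, (S (p.1 : ℂ) (complexify p.2) i).im = 0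
  order_two : HasOrder f x₀ (realPart S) 2
  symmetric : ∀ᶠ p : ℂ × (Fin d → ℂ) in 𝓝 (0, complexify x₀), S p.1 (S (-p.1) p.2) = p.2

/-- The composition `S_{α_s h} ∘ ⋯ ∘ S_{α_2 h} ∘ S_{α_1 h}`. -/
def composition {d s : ℕ} (S : ℂ → (Fin d → ℂ) → (Fin d → ℂ)) (α : Fin s → ℂ) (h : ℂ)
    (z : Fin d → ℂ) : Fin d → ℂ :=
  (List.ofFn α).foldl (fun y a => S (a * h) y) z

/-- The symmetric-conjugate pattern `α_{s+1-j} = conj α_j`. -/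
def IsSymmetricConjugate {s : ℕ} (α : Fin s → ℂ) : Prop :=
  ∀ j, α j.rev = (starRingEnd ℂ) (α j)

/-! ### The graded free Lie algebra on `F = Y₁, Y₃, Y₅, …`

The generator `Y_{2k+1}` is `FreeLieAlgebra.of ℝ k`; in particular `F` is the generator number `0`.
It has degree `2k+1`, the power of `h` that accompanies it. -/

/-- `x` is a nested bracket of generators, of total degree `m`. -/
inductive IsBracket : ℕ → FreeLieAlgebra ℝ ℕ → Prop
  | of (k : ℕ) : IsBracket (2 * k + 1) (FreeLieAlgebra.of ℝ k)
  | lie {a b : ℕ} {x y : FreeLieAlgebra ℝ ℕ} (hx : IsBracket a x) (hy : IsBracket b y) :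
      IsBracket (a + b) ⁅x, y⁆

/-- The homogeneous component `𝓛_m` of the free Lie algebra. -/
def component (m : ℕ) : Submodule ℝ (FreeLieAlgebra ℝ ℕ) :=
  Submodule.span ℝ {x | IsBracket m x}

theorem IsBracket.pos {m : ℕ} {x : FreeLieAlgebra ℝ ℕ} (h : IsBracket m x) : 0 < m := by
  induction h with
  | of k => omega
  | lie _ _ h1 h2 => omega

theorem finite_isBracket (m : ℕ) : {x | IsBracket m x}.Finite := by
  induction m using Nat.strong_induction_on with
  | _ m ih =>
    have h1 : (⋃ a ∈ Set.Iio m, ⋃ b ∈ Set.Iio m,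
        Set.image2 (fun x y : FreeLieAlgebra ℝ ℕ => ⁅x, y⁆)
          {x | IsBracket a x} {x | IsBracket b x}).Finite :=
      (Set.finite_Iio m).biUnion fun a ha => (Set.finite_Iio m).biUnion fun b hb =>
        (ih a ha).image2 _ (ih b hb)
    refine ((Set.finite_singleton (FreeLieAlgebra.of ℝ (m / 2))).union h1).subset ?_
    intro x hx
    cases hx with
    | of k =>
      left
      have : (2 * k + 1) / 2 = k := by omega
      simp [this]
    | @lie a b x y hx hy =>
      right
      have ha := hx.pos
      have hb := hy.pos
      simp only [Set.mem_iUnion]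
      exact ⟨a, by simp only [Set.mem_Iio]; omega, b, by simp only [Set.mem_Iio]; omega,
        x, hx, y, hy, rfl⟩

/-- The homogeneous components are finite-dimensional, so that their dimensions `c` are genuine. -/
instance (m : ℕ) : Module.Finite ℝ (component m) :=
  Module.Finite.span_of_finite ℝ (finite_isBracket m)

/-- `c(m) = dim 𝓛_m`. -/
def c (m : ℕ) : ℕ := Module.finrank ℝ (component m)

/-- `N^{[r]} = c(1) + ⋯ + c(r)`. -/
def numConditions (r : ℕ) : ℕ := ∑ m ∈ Finset.Icc 1 r, c m

/-! ### The series of operators of a composition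

Formal power series in `h` whose coefficients are noncommutative polynomials in `F, Y₃, Y₅, …`. -/

/-- The exponential of a series without constant term. -/
def expSeries (X : PowerSeries (FreeAlgebra ℂ ℕ)) : PowerSeries (FreeAlgebra ℂ ℕ) :=
  PowerSeries.mk fun m =>
    ∑ k ∈ Finset.range (m + 1), ((k.factorial : ℂ)⁻¹) • PowerSeries.coeff m (X ^ k)

/-- The logarithm of a series with constant term `1`. -/
def logSeries (P : PowerSeries (FreeAlgebra ℂ ℕ)) : PowerSeries (FreeAlgebra ℂ ℕ) :=
  PowerSeries.mk fun m =>
    ∑ k ∈ Finset.Icc 1 m, ((-1 : ℂ) ^ (k + 1) / (k : ℂ)) • PowerSeries.coeff m ((P - 1) ^ k)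

/-- `a h F + a³ h³ Y₃ + a⁵ h⁵ Y₅ + ⋯`, the exponent of the series of `S_{a h}`. -/
def stageExponent (a : ℂ) : PowerSeries (FreeAlgebra ℂ ℕ) :=
  PowerSeries.mk fun m => if Odd m then a ^ m • FreeAlgebra.ι ℂ (m / 2) else 0

/-- `V(h)`, with `exp V(h)` the series of operators of `S_{α_s h} ∘ ⋯ ∘ S_{α_1 h}`. A series acts
on functions `g` by `g ↦ g ∘ ψ_h`, so the operator of the first stage stands on the left. -/
def exponent {s : ℕ} (α : Fin s → ℂ) : PowerSeries (FreeAlgebra ℂ ℕ) :=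
  logSeries (List.ofFn fun j => expSeries (stageExponent (α j))).prod

attribute [local instance] LieRing.ofAssociativeRing

/-- The canonical map from the free Lie algebra to noncommutative polynomials, which sends the
bracket to the commutator. -/
def toPoly : FreeLieAlgebra ℝ ℕ →ₗ⁅ℝ⁆ FreeAlgebra ℂ ℕ :=
  FreeLieAlgebra.lift ℝ fun k => FreeAlgebra.ι ℂ k

/-- `V(h) = ∑_m h^m ∑_k w_{m,k} E_{m,k}`: the `w_{m,k}` are the coordinates of `V(h)` in the
homogeneous bases `E`. -/
def IsCoordinates {s : ℕ} (E : (m : ℕ) → Module.Basis (Fin (c m)) ℝ (component m))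
    (α : Fin s → ℂ) (w : (m : ℕ) → Fin (c m) → ℂ) : Prop :=
  ∀ m, PowerSeries.coeff m (exponent α) =
    ∑ k, w m k • toPoly ((E m k : component m) : FreeLieAlgebra ℝ ℕ)

/-! ### Order conditions -/

/-- The indices `(m,k)`, `1 ≤ m ≤ 2n`, of all order conditions for order `2n`, except for those at
`h^{2n}, h^{2n-2}, …, h^{2n-2q}`. -/
def retained (n q : ℕ) : Finset ((m : ℕ) × Fin (c m)) :=
  ((Finset.Icc 1 (2 * n)).filter fun m => ∀ j ≤ q, m ≠ 2 * n - 2 * j).sigma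
    fun _ => Finset.univ

/-- The order condition with index `(m,k)`: `w_1 = 1` for `m = 1`, and `w_{m,k} = 0` for `m > 1`. -/
def OrderCondition (w : (m : ℕ) → Fin (c m) → ℂ) (i : (m : ℕ) × Fin (c m)) : Prop :=
  w i.1 i.2 = if i.1 = 1 then 1 else 0

end SymConj

end

noncomputable section

namespace SymConj

/-! ### Formal power series over a noncommutative algebra -/

section Formal

open PowerSeries Finset

variable {A : Type*} [Ring A]

/-- The coefficients of `X` below degree `N` vanish. -/
def VanishesTo (N : ℕ) (X : PowerSeries A) : Prop := ∀ m < N, coeff m X = 0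

theorem VanishesTo.mono {N M : ℕ} {X : PowerSeries A} (h : VanishesTo N X) (hM : M ≤ N) :
    VanishesTo M X := fun m hm => h m (hm.trans_le hM)

theorem VanishesTo.zero (N : ℕ) : VanishesTo N (0 : PowerSeries A) := fun m _ => by simp

theorem VanishesTo.zero_left (X : PowerSeries A) : VanishesTo 0 X := fun m hm => by omega

theorem VanishesTo.add {N : ℕ} {X Y : PowerSeries A} (hX : VanishesTo N X)
    (hY : VanishesTo N Y) : VanishesTo N (X + Y) := fun m hm => by
  rw [map_add, hX m hm, hY m hm, add_zero]

theorem VanishesTo.neg {N : ℕ} {X : PowerSeries A} (hX : VanishesTo N X) :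
    VanishesTo N (-X) := fun m hm => by rw [map_neg, hX m hm, neg_zero]

theorem VanishesTo.sub {N : ℕ} {X Y : PowerSeries A} (hX : VanishesTo N X)
    (hY : VanishesTo N Y) : VanishesTo N (X - Y) := fun m hm => by
  rw [map_sub, hX m hm, hY m hm, sub_zero]

theorem VanishesTo.mul {N M : ℕ} {X Y : PowerSeries A} (hX : VanishesTo N X)
    (hY : VanishesTo M Y) : VanishesTo (N + M) (X * Y) := fun m hm => by
  rw [PowerSeries.coeff_mul]
  refine Finset.sum_eq_zero fun p hp => ?_
  rw [HasAntidiagonal.mem_antidiagonal] at hp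
  by_cases h : p.1 < N
  · rw [hX _ h, zero_mul]
  · rw [hY p.2 (by omega), mul_zero]

theorem VanishesTo.mul_left {N : ℕ} {Y : PowerSeries A} (X : PowerSeries A)
    (hY : VanishesTo N Y) : VanishesTo N (X * Y) := by
  simpa using (VanishesTo.zero_left X).mul hY

theorem VanishesTo.mul_right {N : ℕ} {X : PowerSeries A} (hX : VanishesTo N X)
    (Y : PowerSeries A) : VanishesTo N (X * Y) := by
  simpa using hX.mul (VanishesTo.zero_left Y)

theorem VanishesTo.pow {V : PowerSeries A} (hV : VanishesTo 1 V) (k : ℕ) :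
    VanishesTo k (V ^ k) := by
  induction k with
  | zero => exact VanishesTo.zero_left _
  | succ k ih => rw [pow_succ]; exact ih.mul hV

theorem vanishesTo_one_iff {V : PowerSeries A} : VanishesTo 1 V ↔ coeff 0 V = 0 :=
  ⟨fun h => h 0 (by omega), fun h m hm => by obtain rfl : m = 0 := by omega
                                             exact h⟩

/-- The sum of a family of series whose `k`-th member vanishes to order `k`. -/
def psum (T : ℕ → PowerSeries A) : PowerSeries A :=
  mk fun m => ∑ k ∈ range (m + 1), coeff m (T k)

theorem coeff_psum {T : ℕ → PowerSeries A} (hT : ∀ k, VanishesTo k (T k)) {m N : ℕ}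
    (h : m < N) : coeff m (psum T) = ∑ k ∈ range N, coeff m (T k) := by
  rw [psum, coeff_mk]
  refine sum_subset (range_subset_range.2 h) fun k _ hk => hT k m ?_
  simpa using hk

theorem coeff_psum_eq_sum {T : ℕ → PowerSeries A} (hT : ∀ k, VanishesTo k (T k)) {m N : ℕ}
    (h : m < N) : coeff m (psum T) = coeff m (∑ k ∈ range N, T k) := by
  rw [coeff_psum hT h, map_sum]

theorem vanishesTo_psum_sub {T : ℕ → PowerSeries A} (hT : ∀ k, VanishesTo k (T k)) (N : ℕ) :
    VanishesTo N (psum T - ∑ k ∈ range N, T k) := fun m hm => by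
  rw [map_sub, coeff_psum_eq_sum hT hm, sub_self]

theorem sum_range_antidiagonal {M : Type*} [AddCommMonoid M] (N : ℕ) (g : ℕ × ℕ → M)
    (hg : ∀ x, N ≤ x.1 + x.2 → g x = 0) :
    ∑ n ∈ range N, ∑ x ∈ antidiagonal n, g x = ∑ i ∈ range N, ∑ k ∈ range N, g (i, k) := by
  rw [← sum_product', ← sum_filter_add_sum_filter_not (range N ×ˢ range N) (fun x => x.1 + x.2 < N)]
  have h0 : ∑ x ∈ range N ×ˢ range N with ¬ x.1 + x.2 < N, g (x.1, x.2) = 0 := by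
    refine sum_eq_zero fun x hx => ?_
    simp only [mem_filter] at hx
    exact hg x (by omega)
  rw [h0, add_zero]
  · rw [← sum_fiberwise_of_maps_to (s := filter _ _) (t := range N) (g := fun x : ℕ × ℕ => x.1 + x.2)]
    · refine sum_congr rfl fun n hn => sum_congr ?_ fun _ _ => rfl
      ext ⟨a, b⟩
      simp only [HasAntidiagonal.mem_antidiagonal, mem_filter, mem_product, Finset.mem_range] at *
      omega
    · intro x hx
      simp only [mem_filter, mem_product, Finset.mem_range] at *
      omega

theorem psum_mul_psum {T U : ℕ → PowerSeries A} (hT : ∀ k, VanishesTo k (T k))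
    (hU : ∀ k, VanishesTo k (U k)) :
    psum T * psum U = psum fun n => ∑ x ∈ antidiagonal n, T x.1 * U x.2 := by
  have hTU : ∀ n, VanishesTo n (∑ x ∈ antidiagonal n, T x.1 * U x.2) := by
    intro n m hm
    rw [map_sum]
    refine sum_eq_zero fun x hx => ?_
    rw [HasAntidiagonal.mem_antidiagonal] at hx
    exact ((hT x.1).mul (hU x.2)) m (by omega)
  ext m
  rw [coeff_psum hTU (Nat.lt_succ_self m)]
  simp only [map_sum]
  rw [sum_range_antidiagonal _ (fun x => coeff m (T x.1 * U x.2))]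
  · simp only [← map_sum, ← mul_sum, ← sum_mul]
    have h1 := vanishesTo_psum_sub hT (m + 1)
    have h2 := vanishesTo_psum_sub hU (m + 1)
    have h3 := (h1.mul_right (psum U)).add (h2.mul_left (∑ k ∈ range (m + 1), T k))
    have h4 := h3 m (Nat.lt_succ_self m)
    rw [← sub_eq_zero, ← map_sub, ← h4]
    congr 1
    noncomm_ring
  · intro x hx
    exact ((hT x.1).mul (hU x.2)) m (by omega)

theorem psum_congr {T U : ℕ → PowerSeries A} (h : ∀ k, T k = U k) : psum T = psum U := by
  rw [funext h]

theorem psum_add (T U : ℕ → PowerSeries A) : psum T + psum U = psum fun k => T k + U k := by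
  ext m; simp [psum, sum_add_distrib]

theorem mul_psum {T : ℕ → PowerSeries A} (hT : ∀ k, VanishesTo k (T k)) (Y : PowerSeries A) :
    Y * psum T = psum fun k => Y * T k := by
  ext m
  rw [coeff_psum_eq_sum (fun k => (hT k).mul_left Y) (Nat.lt_succ_self m), ← mul_sum,
    ← sub_eq_zero, ← map_sub, ← mul_sub]
  exact (vanishesTo_psum_sub hT (m + 1)).mul_left Y m (Nat.lt_succ_self m)

/-- `Y exp V = exp V ∑ (-ad_V)^k Y / k!`. -/
theorem vanishesTo_pow_sub_pow {N : ℕ} {V W : PowerSeries A} (h : VanishesTo N (V - W)) (k : ℕ) :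
    VanishesTo N (V ^ k - W ^ k) := by
  induction k with
  | zero => simpa using VanishesTo.zero N
  | succ k ih =>
    have : V ^ (k + 1) - W ^ (k + 1) = (V ^ k - W ^ k) * V + W ^ k * (V - W) := by
      rw [pow_succ, pow_succ]; noncomm_ring
    rw [this]
    exact (ih.mul_right _).add (h.mul_left _)

theorem vanishesTo_psum {T : ℕ → PowerSeries A} {N : ℕ} (hT : ∀ k, VanishesTo N (T k)) :
    VanishesTo N (psum T) := fun m hm => by
  rw [psum, coeff_mk]
  exact sum_eq_zero fun k _ => hT k m hm

theorem psum_sub (T U : ℕ → PowerSeries A) : psum T - psum U = psum fun k => T k - U k := by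
  ext m; simp [psum, sum_sub_distrib]

/-- `(-ad_V)^k Y`. -/
def adPow (V Y : PowerSeries A) : ℕ → PowerSeries A
  | 0 => Y
  | k + 1 => adPow V Y k * V - V * adPow V Y k

theorem VanishesTo.adPow {N : ℕ} {V Y : PowerSeries A} (hV : VanishesTo 1 V)
    (hY : VanishesTo N Y) (k : ℕ) : VanishesTo (k + N) (adPow V Y k) := by
  induction k with
  | zero => simpa [SymConj.adPow] using hY
  | succ k ih =>
    exact ((ih.mul hV).mono (by omega)).sub ((hV.mul ih).mono (by omega))

variable [Algebra ℂ A]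

theorem VanishesTo.smul {N : ℕ} {X : PowerSeries A} (c : ℂ) (hX : VanishesTo N X) :
    VanishesTo N (c • X) := fun m hm => by rw [coeff_smul, hX m hm, smul_zero]

/-- The value of the one-variable series `f` at a series `V` without constant term. -/
def evalSeries (f : PowerSeries ℂ) (V : PowerSeries A) : PowerSeries A :=
  psum fun k => coeff k f • V ^ k

theorem vanishesTo_smul_pow {V : PowerSeries A} (hV : VanishesTo 1 V) (f : ℕ → ℂ) (k : ℕ) :
    VanishesTo k (f k • V ^ k) := (hV.pow k).smul _

theorem evalSeries_mul {V : PowerSeries A} (hV : VanishesTo 1 V) (f g : PowerSeries ℂ) :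
    evalSeries (f * g) V = evalSeries f V * evalSeries g V := by
  rw [evalSeries, evalSeries, evalSeries, psum_mul_psum (vanishesTo_smul_pow hV _)
    (vanishesTo_smul_pow hV _)]
  refine psum_congr fun n => ?_
  rw [PowerSeries.coeff_mul, sum_smul]
  refine sum_congr rfl fun x hx => ?_
  rw [HasAntidiagonal.mem_antidiagonal] at hx
  rw [smul_mul_smul_comm, ← pow_add, hx]

theorem evalSeries_one (V : PowerSeries A) : evalSeries 1 V = 1 := by
  ext m
  rw [evalSeries, psum, coeff_mk, sum_eq_single 0]
  · simp
  · intro k _ hk; simp [PowerSeries.coeff_one, hk]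
  · simp

theorem evalSeries_X {V : PowerSeries A} (hV : VanishesTo 1 V) :
    evalSeries (X : PowerSeries ℂ) V = V := by
  ext m
  rw [evalSeries, coeff_psum (vanishesTo_smul_pow hV _) (show m < m + 2 by omega),
    sum_eq_single 1]
  · simp
  · intro k _ hk; simp [PowerSeries.coeff_X, hk]
  · simp

theorem evalSeries_add (f g : PowerSeries ℂ) (V : PowerSeries A) :
    evalSeries (f + g) V = evalSeries f V + evalSeries g V := by
  rw [evalSeries, evalSeries, evalSeries, psum_add]
  exact psum_congr fun k => by rw [map_add, add_smul]

theorem evalSeries_pow {V : PowerSeries A} (hV : VanishesTo 1 V) (f : PowerSeries ℂ) (k : ℕ) :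
    evalSeries (f ^ k) V = evalSeries f V ^ k := by
  induction k with
  | zero => rw [pow_zero, pow_zero, evalSeries_one]
  | succ k ih => rw [pow_succ, evalSeries_mul hV, ih, pow_succ]

theorem VanishesTo.evalSeries {f : PowerSeries ℂ} (hf : VanishesTo 1 f) (V : PowerSeries A) :
    VanishesTo 1 (evalSeries f V) := by
  rw [vanishesTo_one_iff] at hf ⊢
  rw [SymConj.evalSeries, psum, coeff_mk]
  simp [hf]

theorem evalSeries_evalSeries {V : PowerSeries A} (hV : VanishesTo 1 V) (f : PowerSeries ℂ)
    {g : PowerSeries ℂ} (hg : VanishesTo 1 g) :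
    evalSeries f (evalSeries g V) = evalSeries (evalSeries f g) V := by
  ext m
  rw [evalSeries, coeff_psum (vanishesTo_smul_pow (hg.evalSeries V) _) (Nat.lt_succ_self m)]
  conv_rhs => rw [evalSeries, coeff_psum (vanishesTo_smul_pow hV _) (Nat.lt_succ_self m)]
  simp_rw [← evalSeries_pow hV, coeff_smul]
  have h1 : ∀ k, coeff m (evalSeries (g ^ k) V)
      = ∑ j ∈ range (m + 1), coeff j (g ^ k) • coeff m (V ^ j) := fun k => by
    rw [evalSeries, coeff_psum (vanishesTo_smul_pow hV _) (Nat.lt_succ_self m)]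
    simp only [coeff_smul]
  simp_rw [h1, smul_sum]
  rw [sum_comm]
  refine sum_congr rfl fun j hj => ?_
  rw [evalSeries, coeff_psum (vanishesTo_smul_pow hg _) (Finset.mem_range.1 hj), sum_smul]
  simp [mul_smul]

/-- The exponential of a series without constant term. -/
def formalExp (V : PowerSeries A) : PowerSeries A :=
  psum fun k => ((k.factorial : ℂ)⁻¹) • V ^ k

/-- The logarithm of a series with constant term `1`. -/
def formalLog (P : PowerSeries A) : PowerSeries A :=
  mk fun m => ∑ k ∈ Finset.Icc 1 m, ((-1 : ℂ) ^ (k + 1) / (k : ℂ)) • coeff m ((P - 1) ^ k)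

theorem logSeries_eq (P : PowerSeries (FreeAlgebra ℂ ℕ)) : logSeries P = formalLog P := rfl

/-- The series `exp`. -/
def expCoeffs : PowerSeries ℂ := mk fun k => (k.factorial : ℂ)⁻¹

/-- The series `log (1 + X)`. -/
def logCoeffs : PowerSeries ℂ := mk fun k => if k = 0 then 0 else (-1 : ℂ) ^ (k + 1) / (k : ℂ)

theorem formalExp_eq (V : PowerSeries A) : formalExp V = evalSeries expCoeffs V := by
  simp [formalExp, evalSeries, expCoeffs]

theorem formalLog_eq (P : PowerSeries A) : formalLog P = evalSeries logCoeffs (P - 1) := by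
  ext m
  simp only [formalLog, evalSeries, logCoeffs, psum, coeff_mk, coeff_smul]
  rw [sum_range_succ', if_pos rfl, zero_smul, add_zero, Finset.range_eq_Ico,
    Finset.sum_Ico_add' (fun k : ℕ => (if k = 0 then (0 : ℂ) else (-1) ^ (k + 1) / (k : ℂ))
      • coeff m ((P - 1) ^ k)) 0 m 1]
  refine sum_congr ?_ fun k hk => ?_
  · ext k; simp only [Finset.mem_Icc, Finset.mem_Ico]; omega
  · rw [if_neg]
    simp only [Finset.mem_Ico] at hk; omega

theorem vanishesTo_logCoeffs : VanishesTo 1 logCoeffs :=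
  vanishesTo_one_iff.2 (by simp [logCoeffs])

theorem vanishesTo_formalLog (P : PowerSeries A) : VanishesTo 1 (formalLog P) := by
  rw [formalLog_eq]; exact vanishesTo_logCoeffs.evalSeries _

/-! #### The derivation `h d/dh` and the exponential -/

/-- The derivation `h d/dh`. -/
def theta (X : PowerSeries A) : PowerSeries A := mk fun m => (m : ℂ) • coeff m X

theorem coeff_theta (m : ℕ) (X : PowerSeries A) : coeff m (theta X) = (m : ℂ) • coeff m X := by
  rw [theta, coeff_mk]

theorem theta_mul (X Y : PowerSeries A) : theta (X * Y) = theta X * Y + X * theta Y := by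
  ext m
  rw [coeff_theta, map_add, PowerSeries.coeff_mul, PowerSeries.coeff_mul, PowerSeries.coeff_mul,
    ← sum_add_distrib, smul_sum]
  refine sum_congr rfl fun x hx => ?_
  rw [HasAntidiagonal.mem_antidiagonal] at hx
  rw [coeff_theta, coeff_theta, smul_mul_assoc, mul_smul_comm, ← add_smul, ← hx]
  push_cast; rfl

theorem theta_smul (c : ℂ) (X : PowerSeries A) : theta (c • X) = c • theta X := by
  ext m; simp only [coeff_theta, coeff_smul, smul_comm c]

theorem VanishesTo.theta {N : ℕ} {X : PowerSeries A} (hX : VanishesTo N X) :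
    VanishesTo N (theta X) := fun m hm => by rw [coeff_theta, hX m hm, smul_zero]

theorem vanishesTo_theta (X : PowerSeries A) : VanishesTo 1 (theta X) :=
  vanishesTo_one_iff.2 (by rw [coeff_theta]; simp)

/-- The divided power `V ^ k / k!`. -/
def divPow (V : PowerSeries A) (k : ℕ) : PowerSeries A := ((k.factorial : ℂ)⁻¹) • V ^ k

theorem divPow_mul (V : PowerSeries A) (k : ℕ) :
    divPow V k * V = ((k : ℂ) + 1) • divPow V (k + 1) := by
  have h : ((k : ℂ) + 1) ≠ 0 := by exact_mod_cast k.succ_ne_zero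
  rw [divPow, divPow, smul_smul, Nat.factorial_succ, smul_mul_assoc, ← pow_succ]
  congr 1
  push_cast
  field_simp

theorem divPow_mul_mul (V Y : PowerSeries A) (k : ℕ) :
    divPow V k * Y * V
      = ((k + 1 : ℕ) : ℂ) • (divPow V (k + 1) * Y) + divPow V k * (Y * V - V * Y) := by
  rw [← smul_mul_assoc, Nat.cast_succ, ← divPow_mul]
  noncomm_ring

theorem mul_divPow (V Y : PowerSeries A) (n : ℕ) :
    Y * divPow V n = ∑ x ∈ antidiagonal n, divPow V x.1 * ((x.2.factorial : ℂ)⁻¹ • adPow V Y x.2) := by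
  induction n with
  | zero => simp [divPow, adPow]
  | succ n ih =>
    have h : ((n : ℂ) + 1) ≠ 0 := by exact_mod_cast n.succ_ne_zero
    refine smul_right_injective _ h ?_
    simp only
    rw [← mul_smul_comm, ← divPow_mul, ← mul_assoc, ih, sum_mul, smul_sum]
    have e1 : ∑ x ∈ antidiagonal (n + 1), ((n : ℂ) + 1) •
        (divPow V x.1 * ((x.2.factorial : ℂ)⁻¹ • adPow V Y x.2))
        = ∑ x ∈ antidiagonal (n + 1), (x.1 : ℂ) •
          (divPow V x.1 * ((x.2.factorial : ℂ)⁻¹ • adPow V Y x.2))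
        + ∑ x ∈ antidiagonal (n + 1), (x.2 : ℂ) •
          (divPow V x.1 * ((x.2.factorial : ℂ)⁻¹ • adPow V Y x.2)) := by
      rw [← sum_add_distrib]
      refine sum_congr rfl fun x hx => ?_
      rw [HasAntidiagonal.mem_antidiagonal] at hx
      rw [← add_smul]; congr 1; exact_mod_cast hx.symm
    rw [e1, Finset.Nat.sum_antidiagonal_succ, Finset.Nat.sum_antidiagonal_succ']
    simp only [Nat.cast_zero, zero_smul, zero_add, ← sum_add_distrib]
    refine sum_congr rfl fun x _ => ?_
    have h2 : ((x.2 : ℂ) + 1) ≠ 0 := by exact_mod_cast x.2.succ_ne_zero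
    have e2 : ((x.2 + 1 : ℕ) : ℂ) • ((((x.2 + 1).factorial : ℕ) : ℂ)⁻¹ • adPow V Y (x.2 + 1))
        = (x.2.factorial : ℂ)⁻¹ • adPow V Y (x.2 + 1) := by
      rw [smul_smul, Nat.factorial_succ]; congr 1; push_cast; field_simp
    rw [← mul_smul_comm (((x.2 + 1 : ℕ) : ℂ)), e2, divPow_mul_mul, adPow, smul_mul_assoc,
      mul_smul_comm (_ : ℂ) V, smul_sub]

theorem theta_divPow_succ (V : PowerSeries A) (n : ℕ) :
    theta (divPow V (n + 1)) = ∑ x ∈ antidiagonal n,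
      divPow V x.1 * (((x.2 + 1).factorial : ℂ)⁻¹ • adPow V (theta V) x.2) := by
  induction n with
  | zero => simp [divPow, adPow]
  | succ n ih =>
    have h : (((n + 1 : ℕ) : ℂ) + 1) ≠ 0 := by exact_mod_cast (n + 1).succ_ne_zero
    refine smul_right_injective _ h ?_
    simp only
    rw [← theta_smul, ← divPow_mul, theta_mul, ih, sum_mul, smul_sum]
    have e1 : ∑ x ∈ antidiagonal (n + 1), (((n + 1 : ℕ) : ℂ) + 1) •
        (divPow V x.1 * (((x.2 + 1).factorial : ℂ)⁻¹ • adPow V (theta V) x.2))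
        = ∑ x ∈ antidiagonal (n + 1), (x.1 : ℂ) •
          (divPow V x.1 * (((x.2 + 1).factorial : ℂ)⁻¹ • adPow V (theta V) x.2))
        + ∑ x ∈ antidiagonal (n + 1), ((x.2 : ℂ) + 1) •
          (divPow V x.1 * (((x.2 + 1).factorial : ℂ)⁻¹ • adPow V (theta V) x.2)) := by
      rw [← sum_add_distrib]
      refine sum_congr rfl fun x hx => ?_
      rw [HasAntidiagonal.mem_antidiagonal] at hx
      rw [← add_smul, ← hx]; congr 1; push_cast; ring
    rw [e1, Finset.Nat.sum_antidiagonal_succ, Finset.Nat.sum_antidiagonal_succ']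
    simp only [Nat.cast_zero, zero_smul, zero_add, Nat.factorial_one, Nat.cast_one, inv_one,
      one_smul]
    rw [add_left_comm, ← sum_add_distrib, add_comm]
    refine congrArg₂ _ (by rw [adPow]) ?_
    refine sum_congr rfl fun x _ => ?_
    have h2 : ((x.2 : ℂ) + 1 + 1) ≠ 0 := by exact_mod_cast (x.2 + 1).succ_ne_zero
    have e2 : (((x.2 + 1 : ℕ) : ℂ) + 1) • ((((x.2 + 1 + 1).factorial : ℕ) : ℂ)⁻¹ •
          adPow V (theta V) (x.2 + 1))
        = ((x.2 + 1).factorial : ℂ)⁻¹ • adPow V (theta V) (x.2 + 1) := by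
      rw [smul_smul, Nat.factorial_succ (x.2 + 1)]; congr 1; push_cast; field_simp
    rw [← mul_smul_comm (((x.2 + 1 : ℕ) : ℂ) + 1), e2, divPow_mul_mul, adPow, smul_mul_assoc,
      mul_smul_comm (_ : ℂ) V, smul_sub]

theorem formalExp_eq_psum (V : PowerSeries A) : formalExp V = psum (divPow V) := rfl

theorem vanishesTo_divPow {V : PowerSeries A} (hV : VanishesTo 1 V) (k : ℕ) :
    VanishesTo k (divPow V k) := (hV.pow k).smul _

theorem mul_formalExp {V : PowerSeries A} (hV : VanishesTo 1 V) (Y : PowerSeries A) :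
    Y * formalExp V = formalExp V * psum fun k => (k.factorial : ℂ)⁻¹ • adPow V Y k := by
  rw [formalExp_eq_psum, mul_psum (vanishesTo_divPow hV), psum_mul_psum (vanishesTo_divPow hV)
    (fun k => ((hV.adPow (VanishesTo.zero_left Y) k).mono (by omega)).smul _)]
  exact psum_congr fun n => mul_divPow V Y n

/-- `h d/dh (exp V) = exp V ∑ (-ad_V)^k (h V') / (k+1)!`. -/
theorem theta_formalExp {V : PowerSeries A} (hV : VanishesTo 1 V) :
    theta (formalExp V) =
      formalExp V * psum fun k => ((k + 1).factorial : ℂ)⁻¹ • adPow V (theta V) k := by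
  rw [formalExp_eq_psum, psum_mul_psum (vanishesTo_divPow hV)
    (fun k => ((hV.adPow (VanishesTo.zero_left _) k).mono (by omega)).smul _)]
  simp_rw [← theta_divPow_succ]
  ext m
  rw [coeff_theta, coeff_psum (vanishesTo_divPow hV) (show m < m + 2 by omega),
    coeff_psum (fun k => (((vanishesTo_divPow hV (k + 1)).theta).mono (by omega)))
      (Nat.lt_succ_self m), sum_range_succ', smul_add, smul_sum]
  simp only [coeff_theta]
  have : (m : ℂ) • coeff m (divPow V 0) = 0 := by
    by_cases hm : m = 0
    · simp [hm]
    · simp [divPow, PowerSeries.coeff_one, hm]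
  rw [this, add_zero]

theorem constantCoeff_formalExp (V : PowerSeries A) : coeff 0 (formalExp V) = 1 := by
  simp [formalExp, psum]

theorem formalExp_logCoeffs : formalExp logCoeffs = (1 + X : PowerSeries ℂ) := by
  have h1 := theta_formalExp vanishesTo_logCoeffs
  have h0 : ∀ k, 1 ≤ k → adPow logCoeffs (theta logCoeffs) k = 0 := by
    intro k hk
    obtain ⟨k, rfl⟩ := Nat.exists_eq_add_of_le' hk
    rw [adPow, mul_comm, sub_self]
  have h2 : (psum fun k => ((k + 1).factorial : ℂ)⁻¹ • adPow logCoeffs (theta logCoeffs) k)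
      = theta logCoeffs := by
    ext m
    rw [psum, coeff_mk, sum_eq_single 0]
    · simp [adPow]
    · intro k _ hk; rw [h0 k (by omega)]; simp
    · simp
  have h3 : theta logCoeffs * (1 + X) = (X : PowerSeries ℂ) := by
    ext m
    rw [mul_add, mul_one, map_add]
    cases m with
    | zero => simp [coeff_theta]
    | succ m =>
      rw [PowerSeries.coeff_succ_mul_X, coeff_theta, coeff_theta, logCoeffs, coeff_mk, coeff_mk,
        PowerSeries.coeff_X]
      have hm : ((m : ℂ) + 1) ≠ 0 := by exact_mod_cast m.succ_ne_zero
      by_cases h : m = 0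
      · simp [h]
      · have hm' : (m : ℂ) ≠ 0 := by exact_mod_cast h
        simp only [Nat.succ_ne_zero, h, if_false, smul_eq_mul, Nat.cast_succ]
        rw [if_neg (by omega)]
        field_simp
        ring
  rw [h2] at h1
  have h4 : theta (formalExp logCoeffs) * (1 + X) = formalExp logCoeffs * X := by
    rw [h1, mul_assoc, h3]
  have h5 : ∀ m : ℕ, ((m : ℂ) + 1) * coeff (m + 1) (formalExp logCoeffs)
      + m * coeff m (formalExp logCoeffs) = coeff m (formalExp logCoeffs) := by
    intro m
    have := congrArg (coeff (m + 1)) h4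
    rw [mul_add, mul_one, map_add, PowerSeries.coeff_succ_mul_X, PowerSeries.coeff_succ_mul_X,
      coeff_theta, coeff_theta] at this
    simpa using this
  have c0 := constantCoeff_formalExp logCoeffs
  have c1 : coeff 1 (formalExp logCoeffs) = 1 := by
    have := h5 0
    rw [c0] at this
    simpa using this
  have c2 : ∀ m : ℕ, coeff (m + 2) (formalExp logCoeffs) = 0 := by
    intro m
    have hm : ((m : ℂ) + 1 + 1) ≠ 0 := by exact_mod_cast (m + 1).succ_ne_zero
    have := h5 (m + 1)
    push_cast at this
    induction m with
    | zero =>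
      rw [zero_add, c1] at this
      have h6 : (1 + 1 : ℂ) * coeff 2 (formalExp logCoeffs) = 0 := by simpa using this
      rcases mul_eq_zero.1 h6 with h | h
      · norm_num at h
      · exact h
    | succ m ih =>
      rw [show m + 1 + 1 = m + 2 by ring, ih (by exact_mod_cast (m + 1).succ_ne_zero)
        (by exact_mod_cast h5 (m + 1)), mul_zero, add_zero] at this
      rcases mul_eq_zero.1 this with h | h
      · exact absurd h (by exact_mod_cast hm)
      · exact h
  ext m
  match m with
  | 0 => rw [c0]; simp
  | 1 => rw [c1, map_add]; simp [PowerSeries.coeff_one]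
  | m + 2 => rw [c2, map_add]; simp [PowerSeries.coeff_one, PowerSeries.coeff_X]

theorem formalExp_formalLog {P : PowerSeries A} (hP : coeff 0 P = 1) :
    formalExp (formalLog P) = P := by
  have h1 : VanishesTo 1 (P - 1) := vanishesTo_one_iff.2 (by rw [map_sub, hP]; simp)
  rw [formalLog_eq, formalExp_eq, evalSeries_evalSeries h1 _ vanishesTo_logCoeffs,
    ← formalExp_eq, formalExp_logCoeffs, evalSeries_add, evalSeries_one, evalSeries_X h1,
    add_sub_cancel]

theorem formalExp_mul_formalExp_neg {V : PowerSeries A} (hV : VanishesTo 1 V) :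
    formalExp V * formalExp (-V) = 1 := by
  have h1 : formalExp (-V) = evalSeries (mk fun k => (-1) ^ k * (k.factorial : ℂ)⁻¹) V := by
    refine psum_congr fun k => ?_
    rw [coeff_mk, neg_pow, mul_comm ((-1 : ℂ) ^ k), mul_smul]
    congr 1
    rcases Nat.even_or_odd k with h | h <;> simp [h.neg_one_pow]
  rw [h1, formalExp_eq, ← evalSeries_mul hV]
  have : (expCoeffs * mk fun k => (-1) ^ k * (k.factorial : ℂ)⁻¹) = 1 := by
    have := PowerSeries.exp_mul_exp_neg_eq_one (A := ℂ)
    rw [← this]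
    congr 1
    · ext k; simp [expCoeffs, PowerSeries.coeff_exp]
    · ext k; simp [PowerSeries.evalNegHom, PowerSeries.coeff_exp]
  rw [this, evalSeries_one]

theorem formalExp_neg_mul_formalExp {V : PowerSeries A} (hV : VanishesTo 1 V) :
    formalExp (-V) * formalExp V = 1 := by
  simpa using formalExp_mul_formalExp_neg hV.neg

/-! #### Truncations of the exponential -/

theorem vanishesTo_formalExp_sub {N : ℕ} {V W : PowerSeries A} (h : VanishesTo N (V - W)) :
    VanishesTo N (formalExp V - formalExp W) := by
  rw [formalExp, formalExp, psum_sub]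
  refine vanishesTo_psum fun k => ?_
  rw [← smul_sub]
  exact (vanishesTo_pow_sub_pow h k).smul _

theorem vanishesTo_of_formalExp_sub {V W : PowerSeries A} (hV : VanishesTo 1 V)
    (hW : VanishesTo 1 W) {N : ℕ} (h : VanishesTo N (formalExp V - formalExp W)) :
    VanishesTo N (V - W) := by
  induction N with
  | zero => exact VanishesTo.zero_left _
  | succ N ih =>
    have h1 := ih (h.mono (by omega))
    have hpow : ∀ k, k ≠ 1 → VanishesTo (N + 1) (V ^ k - W ^ k) := by
      intro k hk
      rcases k with _ | _ | k
      · simpa using VanishesTo.zero _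
      · simp at hk
      · have : V ^ (k + 2) - W ^ (k + 2)
            = (V ^ (k + 1) - W ^ (k + 1)) * V + W ^ (k + 1) * (V - W) := by
          rw [pow_succ, pow_succ W (k + 1)]; noncomm_ring
        rw [this]
        refine ((vanishesTo_pow_sub_pow h1 _).mul hV).add ?_
        refine VanishesTo.mono (N := (k + 1) + N) ?_ (by omega)
        exact (hW.pow (k + 1)).mul h1
    have h2 : VanishesTo (N + 1) ((formalExp V - formalExp W) - (V - W)) := by
      have e : (formalExp V - formalExp W) - (V - W) = psum fun k =>
          if k = 1 then 0 else (k.factorial : ℂ)⁻¹ • (V ^ k - W ^ k) := by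
        have e2 : V - W = psum fun k => if k = 1 then V - W else 0 := by
          ext m
          rw [coeff_psum (N := m + 2) (fun k => ?_) (by omega), sum_eq_single 1]
          · simp
          · intro k _ hk; simp [hk]
          · simp
          · split_ifs with hk
            · rw [hk]; exact hV.sub hW
            · exact VanishesTo.zero _
        conv_lhs => rw [e2]
        rw [formalExp, formalExp, psum_sub, psum_sub]
        refine psum_congr fun k => ?_
        by_cases hk : k = 1
        · simp [hk]
        · simp [hk, smul_sub]
      rw [e]
      refine vanishesTo_psum fun k => ?_
      split_ifs with hk
      · exact VanishesTo.zero _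
      · exact (hpow k hk).smul _
    simpa using h.sub h2

theorem formalExp_injective {V W : PowerSeries A} (hV : VanishesTo 1 V)
    (hW : VanishesTo 1 W) (h : formalExp V = formalExp W) : V = W := by
  ext m
  have := vanishesTo_of_formalExp_sub hV hW (N := m + 1) (by rw [h, sub_self]; exact VanishesTo.zero _)
  simpa [sub_eq_zero] using this m (by omega)

theorem vanishesTo_formalExp_add_sub {N : ℕ} (V : PowerSeries A) {U : PowerSeries A}
    (hU : VanishesTo N U) :
    VanishesTo (2 * N) (formalExp (V + U) + formalExp (V - U) - (formalExp V + formalExp V)) := by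
  have key : ∀ k, VanishesTo N ((V + U) ^ k - (V - U) ^ k) ∧
      VanishesTo (2 * N) ((V + U) ^ k + (V - U) ^ k - (V ^ k + V ^ k)) := by
    intro k
    induction k with
    | zero => simpa using ⟨VanishesTo.zero _, VanishesTo.zero _⟩
    | succ k ih =>
      refine ⟨vanishesTo_pow_sub_pow (by simpa using hU.add hU) _, ?_⟩
      have : (V + U) ^ (k + 1) + (V - U) ^ (k + 1) - (V ^ (k + 1) + V ^ (k + 1))
          = V * ((V + U) ^ k + (V - U) ^ k - (V ^ k + V ^ k))
            + U * ((V + U) ^ k - (V - U) ^ k) := by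
        rw [pow_succ', pow_succ' (V - U), pow_succ' V]; noncomm_ring
      rw [this, two_mul]
      rw [two_mul] at ih
      exact (ih.2.mul_left _).add (hU.mul ih.1)
  rw [formalExp, formalExp, formalExp, psum_add, psum_add, psum_sub]
  refine vanishesTo_psum fun k => ?_
  rw [← smul_add, ← smul_add, ← smul_sub]
  exact (key k).2.smul _

/-! #### Functoriality and scaling -/

theorem map_formalExp {B : Type*} [Ring B] [Algebra ℂ B] (Φ : A →+* B) (V : PowerSeries A) :
    PowerSeries.map Φ (formalExp V) = formalExp (PowerSeries.map Φ V) := by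
  ext m
  simp only [formalExp, psum, coeff_mk, coeff_smul, PowerSeries.coeff_map, ← map_pow, map_sum]
  exact sum_congr rfl fun k _ => map_inv_natCast_smul Φ ℂ ℂ _ _

/-- The series `X(a h)`. -/
def scale (a : ℂ) (X : PowerSeries A) : PowerSeries A := mk fun m => a ^ m • coeff m X

theorem coeff_scale (a : ℂ) (m : ℕ) (X : PowerSeries A) :
    coeff m (scale a X) = a ^ m • coeff m X := by rw [scale, coeff_mk]

theorem scale_mul (a : ℂ) (X Y : PowerSeries A) : scale a (X * Y) = scale a X * scale a Y := by
  ext m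
  rw [coeff_scale, PowerSeries.coeff_mul, PowerSeries.coeff_mul, smul_sum]
  refine sum_congr rfl fun x hx => ?_
  rw [HasAntidiagonal.mem_antidiagonal] at hx
  rw [coeff_scale, coeff_scale, smul_mul_smul_comm, ← pow_add, hx]

theorem scale_one (a : ℂ) : scale a (1 : PowerSeries A) = 1 := by
  ext m
  rw [coeff_scale, PowerSeries.coeff_one]
  split_ifs with h <;> simp [h]

theorem scale_pow (a : ℂ) (X : PowerSeries A) (k : ℕ) : scale a (X ^ k) = scale a X ^ k := by
  induction k with
  | zero => simp [scale_one]
  | succ k ih => rw [pow_succ, scale_mul, ih, pow_succ]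

theorem scale_formalExp (a : ℂ) (V : PowerSeries A) :
    scale a (formalExp V) = formalExp (scale a V) := by
  ext m
  simp only [formalExp, psum, coeff_mk, coeff_scale, coeff_smul, ← scale_pow, smul_sum]
  exact sum_congr rfl fun k _ => smul_comm _ _ _

theorem VanishesTo.scale {N : ℕ} {X : PowerSeries A} (a : ℂ) (hX : VanishesTo N X) :
    VanishesTo N (scale a X) := fun m hm => by rw [coeff_scale, hX m hm, smul_zero]

theorem scale_list_prod (a : ℂ) (l : List (PowerSeries A)) :
    scale a l.prod = (l.map (scale a)).prod := by
  induction l with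
  | nil => simp [scale_one]
  | cons x l ih => simp [scale_mul, ih]

end Formal

end SymConj

end

noncomputable section

namespace SymConj

/-! ### Series of Lie elements -/

section LieSeries

open PowerSeries Finset

variable {A : Type*} [Ring A]

theorem coeff_commutator (X Y : PowerSeries A) (m : ℕ) :
    coeff m (X * Y - Y * X) = ∑ p ∈ antidiagonal m,
      (coeff p.1 X * coeff p.2 Y - coeff p.2 Y * coeff p.1 X) := by
  rw [map_sub, PowerSeries.coeff_mul, PowerSeries.coeff_mul, sum_sub_distrib]
  congr 1
  exact (Finset.Nat.sum_antidiagonal_swap (n := m)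
    (f := fun p : ℕ × ℕ => coeff p.1 Y * coeff p.2 X)).symm

variable [Algebra ℂ A]

/-- `𝔤` is a family of subspaces that is graded for the commutator. -/
def IsLieGraded (𝔤 : ℕ → Submodule ℂ A) : Prop :=
  ∀ a b x y, x ∈ 𝔤 a → y ∈ 𝔤 b → x * y - y * x ∈ 𝔤 (a + b)

/-- Every coefficient of `X` lies in the component of its degree. -/
def IsLieSeries (𝔤 : ℕ → Submodule ℂ A) (X : PowerSeries A) : Prop := ∀ m, coeff m X ∈ 𝔤 m

variable {𝔤 : ℕ → Submodule ℂ A}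

theorem IsLieSeries.adPow (h𝔤 : IsLieGraded 𝔤) {V Y : PowerSeries A} (hV : IsLieSeries 𝔤 V)
    (hY : IsLieSeries 𝔤 Y) (k : ℕ) : IsLieSeries 𝔤 (adPow V Y k) := by
  induction k with
  | zero => exact hY
  | succ k ih =>
    intro m
    rw [SymConj.adPow, coeff_commutator]
    refine Submodule.sum_mem _ fun p hp => ?_
    rw [HasAntidiagonal.mem_antidiagonal] at hp
    rw [← hp]
    exact h𝔤 _ _ _ _ (ih _) (hV _)

theorem IsLieSeries.add {X Y : PowerSeries A} (hX : IsLieSeries 𝔤 X) (hY : IsLieSeries 𝔤 Y) :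
    IsLieSeries 𝔤 (X + Y) := fun m => by rw [map_add]; exact add_mem (hX m) (hY m)

theorem IsLieSeries.psum {T : ℕ → PowerSeries A} (hT : ∀ k, IsLieSeries 𝔤 (T k)) :
    IsLieSeries 𝔤 (psum T) := fun m => by
  rw [SymConj.psum, coeff_mk]
  exact Submodule.sum_mem _ fun k _ => hT k m

theorem IsLieSeries.smul {X : PowerSeries A} (c : ℂ) (hX : IsLieSeries 𝔤 X) :
    IsLieSeries 𝔤 (c • X) := fun m => by rw [coeff_smul]; exact Submodule.smul_mem _ _ (hX m)

theorem IsLieSeries.theta {X : PowerSeries A} (hX : IsLieSeries 𝔤 X) :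
    IsLieSeries 𝔤 (theta X) := fun m => by
  rw [coeff_theta]; exact Submodule.smul_mem _ _ (hX m)

/-- The logarithmic derivative `P⁻¹ (h P')` is a series of Lie elements. -/
def HasLieLogDeriv (𝔤 : ℕ → Submodule ℂ A) (P : PowerSeries A) : Prop :=
  ∃ L, IsLieSeries 𝔤 L ∧ theta P = P * L

theorem hasLieLogDeriv_one (𝔤 : ℕ → Submodule ℂ A) : HasLieLogDeriv 𝔤 (1 : PowerSeries A) := by
  refine ⟨0, fun m => by simp, ?_⟩
  ext m
  rw [coeff_theta, PowerSeries.coeff_one, mul_zero]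
  split_ifs with h <;> simp [h]

theorem HasLieLogDeriv.mul_formalExp (h𝔤 : IsLieGraded 𝔤) {P X : PowerSeries A}
    (hP : HasLieLogDeriv 𝔤 P) (hX : IsLieSeries 𝔤 X) (hX1 : VanishesTo 1 X) :
    HasLieLogDeriv 𝔤 (P * formalExp X) := by
  obtain ⟨L, hL, hPL⟩ := hP
  refine ⟨_, (IsLieSeries.psum fun k => (hX.adPow h𝔤 hL k).smul (k.factorial : ℂ)⁻¹).add
    (IsLieSeries.psum fun k => (hX.adPow h𝔤 hX.theta k).smul ((k + 1).factorial : ℂ)⁻¹), ?_⟩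
  rw [theta_mul, hPL, mul_assoc, SymConj.mul_formalExp hX1, theta_formalExp hX1]
  noncomm_ring

theorem HasLieLogDeriv.isLieSeries_log (h𝔤 : IsLieGraded 𝔤) {V : PowerSeries A}
    (hV : VanishesTo 1 V) (h : HasLieLogDeriv 𝔤 (formalExp V)) : IsLieSeries 𝔤 V := by
  obtain ⟨L, hL, hVL⟩ := h
  have h1 : L = psum fun k => ((k + 1).factorial : ℂ)⁻¹ • adPow V (theta V) k := by
    rw [theta_formalExp hV] at hVL
    have := congrArg (formalExp (-V) * ·) hVL
    simp only [← mul_assoc, formalExp_neg_mul_formalExp hV, one_mul] at this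
    exact this.symm
  intro m
  induction m using Nat.strong_induction_on with
  | _ m ih =>
    rcases Nat.eq_zero_or_pos m with rfl | hm
    · rw [vanishesTo_one_iff.1 hV]; exact zero_mem _
    have key : ∀ k, ∀ j, (k = 0 ∧ j < m) ∨ (1 ≤ k ∧ j ≤ m) →
        coeff j (adPow V (theta V) k) ∈ 𝔤 j := by
      intro k
      induction k with
      | zero =>
        intro j hj
        rw [adPow, coeff_theta]
        exact Submodule.smul_mem _ _ (ih j (by omega))
      | succ k ihk =>
        intro j hj
        rw [adPow, coeff_commutator]
        refine Submodule.sum_mem _ fun p hp => ?_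
        rw [HasAntidiagonal.mem_antidiagonal] at hp
        by_cases hp1 : p.1 = 0
        · rw [hp1, hV.adPow (vanishesTo_theta V) k 0 (by omega)]
          simp
        by_cases hp2 : p.2 = 0
        · rw [hp2, vanishesTo_one_iff.1 hV]; simp
        rw [← hp]
        refine h𝔤 _ _ _ _ (ihk _ ?_) (ih _ (by omega))
        rcases Nat.eq_zero_or_pos k with hk | hk
        · left; omega
        · right; omega
    have h2 := hL m
    rw [h1, psum, coeff_mk, sum_range_succ'] at h2
    have h3 : ∑ k ∈ range m, coeff m (((k + 1 + 1).factorial : ℂ)⁻¹ •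
        adPow V (theta V) (k + 1)) ∈ 𝔤 m :=
      Submodule.sum_mem _ fun k _ => by
        rw [coeff_smul]
        exact Submodule.smul_mem _ _ (key _ _ (by right; omega))
    have h4 := (Submodule.add_mem_iff_right _ h3).1 h2
    rw [coeff_smul, adPow, coeff_theta] at h4
    have hm' : (m : ℂ) ≠ 0 := by exact_mod_cast hm.ne'
    have h5 := Submodule.smul_mem _ (m : ℂ)⁻¹ h4
    simpa [smul_smul, hm'] using h5

end LieSeries

/-! ### The free Lie algebra inside the noncommutative polynomials -/

section FreeLie

open PowerSeries

attribute [local instance] LieRing.ofAssociativeRing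

theorem toPoly_of (k : ℕ) : toPoly (FreeLieAlgebra.of ℝ k) = FreeAlgebra.ι ℂ k := by
  rw [toPoly, FreeLieAlgebra.lift_of_apply]

theorem toPoly_lie (x y : FreeLieAlgebra ℝ ℕ) :
    toPoly ⁅x, y⁆ = toPoly x * toPoly y - toPoly y * toPoly x := by
  rw [LieHom.map_lie, LieRing.of_associative_ring_bracket]

theorem toPoly_smul (r : ℝ) (x : FreeLieAlgebra ℝ ℕ) : toPoly (r • x) = (r : ℂ) • toPoly x := by
  rw [map_smul]
  exact (algebraMap_smul ℂ r (toPoly x)).symm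

/-- The complex span of the homogeneous component `𝓛_m`. -/
def polyComponent (m : ℕ) : Submodule ℂ (FreeAlgebra ℂ ℕ) :=
  Submodule.span ℂ (toPoly '' {x | IsBracket m x})

theorem isLieGraded_polyComponent : IsLieGraded polyComponent := by
  intro a b x y hx hy
  induction hx using Submodule.span_induction with
  | zero => simp
  | add x x' _ _ h h' =>
    rw [add_mul, mul_add, add_sub_add_comm]; exact add_mem h h'
  | smul c x _ h =>
    rw [smul_mul_assoc, mul_smul_comm, ← smul_sub]; exact Submodule.smul_mem _ _ h
  | mem x hx =>
    induction hy using Submodule.span_induction with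
    | zero => simp
    | add y y' _ _ h h' =>
      rw [add_mul, mul_add, add_sub_add_comm]; exact add_mem h h'
    | smul c y _ h =>
      rw [smul_mul_assoc, mul_smul_comm, ← smul_sub]; exact Submodule.smul_mem _ _ h
    | mem y hy =>
      obtain ⟨u, hu, rfl⟩ := hx
      obtain ⟨v, hv, rfl⟩ := hy
      rw [← toPoly_lie]
      exact Submodule.subset_span ⟨_, hu.lie hv, rfl⟩

theorem isLieSeries_stageExponent (a : ℂ) : IsLieSeries polyComponent (stageExponent a) := by
  intro m
  rw [stageExponent, coeff_mk]
  split_ifs with h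
  · refine Submodule.smul_mem _ _ (Submodule.subset_span ⟨FreeLieAlgebra.of ℝ (m / 2), ?_, toPoly_of _⟩)
    have h2 : 2 * (m / 2) + 1 = m := by obtain ⟨k, rfl⟩ := h; omega
    have := IsBracket.of (m / 2)
    rwa [h2] at this
  · exact zero_mem _

theorem vanishesTo_stageExponent (a : ℂ) : VanishesTo 1 (stageExponent a) :=
  vanishesTo_one_iff.2 (by rw [stageExponent, coeff_mk]; simp)

/-- The series of operators of the composition with the stages `l`. -/
def stageProd (l : List ℂ) : PowerSeries (FreeAlgebra ℂ ℕ) :=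
  (l.map fun a => formalExp (stageExponent a)).prod

theorem exponent_eq {s : ℕ} (α : Fin s → ℂ) :
    exponent α = formalLog (stageProd (List.ofFn α)) := by
  rw [exponent, logSeries_eq, stageProd, List.map_ofFn]; rfl

theorem coeff_zero_stageProd (l : List ℂ) : coeff 0 (stageProd l) = 1 := by
  induction l with
  | nil => simp [stageProd]
  | cons a l ih =>
    rw [stageProd, List.map_cons, List.prod_cons, ← stageProd, PowerSeries.coeff_mul,
      Finset.HasAntidiagonal.antidiagonal_zero, Finset.sum_singleton, constantCoeff_formalExp, ih, one_mul]

theorem hasLieLogDeriv_stageProd (l : List ℂ) : HasLieLogDeriv polyComponent (stageProd l) := by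
  induction l using List.reverseRecOn with
  | nil => simpa [stageProd] using hasLieLogDeriv_one _
  | append_singleton l a ih =>
    rw [stageProd, List.map_append, List.prod_append, ← stageProd, List.map_singleton,
      List.prod_singleton]
    exact ih.mul_formalExp isLieGraded_polyComponent (isLieSeries_stageExponent a)
      (vanishesTo_stageExponent a)

theorem vanishesTo_exponent {s : ℕ} (α : Fin s → ℂ) : VanishesTo 1 (exponent α) := by
  rw [exponent_eq]; exact vanishesTo_formalLog _

theorem formalExp_exponent {s : ℕ} (α : Fin s → ℂ) :
    formalExp (exponent α) = stageProd (List.ofFn α) := by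
  rw [exponent_eq, formalExp_formalLog (coeff_zero_stageProd _)]

theorem isLieSeries_exponent {s : ℕ} (α : Fin s → ℂ) :
    IsLieSeries polyComponent (exponent α) :=
  HasLieLogDeriv.isLieSeries_log isLieGraded_polyComponent (vanishesTo_exponent α)
    (by rw [formalExp_exponent]; exact hasLieLogDeriv_stageProd _)

/-! #### Injectivity on the homogeneous components -/

/-- The operator `(t, v) ↦ (0, t m u + ⁅u, v⁆)`. -/
def weightedAd (m : ℝ) (u : FreeLieAlgebra ℝ ℕ) :
    Module.End ℝ (ℝ × FreeLieAlgebra ℝ ℕ) :=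
  LinearMap.prod 0 ((LinearMap.fst ℝ ℝ (FreeLieAlgebra ℝ ℕ)).smulRight (m • u)
    + (LieAlgebra.ad ℝ (FreeLieAlgebra ℝ ℕ) u : Module.End ℝ (FreeLieAlgebra ℝ ℕ)) ∘ₗ
      LinearMap.snd ℝ ℝ (FreeLieAlgebra ℝ ℕ))

theorem weightedAd_apply (m : ℝ) (u : FreeLieAlgebra ℝ ℕ) (p : ℝ × FreeLieAlgebra ℝ ℕ) :
    weightedAd m u p = (0, p.1 • m • u + ⁅u, p.2⁆) := rfl

theorem weightedAd_lie (a b : ℝ) (u v : FreeLieAlgebra ℝ ℕ) :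
    weightedAd (a + b) ⁅u, v⁆
      = weightedAd a u * weightedAd b v - weightedAd b v * weightedAd a u := by
  refine LinearMap.ext fun p => ?_
  rw [LinearMap.sub_apply, Module.End.mul_apply, Module.End.mul_apply]
  simp only [weightedAd_apply, zero_smul, zero_add, Prod.mk_sub_mk, sub_zero, lie_add, lie_smul,
    lie_lie]
  congr 1
  rw [← lie_skew v u]
  module

/-- The representation of the noncommutative polynomials which sends `Y_{2k+1}` to the operator
`(t, v) ↦ (0, t (2k+1) Y_{2k+1} + ⁅Y_{2k+1}, v⁆)`. -/
def dynkinRep :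
    FreeAlgebra ℂ ℕ →ₐ[ℂ] Module.End ℂ (TensorProduct ℝ ℂ (ℝ × FreeLieAlgebra ℝ ℕ)) :=
  FreeAlgebra.lift ℂ fun k => (weightedAd ((2 * k + 1 : ℕ) : ℝ) (FreeLieAlgebra.of ℝ k)).baseChange ℂ

theorem dynkinRep_toPoly {m : ℕ} {u : FreeLieAlgebra ℝ ℕ} (hu : IsBracket m u) :
    dynkinRep (toPoly u) = (weightedAd (m : ℝ) u).baseChange ℂ := by
  induction hu with
  | of k => rw [toPoly_of, dynkinRep, FreeAlgebra.lift_ι_apply]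
  | @lie a b x y _ _ hx hy =>
    rw [toPoly_lie, map_sub, map_mul, map_mul, hx, hy, Nat.cast_add, weightedAd_lie,
      LinearMap.baseChange_sub, LinearMap.baseChange_mul, LinearMap.baseChange_mul]

theorem dynkinRep_toPoly_apply {m : ℕ} {u : FreeLieAlgebra ℝ ℕ} (hu : u ∈ component m) :
    dynkinRep (toPoly u) ((1 : ℂ) ⊗ₜ[ℝ] ((1 : ℝ), (0 : FreeLieAlgebra ℝ ℕ)))
      = (1 : ℂ) ⊗ₜ[ℝ] ((0 : ℝ), (m : ℝ) • u) := by
  induction hu using Submodule.span_induction with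
  | mem u hu =>
    rw [dynkinRep_toPoly hu, LinearMap.baseChange_tmul, weightedAd_apply]
    simp
  | zero => simp [← Prod.zero_eq_mk]
  | add x y _ _ hx hy =>
    rw [map_add, map_add, LinearMap.add_apply, hx, hy, ← TensorProduct.tmul_add, Prod.mk_add_mk,
      add_zero, smul_add]
  | smul r x _ hx =>
    rw [toPoly_smul, map_smul, LinearMap.smul_apply, hx, TensorProduct.smul_tmul', Complex.coe_smul,
      TensorProduct.smul_tmul, Prod.smul_mk, smul_zero, smul_comm]

theorem component_zero : component 0 = ⊥ := by
  rw [component, Submodule.span_eq_bot]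
  intro x hx
  exact absurd (IsBracket.pos hx) (lt_irrefl _)

/-- The canonical images of linearly independent elements of `𝓛_m` are linearly independent
over `ℂ`. -/
theorem toPoly_linearIndependent {m : ℕ} {ι : Type*} (e : ι → component m)
    (he : LinearIndependent ℝ e) :
    LinearIndependent ℂ fun k => toPoly (e k : FreeLieAlgebra ℝ ℕ) := by
  classical
  rcases Nat.eq_zero_or_pos m with rfl | hm
  · have : IsEmpty ι := ⟨fun k => he.ne_zero k (by
      have h0 : (e k : FreeLieAlgebra ℝ ℕ) ∈ (⊥ : Submodule ℝ (FreeLieAlgebra ℝ ℕ)) :=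
        component_zero ▸ (e k).2
      exact Subtype.ext ((Submodule.mem_bot ℝ).1 h0))⟩
    exact linearIndependent_empty_type
  have hm' : (m : ℝ) ≠ 0 := by exact_mod_cast hm.ne'
  rw [linearIndependent_iff'] 
  intro t w hw j hj
  have he' : LinearIndependent ℝ fun k => ((0 : ℝ), (m : ℝ) • (e k : FreeLieAlgebra ℝ ℕ)) := by
    rw [linearIndependent_iff'] at he ⊢
    intro t' g hg
    refine he t' g (Subtype.ext ?_)
    have h0 := congrArg Prod.snd hg
    simp only [Prod.snd_sum, Prod.smul_mk, smul_comm _ (m : ℝ), ← Finset.smul_sum] at h0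
    simpa using (smul_eq_zero.1 h0).resolve_left hm'
  obtain ⟨ℓ, hℓ⟩ := LinearMap.exists_leftInverse_of_injective _ 
    (LinearMap.ker_eq_bot.2 he')
  have h1 := congrArg (fun x => dynkinRep x ((1 : ℂ) ⊗ₜ[ℝ] ((1 : ℝ), (0 : FreeLieAlgebra ℝ ℕ)))) hw
  simp only [map_sum, map_smul, LinearMap.sum_apply, LinearMap.smul_apply, map_zero,
    LinearMap.zero_apply, dynkinRep_toPoly_apply (e _).2] at h1
  have h2 := congrArg (fun x => Algebra.TensorProduct.rid ℝ ℂ ℂ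
    (((Finsupp.lapply j : (ι →₀ ℝ) →ₗ[ℝ] ℝ) ∘ₗ ℓ).baseChange ℂ x)) h1
  have h3 : ∀ k, ℓ ((0 : ℝ), (m : ℝ) • (e k : FreeLieAlgebra ℝ ℕ)) = Finsupp.single k 1 := by
    intro k
    have := LinearMap.congr_fun hℓ (Finsupp.single k 1)
    simpa using this
  simp only [map_sum, map_smul, LinearMap.baseChange_tmul, LinearMap.comp_apply, h3,
    Finsupp.lapply_apply, Algebra.TensorProduct.rid_tmul, map_zero, Finsupp.single_apply] at h2
  simpa [Finset.sum_ite_eq, hj] using h2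

theorem toPoly_mem_polyComponent {m : ℕ} {u : FreeLieAlgebra ℝ ℕ} (hu : IsBracket m u)
    (E : Module.Basis (Fin (c m)) ℝ (component m)) :
    toPoly u ∈ Submodule.span ℂ (Set.range fun k => toPoly (E k : FreeLieAlgebra ℝ ℕ)) := by
  have h1 := E.sum_repr ⟨u, Submodule.subset_span hu⟩
  have h2 : u = ∑ k, E.repr ⟨u, Submodule.subset_span hu⟩ k • (E k : FreeLieAlgebra ℝ ℕ) := by
    have := congrArg (Submodule.subtype _) h1
    simp only [map_sum, map_smul] at this
    exact this.symm
  have h3 : toPoly u = ∑ k, toPoly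
      (E.repr ⟨u, Submodule.subset_span hu⟩ k • (E k : FreeLieAlgebra ℝ ℕ)) := by
    conv_lhs => rw [h2]
    exact map_sum toPoly _ _
  rw [h3]
  refine Submodule.sum_mem _ fun k _ => ?_
  rw [toPoly_smul]
  exact Submodule.smul_mem _ _ (Submodule.subset_span ⟨k, rfl⟩)

theorem existsUnique_isCoordinates {s : ℕ} (α : Fin s → ℂ)
    (E : (m : ℕ) → Module.Basis (Fin (c m)) ℝ (component m)) :
    ∃! w : (m : ℕ) → Fin (c m) → ℂ, IsCoordinates E α w := by
  have h1 : ∀ m, ∃ w : Fin (c m) → ℂ, coeff m (exponent α) =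
      ∑ k, w k • toPoly ((E m k : component m) : FreeLieAlgebra ℝ ℕ) := by
    intro m
    have h2 : polyComponent m ≤ Submodule.span ℂ
        (Set.range fun k => toPoly (E m k : FreeLieAlgebra ℝ ℕ)) := by
      rw [polyComponent, Submodule.span_le]
      rintro _ ⟨u, hu, rfl⟩
      exact toPoly_mem_polyComponent hu _
    obtain ⟨w, hw⟩ := (Submodule.mem_span_range_iff_exists_fun ℂ).1
      (h2 (isLieSeries_exponent α m))
    exact ⟨w, hw.symm⟩
  choose w hw using h1
  refine ⟨w, hw, fun w' hw' => ?_⟩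
  funext m k
  have h3 : ∑ k, (w' m k - w m k) • toPoly ((E m k : component m) : FreeLieAlgebra ℝ ℕ) = 0 := by
    simp only [sub_smul, Finset.sum_sub_distrib]
    rw [← hw' m, ← hw m, sub_self]
  exact sub_eq_zero.1 (Fintype.linearIndependent_iff.1
    (toPoly_linearIndependent _ (E m).linearIndependent) _ h3 k)

end FreeLie

end SymConj

end

noncomputable section

namespace SymConj

/-! ### Complex conjugation of noncommutative polynomials -/

section Conjugation

open PowerSeries

/-- Conjugation of the coefficients of a noncommutative polynomial. -/
def conjPoly : FreeAlgebra ℂ ℕ →+* FreeAlgebra ℂ ℕ :=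
  ((FreeAlgebra.equivMonoidAlgebraFreeMonoid (R := ℂ) (X := ℕ)).symm : _ →+* _).comp
    ((MonoidAlgebra.mapRingHom (FreeMonoid ℕ) (starRingEnd ℂ)).comp
      (FreeAlgebra.equivMonoidAlgebraFreeMonoid (R := ℂ) (X := ℕ) : _ →+* _))

theorem conjPoly_ι (k : ℕ) : conjPoly (FreeAlgebra.ι ℂ k) = FreeAlgebra.ι ℂ k := by
  have h : FreeAlgebra.equivMonoidAlgebraFreeMonoid (R := ℂ) (FreeAlgebra.ι ℂ k)
      = MonoidAlgebra.single (FreeMonoid.of k) 1 := by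
    simp [FreeAlgebra.equivMonoidAlgebraFreeMonoid]
  simp only [conjPoly, RingHom.comp_apply]
  change FreeAlgebra.equivMonoidAlgebraFreeMonoid.symm (MonoidAlgebra.mapRingHom _ _
    (FreeAlgebra.equivMonoidAlgebraFreeMonoid (FreeAlgebra.ι ℂ k))) = _
  rw [h, MonoidAlgebra.mapRingHom_single, map_one, ← h, AlgEquiv.symm_apply_apply]

theorem conjPoly_smul (a : ℂ) (x : FreeAlgebra ℂ ℕ) :
    conjPoly (a • x) = (starRingEnd ℂ) a • conjPoly x := by
  have h : conjPoly (algebraMap ℂ _ a) = algebraMap ℂ _ ((starRingEnd ℂ) a) := by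
    simp only [conjPoly, RingHom.comp_apply]
    change FreeAlgebra.equivMonoidAlgebraFreeMonoid.symm (MonoidAlgebra.mapRingHom _ _
      (FreeAlgebra.equivMonoidAlgebraFreeMonoid (algebraMap ℂ _ a))) = _
    rw [AlgEquiv.commutes, MonoidAlgebra.coe_algebraMap, Function.comp_apply,
      MonoidAlgebra.mapRingHom_single]
    rw [← AlgEquiv.commutes FreeAlgebra.equivMonoidAlgebraFreeMonoid.symm,
      MonoidAlgebra.coe_algebraMap, Function.comp_apply]
    rfl
  rw [Algebra.smul_def, map_mul, h, Algebra.smul_def]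

theorem conjPoly_toPoly {m : ℕ} {u : FreeLieAlgebra ℝ ℕ} (hu : u ∈ component m) :
    conjPoly (toPoly u) = toPoly u := by
  induction hu using Submodule.span_induction with
  | zero => simp
  | add x y _ _ hx hy => rw [map_add, map_add, hx, hy]
  | smul r x _ hx => rw [toPoly_smul, conjPoly_smul, hx, Complex.conj_ofReal]
  | mem u hu =>
    induction hu with
    | of k => rw [toPoly_of, conjPoly_ι]
    | lie _ _ hx hy => rw [toPoly_lie, map_sub, map_mul, map_mul, hx, hy]

theorem map_conjPoly_stageExponent (a : ℂ) :
    PowerSeries.map conjPoly (stageExponent a) = stageExponent ((starRingEnd ℂ) a) := by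
  ext m
  rw [PowerSeries.coeff_map, stageExponent, stageExponent, coeff_mk, coeff_mk]
  split_ifs
  · rw [conjPoly_smul, conjPoly_ι, map_pow]
  · simp

theorem map_conjPoly_stageProd (l : List ℂ) :
    PowerSeries.map conjPoly (stageProd l) = stageProd (l.map (starRingEnd ℂ)) := by
  simp only [stageProd, map_list_prod, List.map_map]
  congr 2
  funext a
  simp only [Function.comp_apply, map_formalExp, map_conjPoly_stageExponent]

theorem IsSymmetricConjugate.map_conj {s : ℕ} {α : Fin s → ℂ} (hα : IsSymmetricConjugate α) :
    (List.ofFn α).map (starRingEnd ℂ) = (List.ofFn α).reverse := by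
  refine List.ext_getElem (by simp) fun i h1 h2 => ?_
  have hi : i < s := by simpa using h1
  rw [List.getElem_map, List.getElem_ofFn, List.getElem_reverse, List.getElem_ofFn, ← hα]
  congr 1
  ext
  simp only [Fin.val_rev, List.length_ofFn]
  omega

/-! ### Symmetry of the exponent -/

theorem scale_neg_one_stageExponent (a : ℂ) :
    scale (-1) (stageExponent a) = -stageExponent a := by
  ext m
  rw [coeff_scale, map_neg, stageExponent, coeff_mk]
  split_ifs with h
  · rw [h.neg_one_pow, neg_one_smul]
  · simp

theorem scale_stageProd_reverse_mul (l : List ℂ) :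
    scale (-1) (stageProd l.reverse) * stageProd l = 1 := by
  induction l with
  | nil => simp [stageProd, scale_one]
  | cons a l ih =>
    have h1 : stageProd (a :: l).reverse = stageProd l.reverse * formalExp (stageExponent a) := by
      simp [stageProd]
    have h2 : stageProd (a :: l) = formalExp (stageExponent a) * stageProd l := by
      simp [stageProd]
    rw [h1, h2, scale_mul, scale_formalExp, scale_neg_one_stageExponent, mul_assoc,
      ← mul_assoc (formalExp (-_)), formalExp_neg_mul_formalExp (vanishesTo_stageExponent a),
      one_mul, ih]

/-- The exponent of the composition with the stages `l`. -/
def stageLog (l : List ℂ) : PowerSeries (FreeAlgebra ℂ ℕ) := formalLog (stageProd l)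

theorem vanishesTo_stageLog (l : List ℂ) : VanishesTo 1 (stageLog l) := vanishesTo_formalLog _

theorem formalExp_stageLog (l : List ℂ) : formalExp (stageLog l) = stageProd l :=
  formalExp_formalLog (coeff_zero_stageProd l)

theorem scale_stageLog_reverse (l : List ℂ) :
    scale (-1) (stageLog l.reverse) = -stageLog l := by
  refine formalExp_injective ((vanishesTo_stageLog _).scale _) (vanishesTo_stageLog _).neg ?_
  have h1 := formalExp_mul_formalExp_neg (vanishesTo_stageLog l)
  have h2 := scale_stageProd_reverse_mul l
  rw [formalExp_stageLog] at h1
  rw [← scale_formalExp, formalExp_stageLog]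
  exact left_inv_eq_right_inv h2 h1

theorem coeff_stageLog_reverse (l : List ℂ) (m : ℕ) :
    coeff m (stageLog l.reverse) = (-1 : ℂ) ^ (m + 1) • coeff m (stageLog l) := by
  have h := congrArg (coeff m) (scale_stageLog_reverse l)
  rw [coeff_scale, map_neg] at h
  rw [pow_succ, mul_smul, neg_one_smul, ← h, smul_smul, ← mul_pow]
  simp

theorem map_conjPoly_stageLog (l : List ℂ) :
    PowerSeries.map conjPoly (stageLog l) = stageLog (l.map (starRingEnd ℂ)) := by
  refine formalExp_injective ?_ (vanishesTo_stageLog _) ?_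
  · intro m hm
    rw [PowerSeries.coeff_map, vanishesTo_stageLog l m hm, map_zero]
  · rw [← map_formalExp, formalExp_stageLog, formalExp_stageLog, map_conjPoly_stageProd]

theorem exponent_eq_stageLog {s : ℕ} (α : Fin s → ℂ) : exponent α = stageLog (List.ofFn α) :=
  exponent_eq α

/-- The coordinates of the exponent of a symmetric-conjugate composition at even powers of `h` are
purely imaginary. -/
theorem IsCoordinates.re_eq_zero {s : ℕ} {α : Fin s → ℂ} (hα : IsSymmetricConjugate α)
    {E : (m : ℕ) → Module.Basis (Fin (c m)) ℝ (component m)}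
    {w : (m : ℕ) → Fin (c m) → ℂ} (hw : IsCoordinates E α w) {m : ℕ} (hm : Even m)
    (k : Fin (c m)) : (w m k).re = 0 := by
  have h1 : conjPoly (coeff m (exponent α)) = -coeff m (exponent α) := by
    rw [exponent_eq_stageLog, ← PowerSeries.coeff_map, map_conjPoly_stageLog, hα.map_conj,
      coeff_stageLog_reverse, hm.add_one.neg_one_pow, neg_one_smul]
  rw [hw m, map_sum] at h1
  simp only [conjPoly_smul, conjPoly_toPoly (E m _).2] at h1
  have h2 : ∑ k, ((starRingEnd ℂ) (w m k) + w m k) •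
      toPoly ((E m k : component m) : FreeLieAlgebra ℝ ℕ) = 0 := by
    simp only [add_smul, Finset.sum_add_distrib]
    rw [h1, neg_add_cancel]
  have h3 := Fintype.linearIndependent_iff.1
    (toPoly_linearIndependent _ (E m).linearIndependent) _ h2 k
  have h4 := congrArg Complex.re h3
  simp at h4
  linarith

end Conjugation

/-! ### Counting the order conditions -/

theorem card_retained {n q : ℕ} (hnq : 4 * q + 1 < 2 * n) :
    ((retained n q).card : ℤ) =
      (numConditions (2 * n) : ℤ) - ∑ j ∈ Finset.range (q + 1), (c (2 * n - 2 * j) : ℤ) := by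
  have h1 : (retained n q).card
      = ∑ m ∈ (Finset.Icc 1 (2 * n)).filter fun m => ∀ j ≤ q, m ≠ 2 * n - 2 * j, c m := by
    simp [retained, Finset.card_sigma]
  have h2 : (Finset.Icc 1 (2 * n)).filter (fun m => ¬ ∀ j ≤ q, m ≠ 2 * n - 2 * j)
      = (Finset.range (q + 1)).image fun j => 2 * n - 2 * j := by
    ext m
    simp only [Finset.mem_filter, Finset.mem_Icc, Finset.mem_image, Finset.mem_range]
    push Not
    constructor
    · rintro ⟨_, j, hj, rfl⟩
      exact ⟨j, by omega, rfl⟩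
    · rintro ⟨j, hj, rfl⟩
      exact ⟨by omega, j, by omega, rfl⟩
  have h3 : ∑ m ∈ (Finset.range (q + 1)).image (fun j => 2 * n - 2 * j), c m
      = ∑ j ∈ Finset.range (q + 1), c (2 * n - 2 * j) := by
    refine Finset.sum_image fun i hi j hj hij => ?_
    simp only [Finset.coe_range, Set.mem_Iio] at hi hj
    omega
  have h4 := Finset.sum_filter_add_sum_filter_not (Finset.Icc 1 (2 * n))
    (fun m => ∀ j ≤ q, m ≠ 2 * n - 2 * j) c
  rw [h2, h3, ← h1] at h4
  rw [numConditions, ← h4]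
  push_cast
  ring

/-! ### The order conditions in terms of the series of operators -/

section Conditions

open PowerSeries

/-- The series `h F`. -/
def linearSeries : PowerSeries (FreeAlgebra ℂ ℕ) :=
  mk fun m => if m = 1 then FreeAlgebra.ι ℂ 0 else 0

theorem vanishesTo_linearSeries : VanishesTo 1 linearSeries :=
  vanishesTo_one_iff.2 (by rw [linearSeries, coeff_mk]; simp)

theorem linearSeries_pow (k : ℕ) :
    linearSeries ^ k = mk fun m => if m = k then (FreeAlgebra.ι ℂ 0) ^ k else 0 := by
  induction k with
  | zero => ext m; simp [PowerSeries.coeff_one]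
  | succ k ih =>
    ext m
    rw [pow_succ, ih, coeff_mk, PowerSeries.coeff_mul]
    simp only [linearSeries, coeff_mk, mul_ite, ite_mul, mul_zero, zero_mul]
    by_cases hm : m = k + 1
    · rw [if_pos hm, Finset.sum_eq_single (k, 1)]
      · simp [pow_succ]
      · rintro ⟨a, b⟩ h1 h2
        rw [Finset.HasAntidiagonal.mem_antidiagonal] at h1
        simp only at h1 ⊢
        split_ifs with h3 h4
        · exact absurd (by rw [h3, h4]) h2
        · rfl
        · rfl
      · intro h; exact absurd (by simp [hm]) h
    · rw [if_neg hm]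
      refine Finset.sum_eq_zero fun p hp => ?_
      rw [Finset.HasAntidiagonal.mem_antidiagonal] at hp
      split_ifs
      · omega
      · rfl
      · rfl

theorem coeff_formalExp_linearSeries (m : ℕ) :
    coeff m (formalExp linearSeries) = ((m.factorial : ℂ)⁻¹) • (FreeAlgebra.ι ℂ 0) ^ m := by
  simp only [formalExp, psum, coeff_mk, coeff_smul, linearSeries_pow]
  rw [Finset.sum_eq_single m]
  · simp
  · intro k _ hk; rw [if_neg (Ne.symm hk), smul_zero]
  · simp

/-- The order conditions other than those at `h^{2n-2j}`, `j ≤ q`, for the exponent `V`. -/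
def RetainedConditions (n q : ℕ) (V : PowerSeries (FreeAlgebra ℂ ℕ)) : Prop :=
  ∀ m, 1 ≤ m → m ≤ 2 * n → (∀ j ≤ q, m ≠ 2 * n - 2 * j) → coeff m V = coeff m linearSeries

theorem retainedConditions_stageLog_iff {n q : ℕ} (hnq : 4 * q + 1 < 2 * n) (l : List ℂ) :
    RetainedConditions n q (stageLog l) ↔
      VanishesTo (2 * n - 2 * q) (stageProd l - stageProd l.reverse) ∧
      VanishesTo (2 * n + 1) (stageProd l + stageProd l.reverse
        - (formalExp linearSeries + formalExp linearSeries)) := by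
  set V := stageLog l with hV
  set V' := stageLog l.reverse with hV'
  set T := (2⁻¹ : ℂ) • (V - V') with hT
  set B := (2⁻¹ : ℂ) • (V + V') with hB
  have h2 : (2⁻¹ : ℂ) + 2⁻¹ = 1 := by norm_num
  have hBT : B + T = V := by
    rw [hB, hT, ← smul_add, add_add_sub_cancel, smul_add, ← add_smul, h2, one_smul]
  have hBT' : B - T = V' := by
    rw [hB, hT, ← smul_sub, add_sub_sub_cancel, smul_add, ← add_smul, h2, one_smul]
  have hTT : T + T = V - V' := by rw [← hBT, ← hBT']; abel
  have vV : VanishesTo 1 V := vanishesTo_stageLog _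
  have vV' : VanishesTo 1 V' := vanishesTo_stageLog _
  have vB : VanishesTo 1 B := (vV.add vV').smul _
  have hodd : ∀ m, Odd m → coeff m T = 0 ∧ coeff m B = coeff m V := by
    intro m hm
    have h := coeff_stageLog_reverse l m
    rw [hm.add_one.neg_one_pow, one_smul, ← hV, ← hV'] at h
    rw [hT, hB, coeff_smul, coeff_smul, map_sub, map_add, h, sub_self, smul_zero, smul_add,
      ← add_smul, h2, one_smul]
    exact ⟨rfl, rfl⟩
  have heven : ∀ m, Even m → coeff m T = coeff m V ∧ coeff m B = 0 := by
    intro m hm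
    have h := coeff_stageLog_reverse l m
    rw [hm.add_one.neg_one_pow, neg_one_smul, ← hV, ← hV'] at h
    rw [hT, hB, coeff_smul, coeff_smul, map_sub, map_add, h, sub_neg_eq_add, smul_add,
      ← add_smul, h2, one_smul, add_neg_cancel, smul_zero]
    exact ⟨rfl, rfl⟩
  have hlin : ∀ m, m ≠ 1 → coeff m linearSeries = 0 := fun m hm => by
    rw [linearSeries, coeff_mk, if_neg hm]
  have s1 : RetainedConditions n q V ↔
      VanishesTo (2 * n - 2 * q) T ∧ VanishesTo (2 * n + 1) (B - linearSeries) := by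
    constructor
    · intro h
      constructor
      · intro m hm
        rcases Nat.even_or_odd m with he | ho
        · rw [(heven m he).1]
          rcases Nat.eq_zero_or_pos m with rfl | hpos
          · exact vV 0 (by omega)
          · rw [h m hpos (by omega) (fun j hj => by omega), hlin]
            rintro rfl; exact absurd he (by decide)
        · exact (hodd m ho).1
      · intro m hm
        rw [map_sub]
        rcases Nat.even_or_odd m with he | ho
        · rw [(heven m he).2, hlin, sub_zero]
          rintro rfl; exact absurd he (by decide)
        · rw [(hodd m ho).2, h m ho.pos (by omega), sub_self]
          intro j hj
          obtain ⟨k, rfl⟩ := ho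
          omega
    · rintro ⟨h1, h3⟩ m hm1 hm2 hm3
      rcases Nat.even_or_odd m with he | ho
      · rw [← (heven m he).1, h1, hlin]
        · rintro rfl; exact absurd he (by decide)
        · by_contra hcon
          obtain ⟨k, rfl⟩ := he
          exact hm3 (n - k) (by omega) (by omega)
      · have := h3 m (by omega)
        rw [map_sub, (hodd m ho).2] at this
        exact sub_eq_zero.1 this
  have s2 : VanishesTo (2 * n - 2 * q) T ↔
      VanishesTo (2 * n - 2 * q) (stageProd l - stageProd l.reverse) := by
    rw [← formalExp_stageLog l, ← formalExp_stageLog l.reverse, ← hV, ← hV']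
    constructor
    · intro h
      exact vanishesTo_formalExp_sub (by rw [← hTT]; exact h.add h)
    · intro h
      exact (vanishesTo_of_formalExp_sub vV vV' h).smul _
  rw [s1, ← s2]
  refine and_congr_right fun h => ?_
  have h3 := (vanishesTo_formalExp_add_sub B h).mono (show 2 * n + 1 ≤ _ by omega)
  rw [hBT, hBT', hV, hV', formalExp_stageLog, formalExp_stageLog] at h3
  constructor
  · intro h4
    have h5 := vanishesTo_formalExp_sub h4
    have h6 := (h3.add h5).add h5
    convert h6 using 1
    abel
  · intro h4
    refine vanishesTo_of_formalExp_sub vB vanishesTo_linearSeries ?_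
    have h5 := (h4.sub h3).smul (2⁻¹ : ℂ)
    convert h5 using 1
    rw [sub_sub_sub_cancel_left, add_sub_add_comm, smul_add, ← add_smul, h2, one_smul]

theorem c_one (E : Module.Basis (Fin (c 1)) ℝ (component 1))
    (hE : ∀ k, ((E k : component 1) : FreeLieAlgebra ℝ ℕ) = FreeLieAlgebra.of ℝ 0) : c 1 = 1 := by
  have h1 : Subsingleton (Fin (c 1)) :=
    ⟨fun i j => E.injective (Subtype.ext ((hE i).trans (hE j).symm))⟩
  have h2 : c 1 ≠ 0 := by
    intro h0
    have : Subsingleton (component 1) := Module.finrank_zero_iff.1 h0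
    have h3 : FreeLieAlgebra.of ℝ (0 : ℕ) = 0 := congrArg Subtype.val (Subsingleton.elim
      (⟨_, Submodule.subset_span (IsBracket.of 0)⟩ : component 1) 0)
    have h4 := toPoly_of 0
    rw [h3, map_zero] at h4
    exact FreeAlgebra.ι_ne_zero 0 h4.symm
  have h3 := Fin.subsingleton_iff_le_one.1 h1
  omega

theorem orderConditions_iff {s : ℕ} {α : Fin s → ℂ}
    {E : (m : ℕ) → Module.Basis (Fin (c m)) ℝ (component m)}
    (hE : ∀ k, ((E 1 k : component 1) : FreeLieAlgebra ℝ ℕ) = FreeLieAlgebra.of ℝ 0)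
    {w : (m : ℕ) → Fin (c m) → ℂ} (hw : IsCoordinates E α w) (n q : ℕ) :
    (∀ i ∈ retained n q, OrderCondition w i) ↔
      RetainedConditions n q (stageLog (List.ofFn α)) := by
  have key : ∀ m, coeff m (exponent α) = coeff m linearSeries ↔
      ∀ k, OrderCondition w ⟨m, k⟩ := by
    intro m
    rw [hw m, linearSeries, coeff_mk]
    by_cases hm : m = 1
    · subst hm
      simp only [if_true, hE, toPoly_of, OrderCondition, ← Finset.sum_smul]
      have hc := c_one (E 1) hE
      have hu : ∀ i j : Fin (c 1), i = j := fun i j => Fin.ext (by omega)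
      have k0 : Fin (c 1) := ⟨0, by omega⟩
      rw [Fintype.sum_eq_single k0 (fun i hi => absurd (hu i k0) hi)]
      constructor
      · intro h k
        rw [hu k k0]
        have h1 : (w 1 k0 - 1) • FreeAlgebra.ι ℂ (0 : ℕ) = 0 := by
          rw [sub_smul, h, one_smul, sub_self]
        have h2 := (smul_eq_zero.1 h1).resolve_right (FreeAlgebra.ι_ne_zero 0)
        exact sub_eq_zero.1 h2
      · intro h
        rw [h k0, one_smul]
    · simp only [if_neg hm, OrderCondition]
      constructor
      · intro h
        exact Fintype.linearIndependent_iff.1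
          (toPoly_linearIndependent _ (E m).linearIndependent) _ h
      · intro h
        exact Finset.sum_eq_zero fun k _ => by rw [h k, zero_smul]
  rw [← exponent_eq_stageLog]
  constructor
  · intro h m h1 h2 h3
    exact (key m).2 fun k => h ⟨m, k⟩ (by simp [retained, h1, h2]; exact h3)
  · rintro h ⟨m, k⟩ hi
    simp only [retained, Finset.mem_sigma, Finset.mem_filter, Finset.mem_Icc, Finset.mem_univ,
      and_true] at hi
    exact (key m).1 (h m hi.1.1 hi.1.2 hi.2) k

end Conditions

end SymConj

end

noncomputable section

namespace SymConj

/-! ### Reflection -/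

section Reflection

theorem continuous_complexify {d : ℕ} : Continuous (complexify (d := d)) :=
  continuous_pi fun i => Complex.continuous_ofReal.comp (continuous_apply i)

/-- A real point of `ℝ × ℝ^d` as a point of `ℂ × ℂ^d`. -/
def realPoint {d : ℕ} (p : ℝ × (Fin d → ℝ)) : ℂ × (Fin d → ℂ) := ((p.1 : ℂ), complexify p.2)

theorem continuous_realPoint {d : ℕ} : Continuous (realPoint (d := d)) :=
  (Complex.continuous_ofReal.comp continuous_fst).prodMk
    (continuous_complexify.comp continuous_snd)

theorem tendsto_realPoint {d : ℕ} (x₀ : Fin d → ℝ) :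
    Tendsto (realPoint (d := d)) (𝓝 (0, x₀)) (𝓝 (0, complexify x₀)) := by
  have h := (continuous_realPoint (d := d)).tendsto (0, x₀)
  rwa [show realPoint ((0 : ℝ), x₀) = ((0 : ℂ), complexify x₀) by simp [realPoint]] at h

theorem star_realPoint {d : ℕ} (p : ℝ × (Fin d → ℝ)) : star (realPoint p) = realPoint p := by
  refine Prod.ext (Complex.conj_ofReal _) (funext fun i => Complex.conj_ofReal _)

/-- A function which is holomorphic near a real point and real at real points commutes with
conjugation. -/
theorem eventually_eq_star_of_real {d : ℕ} {H : ℂ × (Fin d → ℂ) → ℂ} {x₀ : Fin d → ℝ}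
    (hH : AnalyticAt ℂ H (0, complexify x₀))
    (hr : ∀ᶠ p : ℝ × (Fin d → ℝ) in 𝓝 (0, x₀), (H (realPoint p)).im = 0) :
    ∀ᶠ z in 𝓝 ((0 : ℂ), complexify x₀), H z = star (H (star z)) := by
  let re' : ℂ × (Fin d → ℂ) → ℝ × (Fin d → ℝ) := fun z => (z.1.re, fun i => (z.2 i).re)
  let im' : ℂ × (Fin d → ℂ) → ℝ × (Fin d → ℝ) := fun z => (z.1.im, fun i => (z.2 i).im)
  have hre : Continuous re' := by fun_prop
  have him : Continuous im' := by fun_prop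
  let P : (ℂ × (Fin d → ℂ)) → ℂ → ℂ × (Fin d → ℂ) :=
    fun z t => realPoint (re' z) + t • realPoint (im' z)
  let Q : (ℂ × (Fin d → ℂ)) → ℝ → ℝ × (Fin d → ℝ) := fun z t => re' z + t • im' z
  have hP : Continuous fun w : (ℂ × (Fin d → ℂ)) × ℂ => P w.1 w.2 :=
    (continuous_realPoint.comp (hre.comp continuous_fst)).add
      (continuous_snd.smul (continuous_realPoint.comp (him.comp continuous_fst)))
  have hQ : Continuous fun w : (ℂ × (Fin d → ℂ)) × ℝ => Q w.1 w.2 :=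
    (hre.comp continuous_fst).add (continuous_snd.smul (him.comp continuous_fst))
  have hPQ : ∀ z (t : ℝ), P z t = realPoint (Q z t) := by
    intro z t
    refine Prod.ext ?_ (funext fun i => ?_) <;> simp [P, Q, realPoint, complexify]
  have hPI : ∀ z, P z Complex.I = z := by
    intro z
    refine Prod.ext ?_ (funext fun i => ?_)
    · simp [P, re', im', realPoint, mul_comm Complex.I]
    · simp [P, re', im', realPoint, complexify, mul_comm Complex.I]
  have hPnegI : ∀ z, P z (-Complex.I) = star z := by
    intro z
    refine Prod.ext ?_ (funext fun i => ?_)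
    · apply Complex.ext <;> simp [P, re', im', realPoint]
    · apply Complex.ext <;> simp [P, re', im', realPoint, complexify]
  have hP0 : ∀ t, P (0, complexify x₀) t = (0, complexify x₀) := by
    intro t
    refine Prod.ext ?_ (funext fun i => ?_) <;> simp [P, re', im', realPoint, complexify]
  have hQ0 : ∀ t, Q (0, complexify x₀) t = (0, x₀) := by
    intro t
    refine Prod.ext ?_ (funext fun i => ?_) <;> simp [Q, re', im', complexify]
  have e1 : ∀ᶠ z in 𝓝 ((0 : ℂ), complexify x₀), ∀ t ∈ Metric.closedBall (0 : ℂ) 2,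
      AnalyticAt ℂ H (P z t) := by
    refine (isCompact_closedBall 0 2).eventually_forall_of_forall_eventually fun t _ => ?_
    have h1 := hH.eventually_analyticAt
    rw [← hP0 t] at h1
    exact (hP.tendsto ((0, complexify x₀), t)).eventually h1
  have e2 : ∀ᶠ z in 𝓝 ((0 : ℂ), complexify x₀), ∀ t ∈ Metric.closedBall (0 : ℝ) 2,
      (H (realPoint (Q z t))).im = 0 := by
    refine (isCompact_closedBall 0 2).eventually_forall_of_forall_eventually fun t _ => ?_
    rw [← hQ0 t] at hr
    exact (hQ.tendsto ((0, complexify x₀), t)).eventually hr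
  filter_upwards [e1, e2] with z h1 h2
  let g : ℂ → ℂ := fun t => H (P z t)
  let B : Set ℂ := Metric.ball 0 2
  have hg : ∀ t ∈ B, DifferentiableAt ℂ g t := by
    intro t ht
    refine (h1 t (Metric.ball_subset_closedBall ht)).differentiableAt.comp t ?_
    change DifferentiableAt ℂ (fun t : ℂ => realPoint (re' z) + t • realPoint (im' z)) t
    fun_prop
  have hstar : ∀ t ∈ B, star t ∈ B := fun t ht => by
    simpa [B, Metric.mem_ball, dist_zero_right] using ht
  have hg2 : ∀ t ∈ B, DifferentiableAt ℂ (fun t => star (g (star t))) t := by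
    intro t ht
    have := (hg _ (hstar t ht)).star_star
    rw [star_star] at this
    exact this
  have a1 : AnalyticOnNhd ℂ g B :=
    DifferentiableOn.analyticOnNhd (fun t ht => (hg t ht).differentiableWithinAt) Metric.isOpen_ball
  have a2 : AnalyticOnNhd ℂ (fun t => star (g (star t))) B :=
    DifferentiableOn.analyticOnNhd (fun t ht => (hg2 t ht).differentiableWithinAt)
      Metric.isOpen_ball
  have hreal : ∀ t : ℝ, |t| < 2 → g t = star (g (star (t : ℂ))) := by
    intro t ht
    have h3 : (g t).im = 0 := by
      simp only [g]
      rw [hPQ]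
      exact h2 t (by simpa using ht.le)
    rw [show star (t : ℂ) = t from Complex.conj_ofReal t]
    exact (Complex.conj_eq_iff_im.2 h3).symm
  have hfreq : ∃ᶠ t in 𝓝[≠] (0 : ℂ), g t = star (g (star t)) := by
    have ht : Tendsto (fun t : ℝ => (t : ℂ)) (𝓝[≠] 0) (𝓝[≠] 0) := by
      refine tendsto_nhdsWithin_of_tendsto_nhds_of_eventually_within _ ?_ ?_
      · exact (Complex.continuous_ofReal.tendsto' 0 0 (by simp)).mono_left nhdsWithin_le_nhds
      · filter_upwards [self_mem_nhdsWithin] with t ht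
        simpa using ht
    refine ht.frequently (Eventually.frequently ?_)
    have : ∀ᶠ t : ℝ in 𝓝[≠] 0, t ∈ Metric.ball (0 : ℝ) 2 :=
      nhdsWithin_le_nhds (Metric.ball_mem_nhds 0 (by norm_num))
    filter_upwards [this] with t ht
    exact hreal t (by simpa using ht)
  have hcon : IsPreconnected B := (convex_ball (0 : ℂ) 2).isPreconnected
  have heq := a1.eqOn_of_preconnected_of_frequently_eq a2 hcon
    (Metric.mem_ball_self (by norm_num)) hfreq
  have h4 := heq (show Complex.I ∈ B by simp [B])
  simp only [g] at h4
  rw [show star Complex.I = -Complex.I from Complex.conj_I, hPI, hPnegI] at h4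
  exact h4

theorem eventually_eq_zero_of_real {d : ℕ} {H : ℂ × (Fin d → ℂ) → ℂ} {x₀ : Fin d → ℝ}
    (hH : AnalyticAt ℂ H (0, complexify x₀))
    (hr : ∀ᶠ p : ℝ × (Fin d → ℝ) in 𝓝 (0, x₀), H (realPoint p) = 0) :
    ∀ᶠ z in 𝓝 ((0 : ℂ), complexify x₀), H z = 0 := by
  have h1 := eventually_eq_star_of_real hH (hr.mono fun p hp => by simp [hp])
  have h2 := eventually_eq_star_of_real (H := fun z => Complex.I * H z)
    (analyticAt_const.mul hH) (hr.mono fun p hp => by simp [hp])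
  filter_upwards [h1, h2] with z h1 h2
  rw [star_mul, show star Complex.I = -Complex.I from Complex.conj_I, ← h1] at h2
  have h3 : (2 * Complex.I) * H z = 0 := by linear_combination h2
  simpa using h3

end Reflection

/-! ### Division by powers of the step -/

section Division

variable {E : Type*} [NormedAddCommGroup E] [NormedSpace ℂ E]

/-- The projection `(h, z) ↦ (0, z)`. -/
def dropStep (E : Type*) [NormedAddCommGroup E] [NormedSpace ℂ E] : (ℂ × E) →L[ℂ] (ℂ × E) :=
  (ContinuousLinearMap.inr ℂ ℂ E).comp (ContinuousLinearMap.snd ℂ ℂ E)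

theorem dropStep_apply (y : ℂ × E) : dropStep E y = (0, y.2) := rfl

theorem norm_dropStep_apply_le (y : ℂ × E) : ‖dropStep E y‖ ≤ ‖y‖ := by
  rw [dropStep_apply, Prod.norm_def, Prod.norm_def, norm_zero]
  exact max_le_max (norm_nonneg _) le_rfl

/-- The quotient of `p(y,…,y) - p(y₀,…,y₀)` by `h`, where `y = (h, z)` and `y₀ = (0, z)`. -/
def divMultilinear : (n : ℕ) →
    ((ℂ × E) [×(n + 1)]→L[ℂ] ℂ) →L[ℂ] ((ℂ × E) [×n]→L[ℂ] ℂ)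
  | 0 => (ContinuousLinearMap.apply ℂ _ ((1, 0) : ℂ × E)).comp
      (continuousMultilinearCurryLeftEquiv ℂ (fun _ : Fin 1 => ℂ × E) ℂ :
        ((ℂ × E) [×1]→L[ℂ] ℂ) →L[ℂ] ((ℂ × E) →L[ℂ] ((ℂ × E) [×0]→L[ℂ] ℂ)))
  | n + 1 =>
      let curry : ((ℂ × E) [×(n + 2)]→L[ℂ] ℂ) →L[ℂ] ((ℂ × E) →L[ℂ] ((ℂ × E) [×(n + 1)]→L[ℂ] ℂ)) :=
        (continuousMultilinearCurryLeftEquiv ℂ (fun _ : Fin (n + 2) => ℂ × E) ℂ)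
      let uncurry : ((ℂ × E) →L[ℂ] ((ℂ × E) [×n]→L[ℂ] ℂ)) →L[ℂ] ((ℂ × E) [×(n + 1)]→L[ℂ] ℂ) :=
        (continuousMultilinearCurryLeftEquiv ℂ (fun _ : Fin (n + 1) => ℂ × E) ℂ).symm
      (ContinuousLinearMap.apply ℂ _ ((1, 0) : ℂ × E)).comp curry +
        uncurry.comp ((ContinuousLinearMap.compL ℂ (ℂ × E) _ _ (divMultilinear n)).comp
          (((ContinuousLinearMap.compL ℂ (ℂ × E) (ℂ × E) _).flip (dropStep E)).comp curry))

theorem divMultilinear_zero_apply (p : (ℂ × E) [×1]→L[ℂ] ℂ) :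
    divMultilinear 0 p = p.curryLeft (1, 0) := rfl

theorem divMultilinear_succ_apply (n : ℕ) (p : (ℂ × E) [×(n + 2)]→L[ℂ] ℂ) :
    divMultilinear (n + 1) p = p.curryLeft (1, 0) +
      (((divMultilinear n).comp (p.curryLeft.comp (dropStep E))).uncurryLeft :
        (ℂ × E) [×(n + 1)]→L[ℂ] ℂ) := rfl

theorem norm_divMultilinear_le (n : ℕ) (p : (ℂ × E) [×(n + 1)]→L[ℂ] ℂ) :
    ‖divMultilinear n p‖ ≤ (n + 1) * ‖p‖ := by
  have h1 : ∀ (n : ℕ) (p : (ℂ × E) [×(n + 1)]→L[ℂ] ℂ), ‖p.curryLeft (1, 0)‖ ≤ ‖p‖ := by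
    intro n p
    refine (p.curryLeft.le_opNorm _).trans ?_
    rw [ContinuousMultilinearMap.curryLeft_norm]
    simp [Prod.norm_def]
  induction n with
  | zero =>
    rw [divMultilinear_zero_apply]
    simpa using h1 0 p
  | succ n ih =>
    rw [divMultilinear_succ_apply]
    have h2 : ‖(((divMultilinear n).comp (p.curryLeft.comp (dropStep E))).uncurryLeft :
        (ℂ × E) [×(n + 1)]→L[ℂ] ℂ)‖ ≤ (n + 1) * ‖p‖ := by
      rw [ContinuousLinearMap.uncurryLeft_norm]
      refine ContinuousLinearMap.opNorm_le_bound _ (by positivity) fun y => ?_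
      refine (ih _).trans ?_
      rw [mul_assoc]
      refine mul_le_mul_of_nonneg_left ?_ (by positivity)
      refine (p.curryLeft.le_opNorm _).trans ?_
      rw [ContinuousMultilinearMap.curryLeft_norm]
      exact mul_le_mul_of_nonneg_left (norm_dropStep_apply_le y) (norm_nonneg _)
    refine (norm_add_le _ _).trans ((add_le_add (h1 _ p) h2).trans (le_of_eq ?_))
    push_cast
    ring

theorem mul_divMultilinear (n : ℕ) (p : (ℂ × E) [×(n + 1)]→L[ℂ] ℂ) (y : ℂ × E) :
    p (fun _ => y) - p (fun _ => dropStep E y) = y.1 * divMultilinear n p (fun _ => y) := by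
  have hy : y = y.1 • ((1, 0) : ℂ × E) + dropStep E y := by
    refine Prod.ext ?_ ?_ <;> simp [dropStep_apply]
  have hcurry : ∀ (n : ℕ) (p : (ℂ × E) [×(n + 1)]→L[ℂ] ℂ) (u : ℂ × E),
      p (fun _ => u) = p.curryLeft u (fun _ => u) := by
    intro n p u
    rw [ContinuousMultilinearMap.curryLeft_apply]
    congr 1
    funext i
    refine Fin.cases rfl (fun i => rfl) i
  have hsplit : ∀ (n : ℕ) (p : (ℂ × E) [×(n + 1)]→L[ℂ] ℂ) (v : Fin n → ℂ × E),
      p.curryLeft y v = y.1 * p.curryLeft (1, 0) v + p.curryLeft (dropStep E y) v := by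
    intro n p v
    conv_lhs => rw [hy]
    rw [map_add, map_smul]
    rfl
  induction n with
  | zero =>
    rw [divMultilinear_zero_apply, hcurry, hcurry, hsplit,
      Subsingleton.elim (fun _ : Fin 0 => dropStep E y) (fun _ => y)]
    ring
  | succ n ih =>
    have h1 := ih (p.curryLeft (dropStep E y))
    rw [divMultilinear_succ_apply, hcurry (n + 1) p y, hcurry (n + 1) p (dropStep E y),
      hsplit (n + 1) p, _root_.add_apply,
      ContinuousLinearMap.uncurryLeft_apply, mul_add]
    simp only [ContinuousLinearMap.comp_apply]
    change _ = _ + y.1 * (divMultilinear n (p.curryLeft (dropStep E y))) (fun _ => y)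
    rw [← h1]
    ring

theorem exists_analyticAt_div {G : ℂ × E → ℂ} {z₀ : E} (hG : AnalyticAt ℂ G (0, z₀)) :
    ∃ R : ℂ × E → ℂ, AnalyticAt ℂ R (0, z₀) ∧
      ∀ᶠ y in 𝓝 ((0 : ℂ), z₀), G y = G (0, y.2) + y.1 * R y := by
  obtain ⟨p, r, hp⟩ := hG
  let q : FormalMultilinearSeries ℂ (ℂ × E) ℂ := fun n => divMultilinear n (p (n + 1))
  have hq : 0 < q.radius := by
    obtain ⟨ρ, hρ0, hρ⟩ := ENNReal.lt_iff_exists_nnreal_btwn.1 hp.r_pos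
    have hρ0' : 0 < ρ := by exact_mod_cast hρ0
    obtain ⟨C, hC, hbd⟩ := p.norm_mul_pow_le_of_lt_radius (hρ.trans_le hp.r_le)
    have h1 : ∀ n, ‖q n‖ * ((ρ / 2 : NNReal) : ℝ) ^ n ≤ C / ρ := by
      intro n
      have hρr : (0 : ℝ) < ρ := by exact_mod_cast hρ0'
      have h2 := hbd (n + 1)
      have h3 := norm_divMultilinear_le n (p (n + 1))
      have h4 : ((n : ℝ) + 1) ≤ 2 ^ n := by exact_mod_cast Nat.lt_two_pow_self
      rw [NNReal.coe_div, NNReal.coe_ofNat, div_pow, le_div_iff₀ hρr, mul_div_assoc', div_mul_eq_mul_div,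
        div_le_iff₀ (by positivity)]
      calc ‖q n‖ * (ρ : ℝ) ^ n * ρ ≤ ((n + 1) * ‖p (n + 1)‖) * (ρ : ℝ) ^ n * ρ := by gcongr
        _ = (n + 1) * (‖p (n + 1)‖ * (ρ : ℝ) ^ (n + 1)) := by ring
        _ ≤ 2 ^ n * C := by gcongr
        _ = C * 2 ^ n := by ring
    refine lt_of_lt_of_le ?_ (q.le_radius_of_bound _ h1)
    exact_mod_cast (half_pos hρ0')
  have hR0 := q.hasFPowerSeriesOnBall hq
  refine ⟨fun y => q.sum (y - (0, z₀)), ?_, ?_⟩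
  · have : AnalyticAt ℂ q.sum ((0, z₀) - (0, z₀) : ℂ × E) := by
      rw [sub_self]; exact hR0.analyticAt
    refine AnalyticAt.fun_comp (g := q.sum) (f := fun y => y - (0, z₀)) this ?_
    fun_prop
  · have hr : 0 < min r q.radius := lt_min hp.r_pos hq
    filter_upwards [Metric.eball_mem_nhds ((0 : ℂ), z₀) hr] with y hy
    set u : ℂ × E := y - (0, z₀) with hu
    have hu1 : u.1 = y.1 := by simp [hu]
    have hy' : edist y (0, z₀) < min r q.radius := hy
    have hun : ‖u‖ₑ < min r q.radius := by rwa [hu, ← edist_eq_enorm_sub]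
    have hdn : ‖dropStep E u‖ₑ < r := by
      refine lt_of_le_of_lt ?_ (hun.trans_le (min_le_left _ _))
      exact enorm_le_iff_norm_le.2 (norm_dropStep_apply_le u)
    have s1 : HasSum (fun n => p n fun _ => u) (G y) := by
      have := hp.hasSum (y := u) (by
        rw [Metric.mem_eball, edist_zero_right]; exact hun.trans_le (min_le_left _ _))
      rwa [show (0, z₀) + u = y by rw [hu]; abel] at this
    have s2 : HasSum (fun n => p n fun _ => dropStep E u) (G (0, y.2)) := by
      have := hp.hasSum (y := dropStep E u) (by rw [Metric.mem_eball, edist_zero_right]; exact hdn)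
      rwa [show (0, z₀) + dropStep E u = (0, y.2) by
        refine Prod.ext ?_ ?_ <;> simp [hu, dropStep_apply]] at this
    have s3 : HasSum (fun n => q n fun _ => u) (q.sum u) := by
      have := hR0.hasSum (y := u) (by
        rw [Metric.mem_eball, edist_zero_right]; exact hun.trans_le (min_le_right _ _))
      rwa [zero_add] at this
    have s4 := (hasSum_nat_add_iff' 1).2 (s1.sub s2)
    have s5 := s3.mul_left u.1
    have h6 : ∀ n, u.1 * q n (fun _ => u)
        = p (n + 1) (fun _ => u) - p (n + 1) (fun _ => dropStep E u) :=
      fun n => (mul_divMultilinear n (p (n + 1)) u).symm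
    simp only [h6] at s5
    have h7 := s5.unique s4
    rw [Finset.sum_range_one, Subsingleton.elim (fun _ : Fin 0 => dropStep E u) (fun _ => u),
      sub_self, sub_zero, hu1] at h7
    rw [h7]
    ring

end Division

end SymConj

end

noncomputable section

namespace SymConj

/-! ### Expansions in powers of the step -/

section Expansion

variable {E : Type*} [NormedAddCommGroup E] [NormedSpace ℂ E] {z₀ : E}

/-- `G` is `h^N` times an analytic function near `(0, z₀)`. -/
def IsDivisible (z₀ : E) (N : ℕ) (G : ℂ × E → ℂ) : Prop :=
  ∃ R : ℂ × E → ℂ, AnalyticAt ℂ R (0, z₀) ∧ ∀ᶠ p in 𝓝 ((0 : ℂ), z₀), G p = p.1 ^ N * R p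

theorem IsDivisible.congr {N : ℕ} {G G' : ℂ × E → ℂ} (h : IsDivisible z₀ N G)
    (hG : ∀ᶠ p in 𝓝 ((0 : ℂ), z₀), G' p = G p) : IsDivisible z₀ N G' := by
  obtain ⟨R, hR, h⟩ := h
  exact ⟨R, hR, by filter_upwards [h, hG] with p h1 h2; rw [h2, h1]⟩

theorem isDivisible_zero (N : ℕ) : IsDivisible z₀ N fun _ => 0 :=
  ⟨fun _ => 0, analyticAt_const, by simp⟩

theorem isDivisible_of_analyticAt {G : ℂ × E → ℂ} (hG : AnalyticAt ℂ G (0, z₀)) :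
    IsDivisible z₀ 0 G := ⟨G, hG, by simp⟩

theorem IsDivisible.add {N : ℕ} {G G' : ℂ × E → ℂ} (h : IsDivisible z₀ N G)
    (h' : IsDivisible z₀ N G') : IsDivisible z₀ N fun p => G p + G' p := by
  obtain ⟨R, hR, h⟩ := h
  obtain ⟨R', hR', h'⟩ := h'
  refine ⟨fun p => R p + R' p, hR.fun_add hR', ?_⟩
  filter_upwards [h, h'] with p h1 h2
  rw [h1, h2]; ring

theorem IsDivisible.mul_left {N : ℕ} {G K : ℂ × E → ℂ} (hK : AnalyticAt ℂ K (0, z₀))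
    (h : IsDivisible z₀ N G) : IsDivisible z₀ N fun p => K p * G p := by
  obtain ⟨R, hR, h⟩ := h
  refine ⟨fun p => K p * R p, hK.fun_mul hR, ?_⟩
  filter_upwards [h] with p h1
  rw [h1]; ring

theorem IsDivisible.sub {N : ℕ} {G G' : ℂ × E → ℂ} (h : IsDivisible z₀ N G)
    (h' : IsDivisible z₀ N G') : IsDivisible z₀ N fun p => G p - G' p :=
  (h.add (h'.mul_left (K := fun _ => -1) analyticAt_const)).congr (by simp [sub_eq_add_neg])

theorem IsDivisible.sum {N : ℕ} {ι : Type*} {s : Finset ι} {G : ι → ℂ × E → ℂ}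
    (h : ∀ i ∈ s, IsDivisible z₀ N (G i)) : IsDivisible z₀ N fun p => ∑ i ∈ s, G i p := by
  classical
  induction s using Finset.induction_on with
  | empty => simpa using isDivisible_zero N
  | insert a s ha ih =>
    refine ((h a (Finset.mem_insert_self _ _)).add
      (ih fun i hi => h i (Finset.mem_insert_of_mem hi))).congr ?_
    exact Eventually.of_forall fun p => Finset.sum_insert ha

theorem isDivisible_pow_mul {N m : ℕ} (hm : N ≤ m) {K : ℂ × E → ℂ}
    (hK : AnalyticAt ℂ K (0, z₀)) : IsDivisible z₀ N fun p => p.1 ^ m * K p := by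
  refine ⟨fun p => p.1 ^ (m - N) * K p, ((analyticAt_fst.pow _).fun_mul hK), ?_⟩
  refine Eventually.of_forall fun p => ?_
  rw [← mul_assoc, ← pow_add, Nat.add_sub_cancel' hm]

/-- A one-step method with complex steps that fixes `z₀` at step `0`. -/
structure IsAnalyticStep (z₀ : E) (S : ℂ × E → E) : Prop where
  analyticAt : AnalyticAt ℂ S (0, z₀)
  initial : ∀ᶠ z in 𝓝 z₀, S (0, z) = z

variable {S : ℂ × E → E}

theorem IsAnalyticStep.map_zero (hS : IsAnalyticStep z₀ S) : S (0, z₀) = z₀ :=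
  hS.initial.self_of_nhds

theorem IsAnalyticStep.analyticAt_scale (hS : IsAnalyticStep z₀ S) (a : ℂ) :
    AnalyticAt ℂ (fun p : ℂ × E => S (a * p.1, p.2)) (0, z₀) := by
  refine AnalyticAt.fun_comp (g := S) (f := fun p : ℂ × E => (a * p.1, p.2)) ?_ ?_
  · simpa using hS.analyticAt
  · exact (analyticAt_const.fun_mul analyticAt_fst).prod analyticAt_snd

theorem IsAnalyticStep.analyticAt_prod (hS : IsAnalyticStep z₀ S) (a : ℂ) :
    AnalyticAt ℂ (fun p : ℂ × E => (p.1, S (a * p.1, p.2))) (0, z₀) :=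
  analyticAt_fst.prod (hS.analyticAt_scale a)

theorem IsAnalyticStep.tendsto (hS : IsAnalyticStep z₀ S) (a : ℂ) :
    Tendsto (fun p : ℂ × E => (p.1, S (a * p.1, p.2))) (𝓝 (0, z₀)) (𝓝 (0, z₀)) := by
  have h := (hS.analyticAt_prod a).continuousAt
  rw [ContinuousAt] at h
  simpa [hS.map_zero] using h

theorem IsAnalyticStep.comp_analyticAt (hS : IsAnalyticStep z₀ S) (a : ℂ) {G : ℂ × E → ℂ}
    (hG : AnalyticAt ℂ G (0, z₀)) :
    AnalyticAt ℂ (fun p : ℂ × E => G (p.1, S (a * p.1, p.2))) (0, z₀) := by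
  refine AnalyticAt.fun_comp (g := G) (f := fun p : ℂ × E => (p.1, S (a * p.1, p.2))) ?_
    (hS.analyticAt_prod a)
  simpa [hS.map_zero] using hG

theorem IsDivisible.comp_step (hS : IsAnalyticStep z₀ S) (a : ℂ) {N : ℕ} {G : ℂ × E → ℂ}
    (h : IsDivisible z₀ N G) :
    IsDivisible z₀ N fun p => G (p.1, S (a * p.1, p.2)) := by
  obtain ⟨R, hR, h⟩ := h
  exact ⟨_, hS.comp_analyticAt a hR, (hS.tendsto a).eventually h⟩

theorem IsDivisible.comp_mul {N : ℕ} {G : ℂ × E → ℂ} (h : IsDivisible z₀ N G) (a : ℂ) :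
    IsDivisible z₀ N fun p => G (a * p.1, p.2) := by
  obtain ⟨R, hR, h⟩ := h
  have h1 : AnalyticAt ℂ (fun p : ℂ × E => (a * p.1, p.2)) (0, z₀) :=
    (analyticAt_const.fun_mul analyticAt_fst).prod analyticAt_snd
  have h2 : Tendsto (fun p : ℂ × E => (a * p.1, p.2)) (𝓝 (0, z₀)) (𝓝 (0, z₀)) := by
    have := h1.continuousAt
    rw [ContinuousAt] at this
    simpa using this
  refine ⟨fun p => a ^ N * R (a * p.1, p.2), analyticAt_const.fun_mul
    (AnalyticAt.fun_comp (g := R) (f := fun p : ℂ × E => (a * p.1, p.2)) (by simpa using hR) h1), ?_⟩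
  filter_upwards [h2.eventually h] with p hp
  rw [hp]; ring

theorem analyticAt_snd_comp {g : E → ℂ} (hg : AnalyticAt ℂ g z₀) (x : ℂ) :
    AnalyticAt ℂ (fun p : ℂ × E => g p.2) (x, z₀) :=
  AnalyticAt.fun_comp (g := g) (f := fun p : ℂ × E => p.2) hg analyticAt_snd

/-- The space of germs of analytic functions at `z₀`. -/
def analyticGerms (z₀ : E) : Submodule ℂ (Germ (𝓝 z₀) ℂ) where
  carrier := {γ | ∃ g : E → ℂ, AnalyticAt ℂ g z₀ ∧ (g : Germ (𝓝 z₀) ℂ) = γ}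
  add_mem' := by
    rintro _ _ ⟨g, hg, rfl⟩ ⟨g', hg', rfl⟩
    exact ⟨g + g', hg.add hg', rfl⟩
  zero_mem' := ⟨0, analyticAt_const, rfl⟩
  smul_mem' := by
    rintro a _ ⟨g, hg, rfl⟩
    exact ⟨a • g, analyticAt_const.smul hg, rfl⟩

/-- The germ of an analytic function. -/
def toGerm (g : E → ℂ) (hg : AnalyticAt ℂ g z₀) : analyticGerms z₀ := ⟨g, g, hg, rfl⟩

theorem toGerm_eq_iff {g g' : E → ℂ} {hg : AnalyticAt ℂ g z₀} {hg' : AnalyticAt ℂ g' z₀} :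
    toGerm g hg = toGerm g' hg' ↔ ∀ᶠ z in 𝓝 z₀, g z = g' z :=
  ⟨fun h => Germ.coe_eq.1 (congrArg Subtype.val h), fun h => Subtype.ext (Germ.coe_eq.2 h)⟩

theorem exists_toGerm (γ : analyticGerms z₀) :
    ∃ (g : E → ℂ) (hg : AnalyticAt ℂ g z₀), toGerm g hg = γ := by
  obtain ⟨γ, g, hg, rfl⟩ := γ
  exact ⟨g, hg, rfl⟩

theorem toGerm_add {g g' : E → ℂ} (hg : AnalyticAt ℂ g z₀) (hg' : AnalyticAt ℂ g' z₀) :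
    toGerm g hg + toGerm g' hg' = toGerm (fun z => g z + g' z) (hg.fun_add hg') := rfl

theorem toGerm_smul (a : ℂ) {g : E → ℂ} (hg : AnalyticAt ℂ g z₀) :
    a • toGerm g hg = toGerm (fun z => a * g z) (analyticAt_const.fun_mul hg) := rfl

theorem toGerm_sum {ι : Type*} (s : Finset ι) {g : ι → E → ℂ} (hg : ∀ i, AnalyticAt ℂ (g i) z₀) :
    ∑ i ∈ s, toGerm (g i) (hg i)
      = toGerm (fun z => ∑ i ∈ s, g i z) (Finset.analyticAt_fun_sum s fun i _ => hg i) := by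
  classical
  induction s using Finset.induction_on with
  | empty => rfl
  | insert a s ha ih =>
    rw [Finset.sum_insert ha, ih, toGerm_add, toGerm_eq_iff]
    exact Eventually.of_forall fun z => (Finset.sum_insert (f := fun i => g i z) ha).symm

/-- `G(h, z) = ∑ h^m b_m(z)` as an expansion in powers of `h`, with `b_m` germs at `z₀`. -/
def HasExpansion (G : ℂ × E → ℂ) (b : ℕ → analyticGerms z₀) : Prop :=
  ∃ (a : ℕ → E → ℂ) (ha : ∀ m, AnalyticAt ℂ (a m) z₀), (∀ m, toGerm (a m) (ha m) = b m) ∧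
    ∀ N, IsDivisible z₀ N fun p => G p - ∑ m ∈ Finset.range N, p.1 ^ m * a m p.2

theorem exists_hasExpansion {G : ℂ × E → ℂ} (hG : AnalyticAt ℂ G (0, z₀)) :
    ∃ b : ℕ → analyticGerms z₀, HasExpansion G b := by
  choose R hR hdiv using fun G : {G : ℂ × E → ℂ // AnalyticAt ℂ G (0, z₀)} =>
    exists_analyticAt_div G.2
  let Q : ℕ → {G : ℂ × E → ℂ // AnalyticAt ℂ G (0, z₀)} :=
    fun m => Nat.rec ⟨G, hG⟩ (fun _ q => ⟨R q, hR q⟩) m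
  have hQ : ∀ m, ∀ᶠ y in 𝓝 ((0 : ℂ), z₀),
      (Q m).1 y = (Q m).1 (0, y.2) + y.1 * (Q (m + 1)).1 y := fun m => hdiv (Q m)
  have ha : ∀ m, AnalyticAt ℂ (fun z => (Q m).1 (0, z)) z₀ := fun m =>
    AnalyticAt.fun_comp (g := (Q m).1) (f := fun z : E => ((0 : ℂ), z)) (Q m).2
      (analyticAt_const.prod analyticAt_id)
  refine ⟨fun m => toGerm _ (ha m), _, ha, fun m => rfl, fun N => ⟨(Q N).1, (Q N).2, ?_⟩⟩
  induction N with
  | zero => simp [Q]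
  | succ N ih =>
    filter_upwards [ih, hQ N] with p h1 h2
    rw [Finset.sum_range_succ, ← sub_sub, h1, h2]
    ring

theorem IsDivisible.eventually_bound {N : ℕ} {G : ℂ × E → ℂ} (h : IsDivisible z₀ N G) :
    ∃ C, ∀ᶠ p in 𝓝 ((0 : ℂ), z₀), ‖G p‖ ≤ C * ‖p.1‖ ^ N := by
  obtain ⟨R, hR, h⟩ := h
  have h2 := hR.continuousAt.norm.eventually_lt_const (lt_add_one _)
  refine ⟨‖R (0, z₀)‖ + 1, ?_⟩
  filter_upwards [h, h2] with p h1 h2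
  rw [h1, norm_mul, norm_pow, mul_comm]
  gcongr

theorem eventually_slice {X Y : Type*} [TopologicalSpace X] [TopologicalSpace Y] {x₀ : X} {y₀ : Y}
    {P : X × Y → Prop} (h : ∀ᶠ p in 𝓝 (x₀, y₀), P p) : ∀ᶠ y in 𝓝 y₀, ∀ᶠ x in 𝓝 x₀, P (x, y) := by
  rw [nhds_prod_eq] at h
  exact (eventually_swap_iff.1 h).curry

/-- An expansion determines its coefficients. -/
theorem eventually_eq_zero_of_isDivisible {a : ℕ → E → ℂ}
    (h : ∀ N, IsDivisible z₀ N fun p => ∑ m ∈ Finset.range N, p.1 ^ m * a m p.2) (m : ℕ) :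
    ∀ᶠ z in 𝓝 z₀, a m z = 0 := by
  induction m using Nat.strong_induction_on with
  | _ m ih =>
    obtain ⟨C, hC⟩ := (h (m + 1)).eventually_bound
    have h2 : ∀ᶠ z in 𝓝 z₀, ∀ j ∈ Finset.range m, a j z = 0 :=
      (Finset.eventually_all _).2 fun j hj => ih j (Finset.mem_range.1 hj)
    filter_upwards [eventually_slice hC, h2] with z h3 h4
    have h5 : ∀ᶠ t in 𝓝[≠] (0 : ℂ), ‖a m z‖ ≤ C * ‖t‖ := by
      filter_upwards [h3.filter_mono nhdsWithin_le_nhds, self_mem_nhdsWithin] with t ht ht0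
      rw [Finset.sum_range_succ, Finset.sum_eq_zero fun j hj => by rw [h4 j hj, mul_zero],
        zero_add, norm_mul, norm_pow, pow_succ, ← mul_assoc, mul_right_comm, mul_comm] at ht
      exact le_of_mul_le_mul_right ht (pow_pos (norm_pos_iff.2 ht0) m)
    have h6 : Tendsto (fun t : ℂ => C * ‖t‖) (𝓝[≠] 0) (𝓝 0) := by
      have : Tendsto (fun t : ℂ => C * ‖t‖) (𝓝 0) (𝓝 (C * ‖(0 : ℂ)‖)) :=
        (continuous_const.mul continuous_norm).tendsto 0
      rw [norm_zero, mul_zero] at this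
      exact this.mono_left nhdsWithin_le_nhds
    exact norm_le_zero_iff.1 (ge_of_tendsto h6 h5)

theorem HasExpansion.unique {G : ℂ × E → ℂ} {b b' : ℕ → analyticGerms z₀}
    (h : HasExpansion G b) (h' : HasExpansion G b') : b = b' := by
  obtain ⟨a, ha, hb, h⟩ := h
  obtain ⟨a', ha', hb', h'⟩ := h'
  funext m
  rw [← hb, ← hb', toGerm_eq_iff]
  have := eventually_eq_zero_of_isDivisible (z₀ := z₀) (a := fun m z => a m z - a' m z)
    (fun N => ((h' N).sub (h N)).congr (Eventually.of_forall fun p => by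
      simp only [mul_sub, Finset.sum_sub_distrib]; ring)) m
  filter_upwards [this] with z hz
  exact sub_eq_zero.1 hz

theorem HasExpansion.of_eq {G : ℂ × E → ℂ} {b b' : ℕ → analyticGerms z₀}
    (h : HasExpansion G b) (hb : ∀ m, b' m = b m) : HasExpansion G b' := by
  rwa [funext hb]

theorem HasExpansion.congr {G G' : ℂ × E → ℂ} {b : ℕ → analyticGerms z₀}
    (h : HasExpansion G b) (hG : ∀ᶠ p in 𝓝 ((0 : ℂ), z₀), G' p = G p) : HasExpansion G' b := by
  obtain ⟨a, ha, hb, h⟩ := h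
  exact ⟨a, ha, hb, fun N => (h N).congr (hG.mono fun p hp => by rw [hp])⟩

theorem HasExpansion.add {G G' : ℂ × E → ℂ} {b b' : ℕ → analyticGerms z₀}
    (h : HasExpansion G b) (h' : HasExpansion G' b') :
    HasExpansion (fun p => G p + G' p) (b + b') := by
  obtain ⟨a, ha, hb, h⟩ := h
  obtain ⟨a', ha', hb', h'⟩ := h'
  refine ⟨fun m z => a m z + a' m z, fun m => (ha m).fun_add (ha' m), fun m => ?_, fun N => ?_⟩
  · rw [← toGerm_add (ha m) (ha' m), hb, hb', Pi.add_apply]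
  · refine ((h N).add (h' N)).congr (Eventually.of_forall fun p => ?_)
    simp only [mul_add, Finset.sum_add_distrib]; ring

theorem HasExpansion.smul {G : ℂ × E → ℂ} {b : ℕ → analyticGerms z₀} (c : ℂ)
    (h : HasExpansion G b) : HasExpansion (fun p => c * G p) (c • b) := by
  obtain ⟨a, ha, hb, h⟩ := h
  refine ⟨fun m z => c * a m z, fun m => analyticAt_const.fun_mul (ha m), fun m => ?_, fun N => ?_⟩
  · rw [← toGerm_smul c (ha m), hb, Pi.smul_apply]
  · refine ((h N).mul_left (K := fun _ => c) analyticAt_const).congr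
      (Eventually.of_forall fun p => ?_)
    rw [mul_sub, Finset.mul_sum]
    congr 1
    exact Finset.sum_congr rfl fun m _ => by ring

theorem hasExpansion_snd {g : E → ℂ} (hg : AnalyticAt ℂ g z₀) :
    HasExpansion (fun p : ℂ × E => g p.2) (fun m => if m = 0 then toGerm g hg else 0) := by
  refine ⟨fun m => if m = 0 then g else fun _ => 0, fun m => ?_, fun m => ?_, fun N => ?_⟩
  · change AnalyticAt ℂ (if m = 0 then g else fun _ => 0) z₀
    split_ifs
    exacts [hg, analyticAt_const]
  · by_cases hm : m = 0
    · subst hm; rfl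
    · simp only [if_neg hm]; rfl
  · cases N with
    | zero => simpa using isDivisible_of_analyticAt (analyticAt_snd_comp hg 0)
    | succ N =>
      refine (isDivisible_zero _).congr (Eventually.of_forall fun p => ?_)
      rw [Finset.sum_range_succ']
      simp

/-- An expansion without terms of degree below `N` belongs to a multiple of `h^N`. -/
theorem HasExpansion.isDivisible {G : ℂ × E → ℂ} {b : ℕ → analyticGerms z₀}
    (h : HasExpansion G b) {N : ℕ} (hb0 : ∀ m < N, b m = 0) : IsDivisible z₀ N G := by
  obtain ⟨a, ha, hb, h⟩ := h
  refine (h N).congr ?_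
  have h1 : ∀ᶠ z in 𝓝 z₀, ∀ m ∈ Finset.range N, a m z = 0 := by
    refine (Finset.eventually_all _).2 fun m hm => ?_
    have h2 : toGerm (a m) (ha m) = toGerm (fun _ => 0) analyticAt_const := by
      rw [hb, hb0 m (Finset.mem_range.1 hm)]; rfl
    exact toGerm_eq_iff.1 h2
  have h2 : Tendsto (fun p : ℂ × E => p.2) (𝓝 ((0 : ℂ), z₀)) (𝓝 z₀) := continuous_snd.tendsto _
  filter_upwards [h2.eventually h1] with p hp
  rw [Finset.sum_eq_zero fun m hm => by rw [hp m hm, mul_zero], sub_zero]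

/-! ### The series of operators of an analytic one-step method -/

theorem IsAnalyticStep.comp_germ_analyticAt (hS : IsAnalyticStep z₀ S) {g : E → ℂ}
    (hg : AnalyticAt ℂ g z₀) : AnalyticAt ℂ (fun p => g (S p)) (0, z₀) :=
  AnalyticAt.fun_comp (g := g) (f := S) (by rwa [hS.map_zero]) hS.analyticAt

theorem IsAnalyticStep.exists_coefficients (hS : IsAnalyticStep z₀ S) (γ : analyticGerms z₀) :
    ∃ b : ℕ → analyticGerms z₀, ∀ (g : E → ℂ) (hg : AnalyticAt ℂ g z₀), toGerm g hg = γ →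
      HasExpansion (fun p => g (S p)) b := by
  obtain ⟨g, hg, rfl⟩ := exists_toGerm γ
  obtain ⟨b, hb⟩ := exists_hasExpansion (hS.comp_germ_analyticAt hg)
  refine ⟨b, fun g' hg' h => hb.congr ?_⟩
  have h1 := toGerm_eq_iff.1 h
  have h2 : Tendsto S (𝓝 (0, z₀)) (𝓝 z₀) := by
    have := hS.analyticAt.continuousAt
    rwa [ContinuousAt, hS.map_zero] at this
  exact h2.eventually h1

/-- The coefficient of `h^m` in `g ↦ g ∘ S_h`. -/
def stepOp (hS : IsAnalyticStep z₀ S) (m : ℕ) : Module.End ℂ (analyticGerms z₀) where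
  toFun γ := (hS.exists_coefficients γ).choose m
  map_add' γ γ' := by
    obtain ⟨g, hg, rfl⟩ := exists_toGerm γ
    obtain ⟨g', hg', rfl⟩ := exists_toGerm γ'
    have h1 := (hS.exists_coefficients (toGerm g hg)).choose_spec g hg rfl
    have h2 := (hS.exists_coefficients (toGerm g' hg')).choose_spec g' hg' rfl
    have h3 := (hS.exists_coefficients (toGerm g hg + toGerm g' hg')).choose_spec _ _
      (toGerm_add hg hg').symm
    rw [(h3.unique (h1.add h2))]
    rfl
  map_smul' c γ := by
    obtain ⟨g, hg, rfl⟩ := exists_toGerm γ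
    have h1 := (hS.exists_coefficients (toGerm g hg)).choose_spec g hg rfl
    have h3 := (hS.exists_coefficients (c • toGerm g hg)).choose_spec _ _ (toGerm_smul c hg).symm
    rw [(h3.unique (h1.smul c))]
    rfl

theorem hasExpansion_stepOp (hS : IsAnalyticStep z₀ S) {g : E → ℂ} (hg : AnalyticAt ℂ g z₀) :
    HasExpansion (fun p => g (S p)) fun m => stepOp hS m (toGerm g hg) :=
  (hS.exists_coefficients (toGerm g hg)).choose_spec g hg rfl

/-- Composition of an expansion with one step. -/
theorem HasExpansion.comp_step (hS : IsAnalyticStep z₀ S) (c : ℂ) {G : ℂ × E → ℂ}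
    {b : ℕ → analyticGerms z₀} (h : HasExpansion G b) :
    HasExpansion (fun p => G (p.1, S (c * p.1, p.2))) fun m =>
      ∑ x ∈ Finset.HasAntidiagonal.antidiagonal m, c ^ x.1 • stepOp hS x.1 (b x.2) := by
  obtain ⟨β, hβ, hb, h⟩ := h
  choose σ hσ hσ' hdiv using fun j => hasExpansion_stepOp hS (hβ j)
  have hterm : ∀ i j, AnalyticAt ℂ (fun z => c ^ i * σ j i z) z₀ := fun i j =>
    analyticAt_const.fun_mul (hσ j i)
  refine ⟨fun m z => ∑ x ∈ Finset.HasAntidiagonal.antidiagonal m, c ^ x.1 * σ x.2 x.1 z, fun m =>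
    Finset.analyticAt_fun_sum _ fun x _ => hterm x.1 x.2, fun m => ?_, fun N => ?_⟩
  · rw [← toGerm_sum _ (fun x : ℕ × ℕ => hterm x.1 x.2)]
    refine Finset.sum_congr rfl fun x _ => ?_
    rw [← toGerm_smul _ (hσ x.2 x.1), hσ', hb]
  · let t : ℕ × ℕ → ℂ × E → ℂ := fun x p => p.1 ^ (x.1 + x.2) * (c ^ x.1 * σ x.2 x.1 p.2)
    have d1 := (h N).comp_step hS c
    have d2 : ∀ j, IsDivisible z₀ N fun p =>
        β j (S (c * p.1, p.2)) - ∑ i ∈ Finset.range N, (c * p.1) ^ i * σ j i p.2 :=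
      fun j => (hdiv j N).comp_mul c
    have d3 : IsDivisible z₀ N fun p => ∑ j ∈ Finset.range N, p.1 ^ j *
        (β j (S (c * p.1, p.2)) - ∑ i ∈ Finset.range N, (c * p.1) ^ i * σ j i p.2) :=
      IsDivisible.sum fun j _ => (d2 j).mul_left (K := fun p => p.1 ^ j) (analyticAt_fst.pow j)
    have d4 : IsDivisible z₀ N fun p => ∑ i ∈ Finset.range N, ∑ j ∈ Finset.range N,
        if i + j < N then 0 else t (i, j) p := by
      refine IsDivisible.sum fun i _ => IsDivisible.sum fun j _ => ?_
      split_ifs with hij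
      · exact isDivisible_zero N
      · exact isDivisible_pow_mul (not_lt.1 hij) (analyticAt_snd_comp (hterm i j) 0)
    refine ((d1.add d3).add d4).congr (Eventually.of_forall fun p => ?_)
    have e1 : ∑ m ∈ Finset.range N, p.1 ^ m *
        ∑ x ∈ Finset.HasAntidiagonal.antidiagonal m, c ^ x.1 * σ x.2 x.1 p.2
        = ∑ i ∈ Finset.range N, ∑ j ∈ Finset.range N, if i + j < N then t (i, j) p else 0 := by
      rw [← sum_range_antidiagonal N (fun x => if x.1 + x.2 < N then t x p else 0)
        (fun x hx => if_neg (by omega))]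
      refine Finset.sum_congr rfl fun m hm => ?_
      rw [Finset.mul_sum]
      refine Finset.sum_congr rfl fun x hx => ?_
      rw [Finset.HasAntidiagonal.mem_antidiagonal] at hx
      rw [if_pos (by rw [hx]; exact Finset.mem_range.1 hm)]
      simp only [t, hx]
    have e2 : ∑ i ∈ Finset.range N, ∑ j ∈ Finset.range N, (if i + j < N then t (i, j) p else 0)
        + ∑ i ∈ Finset.range N, ∑ j ∈ Finset.range N, (if i + j < N then 0 else t (i, j) p)
        = ∑ j ∈ Finset.range N, p.1 ^ j * ∑ i ∈ Finset.range N, (c * p.1) ^ i * σ j i p.2 := by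
      simp only [← Finset.sum_add_distrib]
      rw [Finset.sum_comm]
      refine Finset.sum_congr rfl fun j _ => ?_
      rw [Finset.mul_sum]
      refine Finset.sum_congr rfl fun i _ => ?_
      rw [mul_pow]
      split_ifs <;> simp only [t] <;> ring
    simp only [e1, mul_sub, Finset.sum_sub_distrib]
    rw [← e2]
    ring

/-- The algebra of operators on germs of analytic functions. -/
def GermOps (z₀ : E) : Type _ := Module.End ℂ (analyticGerms z₀)

instance : Ring (GermOps z₀) := inferInstanceAs (Ring (Module.End ℂ (analyticGerms z₀)))

instance : Algebra ℂ (GermOps z₀) :=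
  inferInstanceAs (Algebra ℂ (Module.End ℂ (analyticGerms z₀)))

/-- An endomorphism as an element of the algebra of operators. -/
def GermOps.of (T : Module.End ℂ (analyticGerms z₀)) : GermOps z₀ := T

/-- The value of an operator at a germ. -/
def applyOp (γ : analyticGerms z₀) : GermOps z₀ →ₗ[ℂ] analyticGerms z₀ where
  toFun T := (show Module.End ℂ (analyticGerms z₀) from T) γ
  map_add' _ _ := rfl
  map_smul' _ _ := rfl

theorem applyOp_mul (γ : analyticGerms z₀) (T U : GermOps z₀) :
    applyOp γ (T * U) = applyOp (applyOp γ U) T := rfl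

theorem applyOp_one (γ : analyticGerms z₀) : applyOp γ (1 : GermOps z₀) = γ := rfl

theorem GermOps.ext {T U : GermOps z₀} (h : ∀ (g : E → ℂ) (hg : AnalyticAt ℂ g z₀),
    applyOp (toGerm g hg) T = applyOp (toGerm g hg) U) : T = U :=
  LinearMap.ext fun γ => by
    obtain ⟨g, hg, rfl⟩ := exists_toGerm γ
    exact h g hg

/-- The composition of steps `l` of an analytic method, with the step as a variable. -/
def stepList (S : ℂ × E → E) (l : List ℂ) (p : ℂ × E) : E :=
  l.foldl (fun y a => S (a * p.1, y)) p.2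

/-- The series of operators of an analytic method. -/
def stepSeries (hS : IsAnalyticStep z₀ S) : PowerSeries (GermOps z₀) :=
  PowerSeries.mk fun m => GermOps.of (stepOp hS m)

theorem applyOp_coeff_stepSeries (hS : IsAnalyticStep z₀ S) (m : ℕ) (γ : analyticGerms z₀) :
    applyOp γ (PowerSeries.coeff m (stepSeries hS)) = stepOp hS m γ := by
  rw [stepSeries, PowerSeries.coeff_mk]; rfl

theorem hasExpansion_stepList (hS : IsAnalyticStep z₀ S) {g : E → ℂ} (hg : AnalyticAt ℂ g z₀)
    (l : List ℂ) :
    HasExpansion (fun p => g (stepList S l p)) fun m =>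
      applyOp (toGerm g hg)
        (PowerSeries.coeff m (l.map fun a => scale a (stepSeries hS)).prod) := by
  induction l with
  | nil =>
    refine (hasExpansion_snd hg).of_eq fun m => ?_
    rw [List.map_nil, List.prod_nil, PowerSeries.coeff_one]
    split_ifs
    · rfl
    · exact map_zero _
  | cons a l ih =>
    refine (ih.comp_step hS a).of_eq fun m => ?_
    rw [List.map_cons, List.prod_cons, PowerSeries.coeff_mul, map_sum]
    refine Finset.sum_congr rfl fun x _ => ?_
    rw [applyOp_mul, coeff_scale, map_smul, applyOp_coeff_stepSeries]

theorem coeff_zero_stepSeries (hS : IsAnalyticStep z₀ S) :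
    PowerSeries.coeff 0 (stepSeries hS) = 1 := by
  refine GermOps.ext fun g hg => ?_
  rw [applyOp_coeff_stepSeries, applyOp_one]
  obtain ⟨a, ha, hb, h⟩ := hasExpansion_stepOp hS hg
  refine (hb 0).symm.trans (toGerm_eq_iff.2 ?_)
  obtain ⟨R, hR, h1⟩ := h 1
  have h2 : Tendsto (fun z : E => ((0 : ℂ), z)) (𝓝 z₀) (𝓝 (0, z₀)) :=
    (Continuous.prodMk_right (0 : ℂ)).tendsto z₀
  filter_upwards [h2.eventually h1, hS.initial] with z hz hz2
  simp only [Finset.sum_range_one, pow_zero, one_mul, pow_one, zero_mul, hz2] at hz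
  exact (sub_eq_zero.1 hz).symm

/-- The algebra homomorphism that sends `Y_{2k+1}` to the corresponding coefficient of the
logarithm of the series of operators of the method. -/
def operatorHom (hS : IsAnalyticStep z₀ S) :
    FreeAlgebra ℂ ℕ →ₐ[ℂ] GermOps z₀ :=
  FreeAlgebra.lift ℂ fun k => PowerSeries.coeff (2 * k + 1) (formalLog (stepSeries hS))

theorem map_stageExponent (hS : IsAnalyticStep z₀ S)
    (hsym : ∀ᶠ p in 𝓝 ((0 : ℂ), z₀), S (p.1, S (-p.1, p.2)) = p.2) (a : ℂ) :
    PowerSeries.map (operatorHom hS : FreeAlgebra ℂ ℕ →+* GermOps z₀)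
      (stageExponent a) = scale a (formalLog (stepSeries hS)) := by
  have hlog := formalExp_formalLog (P := stepSeries hS) (coeff_zero_stepSeries hS)
  have hv := vanishesTo_formalLog (stepSeries hS)
  have hinv : scale (-1) (stepSeries hS) * stepSeries hS = 1 := by
    ext1 m
    refine GermOps.ext fun g hg => ?_
    have h1 := hasExpansion_stepList hS hg [-1, 1]
    have h2 : HasExpansion (fun p => g (stepList S [-1, 1] p))
        (fun m => if m = 0 then toGerm g hg else 0) := by
      refine (hasExpansion_snd hg).congr (hsym.mono fun p hp => ?_)
      simp only [stepList, List.foldl_cons, List.foldl_nil, one_mul, neg_mul]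
      rw [hp]
    have h3 := congrFun (h1.unique h2) m
    have h4 : scale 1 (stepSeries hS) = stepSeries hS := by
      ext1 m; rw [coeff_scale, one_pow, one_smul]
    simp only [List.map_cons, List.map_nil, List.prod_cons, List.prod_nil, mul_one, h4] at h3
    rw [h3, PowerSeries.coeff_one]
    split_ifs
    · rfl
    · exact (map_zero _).symm
  have hodd : scale (-1) (formalLog (stepSeries hS)) = -formalLog (stepSeries hS) := by
    refine formalExp_injective (hv.scale _) hv.neg ?_
    rw [← scale_formalExp, hlog]
    have h1 := formalExp_mul_formalExp_neg hv
    rw [hlog] at h1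
    exact left_inv_eq_right_inv hinv h1
  ext1 m
  rw [PowerSeries.coeff_map, coeff_scale, stageExponent, PowerSeries.coeff_mk]
  by_cases hm : Odd m
  · rw [if_pos hm]
    have h2 : 2 * (m / 2) + 1 = m := by obtain ⟨k, rfl⟩ := hm; omega
    change operatorHom hS _ = _
    rw [map_smul, operatorHom, FreeAlgebra.lift_ι_apply, h2]
  · rw [if_neg hm, map_zero]
    have h3 := congrArg (PowerSeries.coeff m) hodd
    rw [coeff_scale, (Nat.not_odd_iff_even.1 hm).neg_one_pow, one_smul, map_neg] at h3
    have h4 : PowerSeries.coeff m (formalLog (stepSeries hS)) = 0 := by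
      have h5 : (2 : ℂ) • PowerSeries.coeff m (formalLog (stepSeries hS)) = 0 := by
        rw [two_smul]; nth_rewrite 1 [h3]; exact neg_add_cancel _
      exact (smul_eq_zero.1 h5).resolve_left two_ne_zero
    rw [h4, smul_zero]

/-- The expansion of an observable along a composition of steps of a symmetric method, through
the series of operators of the composition. -/
theorem hasExpansion_stageProd (hS : IsAnalyticStep z₀ S)
    (hsym : ∀ᶠ p in 𝓝 ((0 : ℂ), z₀), S (p.1, S (-p.1, p.2)) = p.2)
    {g : E → ℂ} (hg : AnalyticAt ℂ g z₀) (l : List ℂ) :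
    HasExpansion (fun p => g (stepList S l p)) fun m =>
      applyOp (toGerm g hg) (operatorHom hS (PowerSeries.coeff m (stageProd l))) := by
  have h1 : PowerSeries.map (operatorHom hS : FreeAlgebra ℂ ℕ →+* GermOps z₀)
      (stageProd l) = (l.map fun a => scale a (stepSeries hS)).prod := by
    rw [stageProd, map_list_prod, List.map_map]
    congr 2
    funext a
    refine (map_formalExp (operatorHom hS : FreeAlgebra ℂ ℕ →+* GermOps z₀)
      (stageExponent a)).trans ?_
    rw [map_stageExponent hS hsym, ← scale_formalExp,
      formalExp_formalLog (P := stepSeries hS) (coeff_zero_stepSeries hS)]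
  have h2 := hasExpansion_stepList hS hg l
  rw [← h1] at h2
  exact h2

theorem operatorHom_ι_zero (hS : IsAnalyticStep z₀ S) :
    operatorHom hS (FreeAlgebra.ι ℂ 0) = PowerSeries.coeff 1 (stepSeries hS) := by
  rw [operatorHom, FreeAlgebra.lift_ι_apply, formalLog, mul_zero, zero_add, PowerSeries.coeff_mk,
    Finset.Icc_self, Finset.sum_singleton]
  simp [PowerSeries.coeff_one]

end Expansion

end SymConj

end

noncomputable section

namespace SymConj

/-! ### Taylor expansion along a flow -/

section Flow

variable {d : ℕ} {f : (Fin d → ℝ) → (Fin d → ℝ)} {x₀ : Fin d → ℝ}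
  {φ : ℝ → (Fin d → ℝ) → (Fin d → ℝ)}

theorem IsLocalFlow.tendsto (hφ : IsLocalFlow f x₀ φ) :
    Tendsto (fun p : ℝ × (Fin d → ℝ) => φ p.1 p.2) (𝓝 (0, x₀)) (𝓝 x₀) := by
  have h := hφ.continuousAt
  rwa [ContinuousAt, hφ.initial.self_of_nhds] at h

/-- If `g (m+1)` is the derivative of `g m` along the field, then `g j` has the expected Taylor
expansion along the flow. -/
theorem IsLocalFlow.taylor (hφ : IsLocalFlow f x₀ φ) {g : ℕ → (Fin d → ℝ) → ℂ}
    (hg : ∀ m, ContinuousAt (g m) x₀)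
    (hd : ∀ m, ∀ᶠ x in 𝓝 x₀, ∃ L : (Fin d → ℝ) →L[ℝ] ℂ, HasFDerivAt (g m) L x ∧
      L (f x) = g (m + 1) x) (M : ℕ) :
    ∀ j, (fun p : ℝ × (Fin d → ℝ) => g j (φ p.1 p.2)
        - ∑ m ∈ Finset.range M, ((p.1 : ℂ) ^ m / (m.factorial : ℂ)) * g (j + m) p.2)
      =O[𝓝 (0, x₀)] fun p => p.1 ^ M := by
  induction M with
  | zero =>
    intro j
    simp only [Finset.sum_range_zero, sub_zero, pow_zero]
    exact ((hg j).tendsto.comp hφ.tendsto).isBigO_one ℝ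
  | succ M ih =>
    intro j
    obtain ⟨C, hC0, hC⟩ := (ih (j + 1)).exists_pos
    have h1 := hφ.tendsto.eventually (hd j)
    have hsnd : Tendsto (fun p : ℝ × (Fin d → ℝ) => p.2) (𝓝 (0, x₀)) (𝓝 x₀) :=
      continuous_snd.tendsto _
    have h2 := hsnd.eventually hφ.initial
    have h3 := ((hC.bound.and h1).and hφ.hasDerivAt).and h2
    obtain ⟨ε, hε, hball⟩ := Metric.eventually_nhds_iff_ball.1 h3
    refine IsBigO.of_bound C ?_
    filter_upwards [Metric.ball_mem_nhds ((0 : ℝ), x₀) hε] with p hp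
    obtain ⟨t, x⟩ := p
    have hmem : ∀ s : ℝ, |s| ≤ |t| → (s, x) ∈ Metric.ball ((0 : ℝ), x₀) ε := by
      intro s hs
      simp only [Metric.mem_ball, Prod.dist_eq, max_lt_iff, Real.dist_eq, sub_zero] at hp ⊢
      exact ⟨hs.trans_lt hp.1, hp.2⟩
    let K : ℝ → ℂ := fun s => g j (φ s x)
      - ∑ m ∈ Finset.range (M + 1), ((s : ℂ) ^ m / (m.factorial : ℂ)) * g (j + m) x
    let K' : ℝ → ℂ := fun s => g (j + 1) (φ s x)
      - ∑ m ∈ Finset.range M, ((s : ℂ) ^ m / (m.factorial : ℂ)) * g (j + 1 + m) x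
    have hK : ∀ s ∈ Set.Icc (-|t|) |t|, HasDerivWithinAt K (K' s) (Set.Icc (-|t|) |t|) s := by
      intro s hs
      obtain ⟨⟨⟨_, L, hL, hLf⟩, hder⟩, _⟩ := hball _ (hmem s (abs_le.2 hs))
      refine HasDerivAt.hasDerivWithinAt (HasDerivAt.sub ?_ ?_)
      · have := hL.comp_hasDerivAt s hder
        rwa [hLf] at this
      · have e : (fun s : ℝ => ∑ m ∈ Finset.range (M + 1),
            ((s : ℂ) ^ m / (m.factorial : ℂ)) * g (j + m) x)
            = fun s : ℝ => ∑ m ∈ Finset.range M,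
            ((s : ℂ) ^ (m + 1) / ((m + 1).factorial : ℂ)) * g (j + 1 + m) x + g j x := by
          funext s
          rw [Finset.sum_range_succ']
          simp [add_assoc, add_comm 1]
        rw [e]
        refine HasDerivAt.add_const _ (HasDerivAt.fun_sum fun m _ => ?_)
        have h5 : HasDerivAt (fun s : ℝ => (s : ℂ)) 1 s := Complex.ofRealCLM.hasDerivAt
        have h6 := (((h5.pow (m + 1)).div_const ((m + 1).factorial : ℂ)).mul_const
          (g (j + 1 + m) x))
        have h7 : ((m : ℂ) + 1) ≠ 0 := by exact_mod_cast m.succ_ne_zero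
        have h8 : (m.factorial : ℂ) ≠ 0 := by exact_mod_cast m.factorial_ne_zero
        refine h6.congr_deriv ?_
        rw [Nat.factorial_succ]
        push_cast
        field_simp
    have hb : ∀ s ∈ Set.Icc (-|t|) |t|, ‖K' s‖ ≤ C * |t| ^ M := by
      intro s hs
      obtain ⟨⟨⟨hbound, _⟩, _⟩, _⟩ := hball _ (hmem s (abs_le.2 hs))
      refine hbound.trans ?_
      rw [norm_pow, Real.norm_eq_abs]
      have := abs_le.2 hs
      gcongr
    have h0 : K 0 = 0 := by
      have hi := (hball _ hp).2
      simp only [K]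
      rw [Finset.sum_range_succ']
      simp only at hi
      simp [hi]
    have := (convex_Icc (-|t|) |t|).norm_image_sub_le_of_norm_hasDerivWithin_le hK hb
      (x := 0) (y := t) ⟨by simp, by simp⟩ ⟨neg_abs_le t, le_abs_self t⟩
    rw [h0, sub_zero, sub_zero, Real.norm_eq_abs, mul_assoc, ← pow_succ] at this
    simpa [norm_pow] using this

end Flow

theorem hasDerivAt_zero_of_isBigO {F : Type*} [NormedAddCommGroup F] [NormedSpace ℝ F]
    {k : ℝ → F} {C : ℝ} (h : ∀ᶠ t in 𝓝 (0 : ℝ), ‖k t‖ ≤ C * ‖t‖ ^ 2) : HasDerivAt k 0 0 := by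
  have h0 : k 0 = 0 := by simpa using h.self_of_nhds
  rw [hasDerivAt_iff_isLittleO_nhds_zero]
  simp only [zero_add, h0, sub_zero, smul_zero]
  have h1 : k =O[𝓝 0] fun t : ℝ => t ^ 2 := IsBigO.of_bound C (by simpa using h)
  exact h1.trans_isLittleO (isLittleO_pow_id one_lt_two)

/-! ### Second differences of analytic functions -/

section SecondDifference

variable {W : Type*} [NormedAddCommGroup W] [NormedSpace ℂ W]

theorem exists_norm_first_difference_le {G : W → ℂ} {w₀ : W} (hG : AnalyticAt ℂ G w₀) :
    ∃ C : ℝ, ∀ᶠ q : W × W in 𝓝 (w₀, 0), ‖G (q.1 + q.2) - G (q.1 - q.2)‖ ≤ C * ‖q.2‖ := by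
  obtain ⟨K, s, hs, hlip⟩ := hG.hasStrictFDerivAt.exists_lipschitzOnWith
  refine ⟨K * 2, ?_⟩
  have t1 : Tendsto (fun q : W × W => q.1 + q.2) (𝓝 (w₀, 0)) (𝓝 w₀) := by
    simpa only [add_zero] using
      (show Continuous fun q : W × W => q.1 + q.2 by fun_prop).tendsto (w₀, 0)
  have t2 : Tendsto (fun q : W × W => q.1 - q.2) (𝓝 (w₀, 0)) (𝓝 w₀) := by
    simpa only [sub_zero] using
      (show Continuous fun q : W × W => q.1 - q.2 by fun_prop).tendsto (w₀, 0)
  filter_upwards [t1.eventually hs, t2.eventually hs] with q h1 h2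
  have h3 := hlip.norm_sub_le h1 h2
  rw [show q.1 + q.2 - (q.1 - q.2) = (2 : ℂ) • q.2 by rw [two_smul]; abel, norm_smul] at h3
  simpa [mul_assoc] using h3

theorem exists_norm_second_difference_le {G : W → ℂ} {w₀ : W} (hG : AnalyticAt ℂ G w₀) :
    ∃ C : ℝ, ∀ᶠ q : W × W in 𝓝 (w₀, 0),
      ‖G (q.1 + q.2) + G (q.1 - q.2) - 2 * G q.1‖ ≤ C * ‖q.2‖ ^ 2 := by
  obtain ⟨K, s, hs, hlip⟩ := hG.fderiv.hasStrictFDerivAt.exists_lipschitzOnWith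
  have h1 : ∀ᶠ w in 𝓝 w₀, w ∈ s ∧ DifferentiableAt ℂ G w :=
    (eventually_mem_set.2 hs).and (hG.eventually_analyticAt.mono fun w hw => hw.differentiableAt)
  obtain ⟨ε, hε, hball⟩ := Metric.eventually_nhds_iff_ball.1 h1
  refine ⟨K * 2, ?_⟩
  filter_upwards [Metric.ball_mem_nhds (w₀, (0 : W)) (half_pos hε)] with q hq
  obtain ⟨w, v⟩ := q
  simp only [Metric.mem_ball, Prod.dist_eq, max_lt_iff, dist_zero_right] at hq
  have hmem : ∀ r : ℝ, |r| ≤ 1 → w + (r : ℂ) • v ∈ Metric.ball w₀ ε := by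
    intro r hr
    rw [Metric.mem_ball, dist_eq_norm, add_sub_right_comm]
    refine (norm_add_le _ _).trans_lt ?_
    rw [norm_smul, Complex.norm_real, Real.norm_eq_abs, ← dist_eq_norm]
    have : |r| * ‖v‖ ≤ ‖v‖ := mul_le_of_le_one_left (norm_nonneg _) hr
    linarith [hq.1, hq.2]
  have hder : ∀ r : ℝ, |r| ≤ 1 → HasDerivAt (fun r : ℝ => G (w + (r : ℂ) • v))
      (fderiv ℂ G (w + (r : ℂ) • v) v) r := by
    intro r hr
    have h2 := (hball _ (hmem r hr)).2.hasFDerivAt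
    have h3 : HasDerivAt (fun r : ℂ => w + r • v) v (r : ℂ) := by
      simpa using ((hasDerivAt_id (r : ℂ)).smul_const v).const_add w
    exact (h2.comp_hasDerivAt (r : ℂ) h3).comp_ofReal
  let k : ℝ → ℂ := fun r => G (w + (r : ℂ) • v) + G (w + ((-r : ℝ) : ℂ) • v)
  have hk : ∀ r ∈ Set.Icc (0 : ℝ) 1, HasDerivWithinAt k
      (fderiv ℂ G (w + (r : ℂ) • v) v - fderiv ℂ G (w + ((-r : ℝ) : ℂ) • v) v)
      (Set.Icc 0 1) r := by
    intro r hr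
    have hr1 : |r| ≤ 1 := abs_le.2 ⟨by linarith [hr.1], hr.2⟩
    have h2 := hder r hr1
    have h3 := (hder (-r) (by rwa [abs_neg])).scomp r (hasDerivAt_neg r)
    rw [neg_one_smul] at h3
    rw [sub_eq_add_neg]
    exact (h2.add h3).hasDerivWithinAt
  have hb : ∀ r ∈ Set.Ico (0 : ℝ) 1,
      ‖fderiv ℂ G (w + (r : ℂ) • v) v - fderiv ℂ G (w + ((-r : ℝ) : ℂ) • v) v‖
        ≤ K * 2 * ‖v‖ ^ 2 := by
    intro r hr
    have hr1 : |r| ≤ 1 := abs_le.2 ⟨by linarith [hr.1], hr.2.le⟩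
    have h4 := hlip.norm_sub_le (hball _ (hmem r hr1)).1
      (hball _ (hmem (-r) (by rwa [abs_neg]))).1
    have h5 : w + (r : ℂ) • v - (w + ((-r : ℝ) : ℂ) • v) = (2 * r : ℂ) • v := by
      push_cast; module
    rw [h5, norm_smul] at h4
    have h6 : ‖(2 * r : ℂ)‖ ≤ 2 := by
      rw [norm_mul, Complex.norm_real, Real.norm_eq_abs, Complex.norm_ofNat]
      linarith
    rw [← _root_.sub_apply]
    refine (ContinuousLinearMap.le_opNorm _ _).trans ?_
    calc _ ≤ (K * (‖(2 * r : ℂ)‖ * ‖v‖)) * ‖v‖ := by gcongr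
      _ ≤ (K * (2 * ‖v‖)) * ‖v‖ := by gcongr
      _ = K * 2 * ‖v‖ ^ 2 := by ring
  have hfin := norm_image_sub_le_of_norm_deriv_le_segment_01' hk hb
  have e1 : k 1 - k 0 = G (w + v) + G (w - v) - 2 * G w := by
    simp only [k]
    simp only [Complex.ofReal_one, one_smul, Complex.ofReal_neg, neg_smul, Complex.ofReal_zero,
      neg_zero, zero_smul, add_zero, sub_eq_add_neg w v]
    ring
  rwa [e1] at hfin

end SecondDifference

/-! ### Approximate symmetry -/

/-- A smooth integrator `R` with `R_{-h} ∘ R_h = id + O(h^{M+1})` has pseudo-symmetry order `M`. -/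
theorem isPseudoSymmetric_of_isBigO {d : ℕ} {x₀ : Fin d → ℝ}
    {R : ℝ → (Fin d → ℝ) → (Fin d → ℝ)} {R' : (ℝ × (Fin d → ℝ)) →L[ℝ] (Fin d → ℝ)}
    (hR : HasStrictFDerivAt (fun p : ℝ × (Fin d → ℝ) => R p.1 p.2) R' (0, x₀))
    (h0 : ∀ᶠ x in 𝓝 x₀, R 0 x = x) {M : ℕ}
    (hM : (fun p : ℝ × (Fin d → ℝ) => R (-p.1) (R p.1 p.2) - p.2) =O[𝓝 (0, x₀)]
      fun p => p.1 ^ (M + 1)) : IsPseudoSymmetric x₀ R M := by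
  let X := Fin d → ℝ
  let T : ℝ × X → ℝ × X := fun p => (p.1, R (-p.1) p.2)
  have hx₀ : R 0 x₀ = x₀ := h0.self_of_nhds
  have hR'2 : ∀ v : X, R' (0, v) = v := by
    intro v
    have h1 : HasFDerivAt (fun x : X => R 0 x) (R'.comp (ContinuousLinearMap.inr ℝ ℝ X)) x₀ :=
      hR.hasFDerivAt.comp (f := fun x : X => ((0 : ℝ), x)) x₀ (hasFDerivAt_prodMk_right 0 x₀)
    have h2 : HasFDerivAt (fun x : X => R 0 x) (ContinuousLinearMap.id ℝ X) x₀ :=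
      (hasFDerivAt_id x₀).congr_of_eventuallyEq h0
    have h3 := h1.unique h2
    exact congrArg (fun L : X →L[ℝ] X => L v) h3
  let a : X := R' (1, 0)
  have hR'1 : ∀ t v, R' (t, v) = t • a + v := by
    intro t v
    have : (t, v) = t • ((1 : ℝ), (0 : X)) + ((0 : ℝ), v) := by simp
    rw [this, map_add, map_smul, hR'2]
  let A : (ℝ × X) →L[ℝ] X := (ContinuousLinearMap.fst ℝ ℝ X).smulRight a
  let e : (ℝ × X) ≃L[ℝ] (ℝ × X) := ContinuousLinearEquiv.equivOfInverse
    ((ContinuousLinearMap.fst ℝ ℝ X).prod (ContinuousLinearMap.snd ℝ ℝ X - A))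
    ((ContinuousLinearMap.fst ℝ ℝ X).prod (ContinuousLinearMap.snd ℝ ℝ X + A))
    (fun p => by simp [A]) (fun p => by simp [A])
  have hT : HasStrictFDerivAt T (e : (ℝ × X) →L[ℝ] (ℝ × X)) (0, x₀) := by
    have h1 : HasStrictFDerivAt (fun p : ℝ × X => (-p.1, p.2))
        ((-ContinuousLinearMap.fst ℝ ℝ X).prod (ContinuousLinearMap.snd ℝ ℝ X)) (0, x₀) :=
      (hasStrictFDerivAt_fst.neg).prodMk hasStrictFDerivAt_snd
    have h2 : HasStrictFDerivAt (fun p : ℝ × X => R p.1 p.2) R' (-(0 : ℝ), x₀) := by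
      rwa [neg_zero]
    have h3 := hasStrictFDerivAt_fst.prodMk (h2.comp (f := fun p : ℝ × X => (-p.1, p.2)) (0, x₀) h1)
    refine h3.congr_fderiv ?_
    refine ContinuousLinearMap.ext fun p => ?_
    refine Prod.ext rfl ?_
    change R' (-p.1, p.2) = p.2 - p.1 • a
    rw [hR'1, neg_smul, neg_add_eq_sub]
  have hT0 : T (0, x₀) = (0, x₀) := by simp [T, hx₀]
  let J := hT.localInverse T e (0, x₀)
  have hJr : ∀ᶠ y in 𝓝 ((0 : ℝ), x₀), T (J y) = y := by
    have := hT.eventually_right_inverse; rwa [hT0] at this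
  have hJl : ∀ᶠ y in 𝓝 ((0 : ℝ), x₀), J (T y) = y := hT.eventually_left_inverse
  have hJs : HasStrictFDerivAt J (e.symm : (ℝ × X) →L[ℝ] (ℝ × X)) (0, x₀) := by
    have := hT.to_localInverse; rwa [hT0] at this
  have hJ0 : J (0, x₀) = (0, x₀) := by
    have := hT.localInverse_apply_image; rwa [hT0] at this
  have hJt : Tendsto J (𝓝 (0, x₀)) (𝓝 (0, x₀)) := by
    have := hJs.continuousAt; rwa [ContinuousAt, hJ0] at this
  refine ⟨fun h x => (J (h, x)).2, ⟨?_, ?_, ?_⟩, ?_⟩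
  · exact (continuous_snd.tendsto (0, x₀)).comp hJt
  · filter_upwards [hJr] with p hp
    have hp' : T (J p) = p := hp
    have h1 : (T (J p)).1 = p.1 := congrArg Prod.fst hp'
    have h2 : (T (J p)).2 = p.2 := congrArg Prod.snd hp'
    simp only [T] at h1 h2
    rwa [h1] at h2
  · filter_upwards [hJl] with p hp
    exact congrArg Prod.snd (show J (T p) = p from hp)
  · obtain ⟨K, s, hs, hlip⟩ := hJs.exists_lipschitzOnWith
    have hRt : Tendsto (fun p : ℝ × X => (p.1, R p.1 p.2)) (𝓝 (0, x₀)) (𝓝 (0, x₀)) := by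
      have h1 := hR.continuousAt
      rw [ContinuousAt, hx₀] at h1
      have h2 := (continuous_fst.tendsto ((0 : ℝ), x₀)).prodMk_nhds h1
      exact h2
    have hTt : Tendsto T (𝓝 (0, x₀)) (𝓝 (0, x₀)) := by
      have := hT.continuousAt; rwa [ContinuousAt, hT0] at this
    refine IsBigO.trans (IsBigO.of_bound K ?_) hM
    filter_upwards [hs, (hTt.comp hRt).eventually hs, hRt.eventually hJl] with p h1 h2 h3
    have h4 := hlip.norm_sub_le h1 h2
    simp only [Function.comp_apply] at h4
    rw [h3] at h4
    have h5 : (J p).2 - R p.1 p.2 = (J p - (p.1, R p.1 p.2)).2 := rfl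
    have h6 : p - T (p.1, R p.1 p.2) = (0, -(R (-p.1) (R p.1 p.2) - p.2)) := by
      refine Prod.ext ?_ ?_ <;> simp [T]
    change ‖(J p).2 - R p.1 p.2‖ ≤ _
    rw [h5]
    refine (norm_snd_le _).trans (h4.trans ?_)
    rw [h6, Prod.norm_mk, norm_zero, norm_neg, max_eq_right (norm_nonneg _)]

end SymConj

end

noncomputable section

namespace SymConj

/-! ### Compositions of steps -/

section Compositions

theorem stepList_cons {E : Type*} (S : ℂ × E → E) (a : ℂ) (l : List ℂ) (p : ℂ × E) :
    stepList S (a :: l) p = stepList S l (p.1, S (a * p.1, p.2)) := rfl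

theorem stepList_concat {E : Type*} (S : ℂ × E → E) (a : ℂ) (l : List ℂ) (p : ℂ × E) :
    stepList S (l ++ [a]) p = S (a * p.1, stepList S l p) := by
  simp [stepList]

variable {E : Type*} [NormedAddCommGroup E] [NormedSpace ℂ E] {z₀ : E} {S : ℂ × E → E}

theorem tendsto_mul_step {E : Type*} [TopologicalSpace E] (a : ℂ) (z₀ : E) :
    Tendsto (fun p : ℂ × E => (a * p.1, p.2)) (𝓝 (0, z₀)) (𝓝 (0, z₀)) := by
  have h : Continuous fun p : ℂ × E => (a * p.1, p.2) := by fun_prop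
  simpa using h.tendsto (0, z₀)

theorem IsAnalyticStep.stepList (hS : IsAnalyticStep z₀ S) (l : List ℂ) :
    IsAnalyticStep z₀ (stepList S l) := by
  induction l with
  | nil => exact ⟨analyticAt_snd, Eventually.of_forall fun z => rfl⟩
  | cons a l ih =>
    refine ⟨?_, ?_⟩
    · refine AnalyticAt.fun_comp (g := SymConj.stepList S l)
        (f := fun p : ℂ × E => (p.1, S (a * p.1, p.2))) ?_ (hS.analyticAt_prod a)
      simpa [hS.map_zero] using ih.analyticAt
    · filter_upwards [hS.initial, ih.initial] with z h1 h2
      rw [stepList_cons, mul_zero, h1, h2]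

theorem eventually_stepList_reverse (hS : IsAnalyticStep z₀ S)
    (hsym : ∀ᶠ p in 𝓝 ((0 : ℂ), z₀), S (p.1, S (-p.1, p.2)) = p.2) (l : List ℂ) :
    ∀ᶠ p in 𝓝 ((0 : ℂ), z₀), stepList S l.reverse (-p.1, stepList S l p) = p.2 := by
  induction l with
  | nil => exact Eventually.of_forall fun p => rfl
  | cons a l ih =>
    filter_upwards [(hS.tendsto a).eventually ih, (tendsto_mul_step (-a) z₀).eventually hsym]
      with p h1 h2
    rw [List.reverse_cons, stepList_concat, stepList_cons]
    simp only at h1 h2 ⊢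
    rw [h1]
    simpa using h2

theorem eventually_stepList_star {d : ℕ} {z₀ : Fin d → ℂ} {S : ℂ × (Fin d → ℂ) → (Fin d → ℂ)}
    (hS : IsAnalyticStep z₀ S) (hstar : ∀ᶠ p in 𝓝 ((0 : ℂ), z₀), S (star p) = star (S p))
    (l : List ℂ) :
    ∀ᶠ p in 𝓝 ((0 : ℂ), z₀), stepList S (l.map (starRingEnd ℂ)) (star p)
      = star (stepList S l p) := by
  induction l with
  | nil => exact Eventually.of_forall fun p => rfl
  | cons a l ih =>
    filter_upwards [(hS.tendsto a).eventually ih, (tendsto_mul_step a z₀).eventually hstar]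
      with p h1 h2
    rw [List.map_cons, stepList_cons, stepList_cons, ← h1]
    have e : ((starRingEnd ℂ) a * (star p).1, (star p).2) = star (a * p.1, p.2) :=
      Prod.ext (map_mul (starRingEnd ℂ) a p.1).symm rfl
    rw [e, h2]
    rfl

/-- The mean of a method and of a second one is symmetric up to twice the order of their
difference, if each of them is the adjoint of the other. -/
theorem isBigO_mean_comp_mean {d : ℕ} {z₀ : Fin d → ℂ} {ψ ψ' : ℂ × (Fin d → ℂ) → (Fin d → ℂ)}
    (hψ : IsAnalyticStep z₀ ψ) (hψ' : IsAnalyticStep z₀ ψ') {N : ℕ}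
    (h1 : ∀ᶠ p in 𝓝 ((0 : ℂ), z₀), ψ' (-p.1, ψ p) = p.2)
    (h2 : ∀ᶠ p in 𝓝 ((0 : ℂ), z₀), ψ (-p.1, ψ' p) = p.2)
    (hdiv : ∀ i, IsDivisible z₀ N fun p => ψ p i - ψ' p i) :
    (fun p : ℂ × (Fin d → ℂ) => (1 / 2 : ℂ) • (ψ (-p.1, (1 / 2 : ℂ) • (ψ p + ψ' p))
      + ψ' (-p.1, (1 / 2 : ℂ) • (ψ p + ψ' p))) - p.2) =O[𝓝 (0, z₀)] fun p => p.1 ^ (2 * N) := by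
  set ρ : ℂ × (Fin d → ℂ) → (Fin d → ℂ) := fun p => (1 / 2 : ℂ) • (ψ p + ψ' p) with hρ
  set δ : ℂ × (Fin d → ℂ) → (Fin d → ℂ) := fun p => (1 / 2 : ℂ) • (ψ p - ψ' p) with hδ
  have aψ := hψ.analyticAt
  have aψ' := hψ'.analyticAt
  have aρ : AnalyticAt ℂ ρ (0, z₀) := analyticAt_const.fun_smul (aψ.fun_add aψ')
  have aδ : AnalyticAt ℂ δ (0, z₀) := analyticAt_const.fun_smul (aψ.fun_sub aψ')
  have ρ0 : ρ (0, z₀) = z₀ := by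
    simp only [hρ, hψ.map_zero, hψ'.map_zero]
    module
  have δ0 : δ (0, z₀) = 0 := by simp only [hδ, hψ.map_zero, hψ'.map_zero, sub_self, smul_zero]
  have tρ : Tendsto ρ (𝓝 (0, z₀)) (𝓝 z₀) := by
    have := aρ.continuousAt; rwa [ContinuousAt, ρ0] at this
  have tδ : Tendsto δ (𝓝 (0, z₀)) (𝓝 0) := by
    have := aδ.continuousAt; rwa [ContinuousAt, δ0] at this
  have tneg : Tendsto (fun p : ℂ × (Fin d → ℂ) => -p.1) (𝓝 (0, z₀)) (𝓝 0) := by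
    have h : Continuous fun p : ℂ × (Fin d → ℂ) => -p.1 := by fun_prop
    simpa using h.tendsto (0, z₀)
  have tq : Tendsto (fun p : ℂ × (Fin d → ℂ) => ((-p.1, ρ p), ((0 : ℂ), δ p))) (𝓝 (0, z₀))
      (𝓝 (((0 : ℂ), z₀), 0)) := by
    have := (tneg.prodMk_nhds tρ).prodMk_nhds ((tendsto_const_nhds (x := (0 : ℂ))).prodMk_nhds tδ)
    exact this
  have tplus : Tendsto (fun p : ℂ × (Fin d → ℂ) => (-p.1, ρ p + δ p)) (𝓝 (0, z₀))
      (𝓝 (0, z₀)) := by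
    have := tneg.prodMk_nhds (tρ.add tδ); rwa [add_zero] at this
  have tminus : Tendsto (fun p : ℂ × (Fin d → ℂ) => (-p.1, ρ p - δ p)) (𝓝 (0, z₀))
      (𝓝 (0, z₀)) := by
    have := tneg.prodMk_nhds (tρ.sub tδ); rwa [sub_zero] at this
  have coordinate : ∀ {F : ℂ × (Fin d → ℂ) → (Fin d → ℂ)} (_ : AnalyticAt ℂ F (0, z₀)) (i : Fin d),
      AnalyticAt ℂ (fun p => F p i) (0, z₀) := fun hF i =>
    ((ContinuousLinearMap.proj (R := ℂ) (φ := fun _ : Fin d => ℂ) i).analyticAt _).fun_comp hF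
  have dδ : ∀ i, IsDivisible z₀ N fun p => δ p i := fun i =>
    ((hdiv i).mul_left (K := fun _ => (1 / 2 : ℂ)) analyticAt_const).congr
      (Eventually.of_forall fun p => rfl)
  have bδ : δ =O[𝓝 (0, z₀)] fun p : ℂ × (Fin d → ℂ) => p.1 ^ N := by
    refine isBigO_pi.2 fun i => ?_
    obtain ⟨C, hC⟩ := (dδ i).eventually_bound
    exact IsBigO.of_bound C (hC.mono fun p hp => by rwa [norm_pow])
  refine isBigO_pi.2 fun i => ?_
  obtain ⟨C₁, hC₁⟩ := exists_norm_second_difference_le (coordinate aρ i)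
  obtain ⟨Q, hQ, hdQ⟩ := dδ i
  obtain ⟨C₂, hC₂⟩ := exists_norm_first_difference_le hQ
  have b1 : (fun p : ℂ × (Fin d → ℂ) => ρ (-p.1, ρ p + δ p) i + ρ (-p.1, ρ p - δ p) i
      - 2 * ρ (-p.1, ρ p) i) =O[𝓝 (0, z₀)] fun p => p.1 ^ (2 * N) := by
    have h3 : (fun p : ℂ × (Fin d → ℂ) => ‖δ p‖ ^ 2) =O[𝓝 (0, z₀)] fun p => p.1 ^ (2 * N) := by
      have := bδ.norm_left.pow 2
      simpa only [← pow_mul, mul_comm N 2] using this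
    refine IsBigO.trans (IsBigO.of_bound C₁ ?_) h3
    filter_upwards [tq.eventually hC₁] with p hp
    simpa using hp
  have b2 : (fun p : ℂ × (Fin d → ℂ) => δ (-p.1, ρ p + δ p) i - δ (-p.1, ρ p - δ p) i)
      =O[𝓝 (0, z₀)] fun p => p.1 ^ (2 * N) := by
    have h3 : (fun p : ℂ × (Fin d → ℂ) => Q (-p.1, ρ p + δ p) - Q (-p.1, ρ p - δ p))
        =O[𝓝 (0, z₀)] fun p => p.1 ^ N := by
      refine IsBigO.trans (IsBigO.of_bound C₂ ?_) bδ
      filter_upwards [tq.eventually hC₂] with p hp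
      simpa using hp
    have h4 : (fun p : ℂ × (Fin d → ℂ) => (-p.1) ^ N) =O[𝓝 (0, z₀)] fun p => p.1 ^ N :=
      IsBigO.of_bound 1 (Eventually.of_forall fun p => by simp)
    refine ((h4.mul h3).congr_right fun p => by rw [two_mul, pow_add]).congr' ?_ EventuallyEq.rfl
    filter_upwards [tplus.eventually hdQ, tminus.eventually hdQ] with p h5 h6
    rw [h5, h6, mul_sub]
  refine ((b2.sub b1).const_mul_left (1 / 2 : ℂ)).congr' ?_ EventuallyEq.rfl
  filter_upwards [h1, h2] with p e1 e2
  have eρ : ρ p + δ p = ψ p := by simp only [hρ, hδ]; module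
  have eρ' : ρ p - δ p = ψ' p := by simp only [hρ, hδ]; module
  have e3 := congrFun e1 i
  have e4 := congrFun e2 i
  rw [eρ, eρ']
  simp only [hρ, hδ, Pi.smul_apply, Pi.add_apply, Pi.sub_apply, smul_eq_mul] at e3 e4 ⊢
  linear_combination (-1 / 2 : ℂ) * e3 - (1 / 2 : ℂ) * e4

/-- An expansion whose first coefficients are known. -/
theorem HasExpansion.isDivisible_sub {G : ℂ × E → ℂ} {b : ℕ → analyticGerms z₀}
    (h : HasExpansion G b) {N : ℕ} {g : ℕ → E → ℂ} (hg : ∀ m, AnalyticAt ℂ (g m) z₀)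
    (hb : ∀ m < N, toGerm (g m) (hg m) = b m) :
    IsDivisible z₀ N fun p => G p - ∑ m ∈ Finset.range N, p.1 ^ m * g m p.2 := by
  obtain ⟨a, ha, hab, h⟩ := h
  refine (h N).congr ?_
  have h1 : ∀ᶠ z in 𝓝 z₀, ∀ m ∈ Finset.range N, g m z = a m z :=
    (Finset.eventually_all _).2 fun m hm =>
      toGerm_eq_iff.1 ((hb m (Finset.mem_range.1 hm)).trans (hab m).symm)
  have h2 : Tendsto (fun p : ℂ × E => p.2) (𝓝 ((0 : ℂ), z₀)) (𝓝 z₀) := continuous_snd.tendsto _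
  filter_upwards [h2.eventually h1] with p hp
  rw [Finset.sum_congr rfl fun m hm => by rw [hp m hm]]

end Compositions

/-! ### Methods for real systems -/

section RealMethods

variable {d : ℕ} {f : (Fin d → ℝ) → (Fin d → ℝ)} {x₀ : Fin d → ℝ}
  {S : ℂ → (Fin d → ℂ) → (Fin d → ℂ)}

theorem IsDivisible.isBigO_realPoint {N : ℕ} {G : ℂ × (Fin d → ℂ) → ℂ}
    (h : IsDivisible (complexify x₀) N G) :
    (fun p : ℝ × (Fin d → ℝ) => G (realPoint p)) =O[𝓝 (0, x₀)] fun p => p.1 ^ N := by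
  obtain ⟨C, hC⟩ := h.eventually_bound
  refine IsBigO.of_bound C (((tendsto_realPoint x₀).eventually hC).mono fun p hp => ?_)
  rw [norm_pow]
  simpa [realPoint] using hp

theorem analyticAt_coordinate (z : Fin d → ℂ) (i : Fin d) :
    AnalyticAt ℂ (fun z : Fin d → ℂ => z i) z :=
  (ContinuousLinearMap.proj (R := ℂ) (φ := fun _ : Fin d => ℂ) i).analyticAt z

theorem IsTimeSymmetricOrderTwo.analyticAt_apply (hS : IsTimeSymmetricOrderTwo f x₀ S)
    (i : Fin d) : AnalyticAt ℂ (fun p : ℂ × (Fin d → ℂ) => S p.1 p.2 i) (0, complexify x₀) :=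
  (analyticAt_coordinate _ i).fun_comp hS.analyticAt

theorem IsTimeSymmetricOrderTwo.realPart_zero (hS : IsTimeSymmetricOrderTwo f x₀ S) :
    ∀ᶠ x in 𝓝 x₀, realPart S 0 x = x := by
  obtain ⟨φ, hφ, hO⟩ := hS.order_two
  obtain ⟨C, hC⟩ := hO.bound
  filter_upwards [eventually_slice hC, hφ.initial] with x h1 h2
  have h3 := h1.self_of_nhds
  simpa [h2, sub_eq_zero] using h3

theorem IsTimeSymmetricOrderTwo.eventually_complexify (hS : IsTimeSymmetricOrderTwo f x₀ S) :
    ∀ᶠ p : ℝ × (Fin d → ℝ) in 𝓝 (0, x₀),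
      S (p.1 : ℂ) (complexify p.2) = complexify (realPart S p.1 p.2) :=
  hS.real.mono fun p hp => funext fun i => Complex.ext rfl (by simpa [complexify] using hp i)

theorem IsTimeSymmetricOrderTwo.isAnalyticStep (hS : IsTimeSymmetricOrderTwo f x₀ S) :
    IsAnalyticStep (complexify x₀) (Function.uncurry S) := by
  refine ⟨hS.analyticAt, ?_⟩
  have h1 : ∀ i, ∀ᶠ z in 𝓝 ((0 : ℂ), complexify x₀), S 0 z.2 i - z.2 i = 0 := by
    intro i
    refine eventually_eq_zero_of_real (H := fun z => S 0 z.2 i - z.2 i) ?_ ?_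
    · refine AnalyticAt.fun_sub ?_ ((analyticAt_coordinate _ i).fun_comp analyticAt_snd)
      exact AnalyticAt.fun_comp (g := fun p : ℂ × (Fin d → ℂ) => S p.1 p.2 i)
        (f := fun z : ℂ × (Fin d → ℂ) => ((0 : ℂ), z.2)) (hS.analyticAt_apply i)
        (analyticAt_const.prod analyticAt_snd)
    · have h2 : ∀ᶠ x in 𝓝 x₀, S 0 (complexify x) = complexify (realPart S 0 x) := by
        filter_upwards [eventually_slice hS.eventually_complexify] with x hx
        simpa using hx.self_of_nhds
      have h3 : Tendsto (fun p : ℝ × (Fin d → ℝ) => p.2) (𝓝 (0, x₀)) (𝓝 x₀) :=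
        continuous_snd.tendsto _
      filter_upwards [h3.eventually h2, h3.eventually hS.realPart_zero] with p h4 h5
      rw [realPoint, h4, h5, sub_self]
  filter_upwards [eventually_slice (eventually_all.2 h1)] with z hz
  exact funext fun i => sub_eq_zero.1 (hz.self_of_nhds i)

theorem IsTimeSymmetricOrderTwo.eventually_star (hS : IsTimeSymmetricOrderTwo f x₀ S) :
    ∀ᶠ p in 𝓝 ((0 : ℂ), complexify x₀),
      Function.uncurry S (star p) = star (Function.uncurry S p) := by
  have h1 : ∀ i, ∀ᶠ z in 𝓝 ((0 : ℂ), complexify x₀),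
      S z.1 z.2 i = star (S (star z).1 (star z).2 i) := fun i =>
    eventually_eq_star_of_real (hS.analyticAt_apply i) (hS.real.mono fun p hp => hp i)
  filter_upwards [eventually_all.2 h1] with z hz
  exact funext fun i => by
    rw [Pi.star_apply]
    change _ = star (S z.1 z.2 i)
    rw [hz i, star_star]
    rfl

/-- The first coefficient of the series of operators is the derivative along the field. -/
theorem IsTimeSymmetricOrderTwo.exists_hasFDerivAt (hS : IsTimeSymmetricOrderTwo f x₀ S)
    {g g' : (Fin d → ℂ) → ℂ} (hg : AnalyticAt ℂ g (complexify x₀))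
    (hg' : AnalyticAt ℂ g' (complexify x₀))
    (h : toGerm g' hg' = stepOp hS.isAnalyticStep 1 (toGerm g hg)) :
    ∀ᶠ x in 𝓝 x₀, ∃ L : (Fin d → ℝ) →L[ℝ] ℂ,
      HasFDerivAt (fun x => g (complexify x)) L x ∧ L (f x) = g' (complexify x) := by
  let J : (Fin d → ℝ) →L[ℝ] (Fin d → ℂ) :=
    ContinuousLinearMap.pi fun i => Complex.ofRealCLM.comp (ContinuousLinearMap.proj i)
  have tc : Tendsto (complexify (d := d)) (𝓝 x₀) (𝓝 (complexify x₀)) :=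
    continuous_complexify.tendsto _
  obtain ⟨a, ha, hab, hdiv⟩ := hasExpansion_stepOp hS.isAnalyticStep hg
  obtain ⟨C, hC⟩ := (hdiv 2).isBigO_realPoint.bound
  have ha1 : ∀ᶠ x in 𝓝 x₀, a 1 (complexify x) = g' (complexify x) :=
    tc.eventually (toGerm_eq_iff.1 ((hab 1).trans h.symm))
  obtain ⟨φ, hφ, hO⟩ := hS.order_two
  obtain ⟨C', hC'⟩ := hO.bound
  filter_upwards [eventually_slice hC, ha1, eventually_slice hC', hφ.initial,
    eventually_slice hφ.hasDerivAt, eventually_slice hS.eventually_complexify, hS.realPart_zero,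
    tc.eventually hg.eventually_analyticAt] with x e1 e2 e3 e4 e5 e6 e7 e8
  have hd := e8.differentiableAt.hasFDerivAt
  refine ⟨((fderiv ℂ g (complexify x)).restrictScalars ℝ).comp J,
    (hd.restrictScalars ℝ).comp x J.hasFDerivAt, ?_⟩
  have d1 : HasDerivAt (fun t => φ t x) (f x) 0 := by
    have := e5.self_of_nhds
    simpa only [e4] using this
  have d2 : HasDerivAt (fun t => realPart S t x - φ t x) 0 0 := by
    refine hasDerivAt_zero_of_isBigO (C := |C'|) ?_
    filter_upwards [e3, Metric.ball_mem_nhds (0 : ℝ) one_pos] with t ht ht1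
    refine ht.trans ?_
    have ht2 : ‖t‖ ≤ 1 := by rw [mem_ball_zero_iff] at ht1; exact ht1.le
    rw [norm_pow]
    calc C' * ‖t‖ ^ (2 + 1) ≤ |C'| * ‖t‖ ^ (2 + 1) := by gcongr; exact le_abs_self _
      _ ≤ |C'| * ‖t‖ ^ 2 := by
        gcongr 1
        exact pow_le_pow_of_le_one (norm_nonneg _) ht2 (by norm_num)
  have d3 : HasDerivAt (fun t => realPart S t x) (f x) 0 := by
    simpa using d2.fun_add d1
  have d4 : HasDerivAt (fun t : ℝ => S t (complexify x)) (J (f x)) 0 :=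
    (J.hasFDerivAt.comp_hasDerivAt (0 : ℝ) d3).congr_of_eventuallyEq e6
  have h0 : S ((0 : ℝ) : ℂ) (complexify x) = complexify x := by
    rw [e6.self_of_nhds, e7]
  have d5 : HasDerivAt (fun t : ℝ => g (S t (complexify x)))
      ((fderiv ℂ g (complexify x)).restrictScalars ℝ (J (f x))) 0 := by
    rw [← h0] at hd
    have := (hd.restrictScalars ℝ).comp_hasDerivAt (0 : ℝ) d4
    rw [h0] at this
    exact this
  have d6 : HasDerivAt (fun t : ℝ => g (S t (complexify x))
      - (a 0 (complexify x) + t * a 1 (complexify x))) 0 0 := by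
    refine hasDerivAt_zero_of_isBigO (C := C) ?_
    filter_upwards [e1] with t ht
    simpa [Finset.sum_range_succ, realPoint, Function.uncurry] using ht
  have d7 : HasDerivAt (fun t : ℝ => a 0 (complexify x) + t * a 1 (complexify x))
      (a 1 (complexify x)) 0 := by
    have h5 : HasDerivAt (fun s : ℝ => (s : ℂ)) 1 0 := Complex.ofRealCLM.hasDerivAt
    simpa using (h5.mul_const (a 1 (complexify x))).const_add (a 0 (complexify x))
  have d8 : HasDerivAt (fun t : ℝ => g (S t (complexify x))) (a 1 (complexify x)) 0 := by
    simpa using d6.fun_add d7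
  rw [← e2, d8.unique d5]
  rfl

end RealMethods

end SymConj

end

noncomputable section

namespace SymConj

section Composition

variable {d s : ℕ} {f : (Fin d → ℝ) → (Fin d → ℝ)} {x₀ : Fin d → ℝ}
  {S : ℂ → (Fin d → ℂ) → (Fin d → ℂ)} {α : Fin s → ℂ}

/-- The projected composition is the mean of the composition and of the one with the steps in the
opposite order. -/
theorem IsTimeSymmetricOrderTwo.complexify_realPart (hS : IsTimeSymmetricOrderTwo f x₀ S)
    (hα : IsSymmetricConjugate α) :
    ∀ᶠ p : ℝ × (Fin d → ℝ) in 𝓝 (0, x₀),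
      complexify (realPart (composition S α) p.1 p.2) = (1 / 2 : ℂ) •
        (stepList (Function.uncurry S) (List.ofFn α) (realPoint p)
          + stepList (Function.uncurry S) (List.ofFn α).reverse (realPoint p)) := by
  have h1 := (tendsto_realPoint x₀).eventually
    (eventually_stepList_star hS.isAnalyticStep hS.eventually_star (List.ofFn α))
  filter_upwards [h1] with p hp
  rw [star_realPoint, hα.map_conj] at hp
  rw [hp]
  funext i
  change (((composition S α (p.1 : ℂ) (complexify p.2) i).re : ℝ) : ℂ) =
    1 / 2 * (composition S α (p.1 : ℂ) (complexify p.2) i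
      + (starRingEnd ℂ) (composition S α (p.1 : ℂ) (complexify p.2) i))
  rw [Complex.add_conj]
  push_cast
  ring

theorem IsTimeSymmetricOrderTwo.hasExpansion_mean (hS : IsTimeSymmetricOrderTwo f x₀ S)
    {g : (Fin d → ℂ) → ℂ} (hg : AnalyticAt ℂ g (complexify x₀)) (l l' : List ℂ) (c c' : ℂ) :
    HasExpansion (fun p => c * g (stepList (Function.uncurry S) l p)
        + c' * g (stepList (Function.uncurry S) l' p))
      fun m => applyOp (toGerm g hg) (operatorHom hS.isAnalyticStep
        (PowerSeries.coeff m (c • stageProd l + c' • stageProd l'))) := by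
  refine (((hasExpansion_stageProd hS.isAnalyticStep hS.symmetric hg l).smul c).add
    ((hasExpansion_stageProd hS.isAnalyticStep hS.symmetric hg l').smul c')).of_eq fun m => ?_
  simp only [map_add, PowerSeries.coeff_smul, map_smul, Pi.add_apply, Pi.smul_apply]

theorem IsTimeSymmetricOrderTwo.hasOrder_composition (hS : IsTimeSymmetricOrderTwo f x₀ S)
    (hα : IsSymmetricConjugate α) {r : ℕ}
    (h : VanishesTo (r + 1) (stageProd (List.ofFn α) + stageProd (List.ofFn α).reverse
      - (formalExp linearSeries + formalExp linearSeries))) :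
    HasOrder f x₀ (realPart (composition S α)) r := by
  obtain ⟨φ, hφ, hO⟩ := hS.order_two
  refine ⟨φ, hφ, isBigO_pi.2 fun i => ?_⟩
  let γ := toGerm _ (analyticAt_coordinate (complexify x₀) i)
  let T := operatorHom hS.isAnalyticStep (FreeAlgebra.ι ℂ 0)
  choose g hg hgT using fun m : ℕ => exists_toGerm (applyOp γ (T ^ m))
  have hg0 : ∀ᶠ z in 𝓝 (complexify x₀), g 0 z = z i :=
    toGerm_eq_iff.1 ((hgT 0).trans (by rw [pow_zero, applyOp_one]))
  have hgs : ∀ m, toGerm (g (m + 1)) (hg (m + 1))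
      = stepOp hS.isAnalyticStep 1 (toGerm (g m) (hg m)) := fun m => by
    rw [hgT, hgT, pow_succ', applyOp_mul]
    simp only [T]
    rw [operatorHom_ι_zero, applyOp_coeff_stepSeries]
  have tc : Tendsto (complexify (d := d)) (𝓝 x₀) (𝓝 (complexify x₀)) :=
    continuous_complexify.tendsto _
  have taylor := hφ.taylor (g := fun m x => g m (complexify x))
    (fun m => (hg m).continuousAt.comp continuous_complexify.continuousAt)
    (fun m => hS.exists_hasFDerivAt (hg m) (hg (m + 1)) (hgs m)) (r + 1) 0
  have hexp := hS.hasExpansion_mean (analyticAt_coordinate (complexify x₀) i) (List.ofFn α)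
    (List.ofFn α).reverse (1 / 2) (1 / 2)
  have hgm : ∀ m, AnalyticAt ℂ (fun z => ((m.factorial : ℂ)⁻¹) * g m z) (complexify x₀) :=
    fun m => analyticAt_const.fun_mul (hg m)
  have hdiv := (hexp.isDivisible_sub (N := r + 1) hgm fun m hm => by
    rw [← toGerm_smul _ (hg m), hgT, ← map_smul]
    congr 1
    have h1 := h m hm
    rw [map_sub, sub_eq_zero, map_add, map_add, coeff_formalExp_linearSeries] at h1
    rw [← smul_add, PowerSeries.coeff_smul, map_add, h1, ← two_smul ℂ, smul_smul,
      show (1 / 2 : ℂ) * 2 = 1 by norm_num, one_smul, map_smul, map_pow]).isBigO_realPoint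
  have hmain := hdiv.sub taylor
  rw [← isBigO_norm_left] at hmain ⊢
  refine hmain.congr' ?_ EventuallyEq.rfl
  filter_upwards [hS.complexify_realPart hα, (tc.comp hφ.tendsto).eventually hg0] with p h1 h2
  have h3 := congrFun h1 i
  rw [Pi.sub_apply, ← Complex.norm_real, Complex.ofReal_sub]
  congr 1
  change ((realPart (composition S α) p.1 p.2 i : ℝ) : ℂ) = _ at h3
  rw [h3]
  have h4 : g 0 (complexify (φ p.1 p.2)) = ((φ p.1 p.2 i : ℝ) : ℂ) := h2
  simp only [h4, zero_add, Pi.smul_apply, Pi.add_apply, smul_eq_mul, realPoint]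
  have h5 : ∀ m ∈ Finset.range (r + 1), (p.1 : ℂ) ^ m * ((m.factorial : ℂ)⁻¹ * g m (complexify p.2))
      = (p.1 : ℂ) ^ m / (m.factorial : ℂ) * g m (complexify p.2) := fun m _ => by
    rw [div_eq_mul_inv, mul_assoc]
  rw [Finset.sum_congr rfl h5]
  ring

theorem IsTimeSymmetricOrderTwo.analyticAt_realPart (hS : IsTimeSymmetricOrderTwo f x₀ S)
    (α : Fin s → ℂ) :
    AnalyticAt ℝ (fun p : ℝ × (Fin d → ℝ) => realPart (composition S α) p.1 p.2) (0, x₀) := by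
  let J : (Fin d → ℝ) →L[ℝ] (Fin d → ℂ) :=
    ContinuousLinearMap.pi fun i => Complex.ofRealCLM.comp (ContinuousLinearMap.proj i)
  let K : (Fin d → ℂ) →L[ℝ] (Fin d → ℝ) :=
    ContinuousLinearMap.pi fun i => Complex.reCLM.comp (ContinuousLinearMap.proj i)
  let L : (ℝ × (Fin d → ℝ)) →L[ℝ] (ℂ × (Fin d → ℂ)) := Complex.ofRealCLM.prodMap J
  have h0 : L (0, x₀) = (0, complexify x₀) := Prod.ext Complex.ofReal_zero rfl
  have h1 : AnalyticAt ℝ (stepList (Function.uncurry S) (List.ofFn α)) (L (0, x₀)) := by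
    rw [h0]; exact (hS.isAnalyticStep.stepList _).analyticAt.restrictScalars
  exact (K.analyticAt _).fun_comp (h1.fun_comp (L.analyticAt _))

theorem IsTimeSymmetricOrderTwo.realPart_composition_zero (hS : IsTimeSymmetricOrderTwo f x₀ S)
    (α : Fin s → ℂ) : ∀ᶠ x in 𝓝 x₀, realPart (composition S α) 0 x = x := by
  have tc : Tendsto (complexify (d := d)) (𝓝 x₀) (𝓝 (complexify x₀)) :=
    continuous_complexify.tendsto _
  filter_upwards [tc.eventually (hS.isAnalyticStep.stepList (List.ofFn α)).initial] with x hx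
  have h1 : composition S α ((0 : ℝ) : ℂ) (complexify x) = complexify x := by
    rw [Complex.ofReal_zero]; exact hx
  funext i
  rw [realPart, h1]
  rfl

theorem IsTimeSymmetricOrderTwo.tendsto_neg_realPart (hS : IsTimeSymmetricOrderTwo f x₀ S)
    (α : Fin s → ℂ) :
    Tendsto (fun p : ℝ × (Fin d → ℝ) => (-p.1, realPart (composition S α) p.1 p.2))
      (𝓝 (0, x₀)) (𝓝 (0, x₀)) := by
  have h1 := (hS.analyticAt_realPart α).continuousAt
  rw [ContinuousAt, (hS.realPart_composition_zero α).self_of_nhds] at h1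
  have h2 : Tendsto (fun p : ℝ × (Fin d → ℝ) => -p.1) (𝓝 (0, x₀)) (𝓝 0) := by
    have h : Continuous fun p : ℝ × (Fin d → ℝ) => -p.1 := by fun_prop
    simpa using h.tendsto (0, x₀)
  exact h2.prodMk_nhds h1

theorem IsTimeSymmetricOrderTwo.isPseudoSymmetric_composition
    (hS : IsTimeSymmetricOrderTwo f x₀ S) (hα : IsSymmetricConjugate α) {N M : ℕ}
    (hM : M + 1 = 2 * N)
    (h : VanishesTo N (stageProd (List.ofFn α) - stageProd (List.ofFn α).reverse)) :
    IsPseudoSymmetric x₀ (realPart (composition S α)) M := by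
  set l := List.ofFn α with hl
  set ψ := stepList (Function.uncurry S) l with hψ
  set ψ' := stepList (Function.uncurry S) l.reverse with hψ'
  have sψ : IsAnalyticStep (complexify x₀) ψ := hS.isAnalyticStep.stepList l
  have sψ' : IsAnalyticStep (complexify x₀) ψ' := hS.isAnalyticStep.stepList l.reverse
  have hinv := eventually_stepList_reverse hS.isAnalyticStep hS.symmetric l
  have hinv' := eventually_stepList_reverse hS.isAnalyticStep hS.symmetric l.reverse
  rw [List.reverse_reverse] at hinv'
  have hdiv : ∀ i, IsDivisible (complexify x₀) N fun p => ψ p i - ψ' p i := by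
    intro i
    have hexp := hS.hasExpansion_mean (analyticAt_coordinate (complexify x₀) i) l l.reverse 1 (-1)
    refine (hexp.isDivisible fun m hm => ?_).congr (Eventually.of_forall fun p => ?_)
    · rw [one_smul, neg_one_smul, ← sub_eq_add_neg, h m hm, map_zero, map_zero]
    · simp only [hψ, hψ']; ring
  have hmean := isBigO_mean_comp_mean sψ sψ' hinv hinv' hdiv
  refine isPseudoSymmetric_of_isBigO (hS.analyticAt_realPart α).hasStrictFDerivAt
    (hS.realPart_composition_zero α) ?_
  rw [hM]
  have hreal := hS.complexify_realPart hα
  have hcomp := hmean.comp_tendsto (tendsto_realPoint x₀)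
  refine isBigO_pi.2 fun i => ?_
  have hcomp_i := isBigO_pi.1 hcomp i
  rw [← isBigO_norm_left, ← isBigO_norm_right] at hcomp_i ⊢
  refine hcomp_i.congr' ?_ ?_
  · filter_upwards [hreal, (hS.tendsto_neg_realPart α).eventually hreal] with p h1 h2
    have h3 := congrFun h2 i
    change ((realPart (composition S α) (-p.1) (realPart (composition S α) p.1 p.2) i : ℝ) : ℂ) = _
      at h3
    rw [Pi.sub_apply, ← Complex.norm_real, Complex.ofReal_sub, h3]
    simp only [realPoint] at h1 ⊢
    rw [h1]
    simp only [Function.comp_apply, realPoint, Complex.ofReal_neg]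
    rfl
  · exact Eventually.of_forall fun p => by simp [realPoint]

end Composition

end SymConj

end

noncomputable section

namespace SymConj

/-! ### Symmetry of the mean of a composition and its reversal, formally -/

theorem scale_add {A : Type*} [Ring A] [Algebra ℂ A] (a : ℂ) (X Y : PowerSeries A) :
    scale a (X + Y) = scale a X + scale a Y := by
  ext1 m
  simp only [coeff_scale, map_add, smul_add]

theorem scale_sub {A : Type*} [Ring A] [Algebra ℂ A] (a : ℂ) (X Y : PowerSeries A) :
    scale a (X - Y) = scale a X - scale a Y := by
  ext1 m
  simp only [coeff_scale, map_sub, smul_sub]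

theorem vanishesTo_of_mul_scale {X : PowerSeries (FreeAlgebra ℂ ℕ)} {N : ℕ}
    (h : VanishesTo (2 * N) (X * scale (-1) X)) : VanishesTo N X := by
  intro m
  induction m using Nat.strong_induction_on with
  | _ m ih =>
    intro hm
    have h1 := h (2 * m) (by omega)
    rw [PowerSeries.coeff_mul, Finset.sum_eq_single (m, m)] at h1
    · rw [coeff_scale, mul_smul_comm] at h1
      have h2 := (smul_eq_zero.1 h1).resolve_left (pow_ne_zero _ (by norm_num))
      exact mul_self_eq_zero.1 h2
    · intro x hx hne
      rw [Finset.HasAntidiagonal.mem_antidiagonal] at hx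
      rcases lt_trichotomy x.1 m with h2 | h2 | h2
      · rw [ih x.1 h2 (by omega), zero_mul]
      · exact absurd (Prod.ext h2 (by omega)) hne
      · rw [coeff_scale, ih x.2 (by omega) (by omega), smul_zero, mul_zero]
    · intro hx
      exact absurd (Finset.HasAntidiagonal.mem_antidiagonal.2 (by omega)) hx

theorem stageProd_mul_scale_reverse (l : List ℂ) :
    stageProd l * scale (-1) (stageProd l.reverse) = 1 := by
  have h := congrArg (scale (-1)) (scale_stageProd_reverse_mul l.reverse)
  have h1 : ∀ X : PowerSeries (FreeAlgebra ℂ ℕ), scale (-1) (scale (-1) X) = X := fun X => by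
    ext1 m
    rw [coeff_scale, coeff_scale, smul_smul, ← mul_pow]
    simp
  rwa [List.reverse_reverse, scale_mul, h1, scale_one] at h

theorem mean_mul_scale_sub_difference_mul_scale (l : List ℂ) :
    (stageProd l + stageProd l.reverse) * scale (-1) (stageProd l + stageProd l.reverse)
      - (stageProd l - stageProd l.reverse) * scale (-1) (stageProd l - stageProd l.reverse)
      = 4 := by
  have h1 := stageProd_mul_scale_reverse l
  have h2 := stageProd_mul_scale_reverse l.reverse
  rw [List.reverse_reverse] at h2
  rw [scale_add, scale_sub]
  calc _ = 2 * (stageProd l * scale (-1) (stageProd l.reverse))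
        + 2 * (stageProd l.reverse * scale (-1) (stageProd l)) := by noncomm_ring
    _ = 4 := by rw [h1, h2]; norm_num

/-! ### Matrix representations of the free algebra -/

/-- The representation of the free algebra by given real matrices. -/
def matrixRep {d : ℕ} (M : ℕ → Matrix (Fin d) (Fin d) ℝ) :
    FreeAlgebra ℂ ℕ →ₐ[ℂ] Matrix (Fin d) (Fin d) ℂ :=
  FreeAlgebra.lift ℂ fun k => (M k).map Complex.ofReal

/-- The action of the letters on the suffixes of the word `v`. -/
def wordMatrix (v : List ℕ) (k : ℕ) : Matrix (Fin (v.length + 1)) (Fin (v.length + 1)) ℝ :=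
  Matrix.of fun i j => if v.drop i = k :: v.drop j then 1 else 0

theorem drop_injective (v : List ℕ) :
    Function.Injective fun i : Fin (v.length + 1) => v.drop i := by
  intro i j h
  have := congrArg List.length h
  simp only [List.length_drop] at this
  ext
  omega

theorem matrixRep_wordMatrix (v : List ℕ) (u : FreeMonoid ℕ) (i j : Fin (v.length + 1)) :
    matrixRep (wordMatrix v) (FreeMonoid.lift (FreeAlgebra.ι ℂ) u) i j
      = if v.drop i = u.toList ++ v.drop j then 1 else 0 := by
  induction u using FreeMonoid.inductionOn' generalizing i with
  | one =>
    rw [map_one, map_one, Matrix.one_apply, FreeMonoid.toList_one, List.nil_append]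
    exact if_congr (drop_injective v).eq_iff.symm rfl rfl
  | of_mul k u ih =>
    rw [map_mul, map_mul, Matrix.mul_apply, FreeMonoid.lift_eval_of, matrixRep,
      FreeAlgebra.lift_ι_apply, ← matrixRep]
    simp only [ih, Matrix.map_apply, wordMatrix, Matrix.of_apply]
    have hk : (FreeMonoid.of k * u).toList ++ v.drop j = k :: (u.toList ++ v.drop j) := rfl
    by_cases h : v.drop i = (FreeMonoid.of k * u).toList ++ v.drop j
    · rw [if_pos h]
      rw [hk] at h
      have hi : (i : ℕ) < v.length := by
        by_contra hi
        rw [List.drop_eq_nil_of_le (not_lt.1 hi)] at h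
        exact absurd h (by simp)
      have h1 : v.drop (i + 1) = u.toList ++ v.drop j := by
        rw [← List.tail_drop, h, List.tail_cons]
      rw [Finset.sum_eq_single (⟨i + 1, by omega⟩ : Fin (v.length + 1))]
      · simp [h, h1]
      · intro a _ ha
        rw [h]
        have h2 : v.drop a ≠ u.toList ++ v.drop j := fun h2 =>
          ha (drop_injective v (h2.trans h1.symm))
        simp [h2]
      · intro h2; exact absurd (Finset.mem_univ _) h2
    · rw [if_neg h]
      rw [hk] at h
      refine Finset.sum_eq_zero fun a _ => ?_
      by_cases h2 : v.drop a = u.toList ++ v.drop j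
      · rw [h2, if_neg h, Complex.ofReal_zero, zero_mul]
      · rw [if_neg h2, mul_zero]

/-- The matrices of words separate the elements of the free algebra. -/
theorem eq_zero_of_matrixRep_wordMatrix {p : FreeAlgebra ℂ ℕ}
    (h : ∀ v, matrixRep (wordMatrix v) p = 0) : p = 0 := by
  let b := FreeAlgebra.basisFreeMonoid ℂ ℕ
  refine b.repr.map_eq_zero_iff.1 (Finsupp.ext fun v => ?_)
  let L : FreeAlgebra ℂ ℕ →ₗ[ℂ] ℂ :=
    (Matrix.entryLinearMap ℂ ℂ 0 (Fin.last _)).comp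
      (matrixRep (wordMatrix v.toList)).toLinearMap
  have hL : L = b.coord v := by
    refine b.ext fun u => ?_
    have hb : b u = FreeMonoid.lift (FreeAlgebra.ι ℂ) u := by
      change MonoidAlgebra.lift ℂ (FreeAlgebra ℂ ℕ) (FreeMonoid ℕ)
        (FreeMonoid.lift (FreeAlgebra.ι ℂ)) (MonoidAlgebra.single u 1) = _
      rw [MonoidAlgebra.lift_single, one_smul]
    rw [Module.Basis.coord_apply, Module.Basis.repr_self]
    change matrixRep (wordMatrix v.toList) (b u) 0 (Fin.last _) = _
    rw [hb, matrixRep_wordMatrix]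
    classical
    rw [Fin.val_zero, Fin.val_last, List.drop_zero, List.drop_length, List.append_nil,
      Finsupp.single_apply]
    exact if_congr (by rw [FreeMonoid.toList.injective.eq_iff, eq_comm]) rfl rfl
  have h1 := LinearMap.congr_fun hL p
  change matrixRep (wordMatrix v.toList) p 0 (Fin.last _) = b.repr p v at h1
  rw [← h1, h]
  rfl

theorem vanishesTo_of_matrixRep_wordMatrix {X : PowerSeries (FreeAlgebra ℂ ℕ)} {N : ℕ}
    (h : ∀ v, ∀ m < N, matrixRep (wordMatrix v) (PowerSeries.coeff m X) = 0) : VanishesTo N X :=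
  fun m hm => eq_zero_of_matrixRep_wordMatrix fun v => h v m hm

/-- The degree of a word. -/
def wordDegree (v : List ℕ) : ℕ := (v.map fun k => 2 * k + 1).sum

theorem wordMatrix_ne_zero {v : List ℕ} {k : ℕ} {i j : Fin (v.length + 1)}
    (h : wordMatrix v k i j ≠ 0) :
    wordDegree (v.drop i) = wordDegree (v.drop j) + (2 * k + 1) := by
  rw [wordMatrix, Matrix.of_apply] at h
  by_cases h1 : v.drop i = k :: v.drop j
  · rw [h1, wordDegree, wordDegree, List.map_cons, List.sum_cons, add_comm]
  · exact absurd (if_neg h1) h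

end SymConj

end

noncomputable section

namespace SymConj

/-! ### Graded matrices -/

section Graded

variable {d : ℕ} {deg : Fin d → ℕ}

/-- `Y` raises the degree by `m`. -/
def IsGraded (deg : Fin d → ℕ) (m : ℕ) (Y : Matrix (Fin d) (Fin d) ℂ) : Prop :=
  ∀ i j, Y i j ≠ 0 → deg i = deg j + m

theorem isGraded_zero (m : ℕ) : IsGraded deg m 0 := fun _ _ h => absurd rfl h

theorem isGraded_one : IsGraded deg 0 1 := fun i j h => by
  have : i = j := by
    by_contra hij
    exact h (Matrix.one_apply_ne hij)
  rw [this, add_zero]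

theorem IsGraded.smul {m : ℕ} {Y : Matrix (Fin d) (Fin d) ℂ} (c : ℂ) (h : IsGraded deg m Y) :
    IsGraded deg m (c • Y) := fun i j hij =>
  h i j fun h0 => hij (by rw [Matrix.smul_apply, h0, smul_zero])

theorem isGraded_sum {ι : Type*} {s : Finset ι} {m : ℕ} {Y : ι → Matrix (Fin d) (Fin d) ℂ}
    (h : ∀ a ∈ s, IsGraded deg m (Y a)) : IsGraded deg m (∑ a ∈ s, Y a) := fun i j hij => by
  rw [Matrix.sum_apply] at hij
  obtain ⟨a, ha, ha0⟩ := Finset.exists_ne_zero_of_sum_ne_zero hij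
  exact h a ha i j ha0

theorem IsGraded.mul {m n : ℕ} {Y Z : Matrix (Fin d) (Fin d) ℂ} (hY : IsGraded deg m Y)
    (hZ : IsGraded deg n Z) : IsGraded deg (m + n) (Y * Z) := fun i j hij => by
  rw [Matrix.mul_apply] at hij
  obtain ⟨a, _, ha0⟩ := Finset.exists_ne_zero_of_sum_ne_zero hij
  have h1 := hY i a (left_ne_zero_of_mul ha0)
  have h2 := hZ a j (right_ne_zero_of_mul ha0)
  omega

theorem IsGraded.eq_zero {D m : ℕ} {Y : Matrix (Fin d) (Fin d) ℂ} (h : IsGraded deg m Y)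
    (hD : ∀ i, deg i ≤ D) (hm : D < m) : Y = 0 := by
  ext i j
  by_contra hij
  have h1 := h i j hij
  have h2 := hD i
  omega

theorem isGraded_coeff_formalExp {V : PowerSeries (Matrix (Fin d) (Fin d) ℂ)}
    (hV : ∀ m, IsGraded deg m (PowerSeries.coeff m V)) (m : ℕ) :
    IsGraded deg m (PowerSeries.coeff m (formalExp V)) := by
  have hpow : ∀ k m, IsGraded deg m (PowerSeries.coeff m (V ^ k)) := by
    intro k
    induction k with
    | zero =>
      intro m
      rw [pow_zero, PowerSeries.coeff_one]
      split_ifs with h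
      · rw [h]; exact isGraded_one
      · exact isGraded_zero m
    | succ k ih =>
      intro m
      rw [pow_succ, PowerSeries.coeff_mul]
      refine isGraded_sum fun x hx => ?_
      rw [← Finset.HasAntidiagonal.mem_antidiagonal.1 hx]
      exact (ih x.1).mul (hV x.2)
  rw [formalExp, psum, PowerSeries.coeff_mk]
  refine isGraded_sum fun k _ => ?_
  rw [PowerSeries.coeff_smul]
  exact (hpow k m).smul _

end Graded

/-! ### Linear methods -/

section LinearStep

variable {d : ℕ}

/-- The linear method `z ↦ ∑_{m<N} h^m C_mᵀ z`. -/
def linearStep (C : ℕ → Matrix (Fin d) (Fin d) ℂ) (N : ℕ) (p : ℂ × (Fin d → ℂ)) : Fin d → ℂ :=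
  ∑ m ∈ Finset.range N, p.1 ^ m • ((C m).transpose.mulVec p.2)

theorem linearStep_apply (C : ℕ → Matrix (Fin d) (Fin d) ℂ) (N : ℕ) (p : ℂ × (Fin d → ℂ))
    (i : Fin d) :
    linearStep C N p i = ∑ m ∈ Finset.range N, p.1 ^ m * ∑ j, C m j i * p.2 j := by
  simp [linearStep, Finset.sum_apply, Matrix.mulVec, dotProduct]

theorem analyticAt_linearStep (C : ℕ → Matrix (Fin d) (Fin d) ℂ) (N : ℕ)
    (p : ℂ × (Fin d → ℂ)) : AnalyticAt ℂ (linearStep C N) p := by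
  refine AnalyticAt.pi fun i => ?_
  simp only [linearStep_apply]
  refine Finset.analyticAt_fun_sum _ fun m _ => (analyticAt_fst.pow m).fun_mul
    (Finset.analyticAt_fun_sum _ fun j _ => analyticAt_const.fun_mul ?_)
  exact (analyticAt_coordinate _ j).fun_comp analyticAt_snd

theorem linearStep_zero {C : ℕ → Matrix (Fin d) (Fin d) ℂ} (hC : C 0 = 1) (N : ℕ)
    (z : Fin d → ℂ) : linearStep C (N + 1) (0, z) = z := by
  rw [linearStep, Finset.sum_range_succ']
  simp [hC]

theorem dotProduct_linearStep (C : ℕ → Matrix (Fin d) (Fin d) ℂ) (N : ℕ)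
    (p : ℂ × (Fin d → ℂ)) (w : Fin d → ℂ) :
    dotProduct w (linearStep C N p)
      = ∑ m ∈ Finset.range N, p.1 ^ m * dotProduct ((C m).mulVec w) p.2 := by
  rw [linearStep, dotProduct_sum]
  refine Finset.sum_congr rfl fun m _ => ?_
  rw [dotProduct_smul, Matrix.dotProduct_mulVec, Matrix.vecMul_transpose, smul_eq_mul]

theorem analyticAt_dotProduct (w z : Fin d → ℂ) :
    AnalyticAt ℂ (fun z : Fin d → ℂ => dotProduct w z) z :=
  Finset.analyticAt_fun_sum _ fun i _ => analyticAt_const.fun_mul (analyticAt_coordinate z i)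

/-- The germ of a linear form. -/
def linearGerm (z₀ w : Fin d → ℂ) : analyticGerms z₀ := toGerm _ (analyticAt_dotProduct w z₀)

theorem hasExpansion_linearStep {C : ℕ → Matrix (Fin d) (Fin d) ℂ} {N : ℕ}
    (hC : ∀ m, N ≤ m → C m = 0) (z₀ w : Fin d → ℂ) :
    HasExpansion (fun p => dotProduct w (linearStep C N p))
      fun m => linearGerm z₀ ((C m).mulVec w) := by
  refine ⟨fun m z => dotProduct ((C m).mulVec w) z, fun m => analyticAt_dotProduct _ _,
    fun m => rfl, fun N' => ?_⟩
  have h1 : IsDivisible z₀ N' fun p => ∑ m ∈ Finset.range N,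
      p.1 ^ (N' + m) * dotProduct ((C (N' + m)).mulVec w) p.2 :=
    IsDivisible.sum fun m _ => isDivisible_pow_mul (Nat.le_add_right N' m)
      (analyticAt_snd_comp (analyticAt_dotProduct _ _) 0)
  refine h1.congr (Eventually.of_forall fun p => ?_)
  simp only [dotProduct_linearStep]
  rw [sub_eq_iff_eq_add', ← Finset.sum_range_add
    (fun m => p.1 ^ m * dotProduct ((C m).mulVec w) p.2), add_comm N' N, Finset.sum_range_add,
    left_eq_add]
  refine Finset.sum_eq_zero fun m _ => ?_
  rw [hC _ (Nat.le_add_right N m), Matrix.zero_mulVec, zero_dotProduct, mul_zero]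

end LinearStep

/-! ### A symmetric method for a nilpotent linear system -/

section Nilpotent

variable {d : ℕ} (M : ℕ → Matrix (Fin d) (Fin d) ℝ) (D : ℕ)

/-- The coefficients of the matrix exponential of `∑ h^{2k+1} M_k`. -/
def expCoeff (m : ℕ) : Matrix (Fin d) (Fin d) ℂ :=
  matrixRep M (PowerSeries.coeff m (formalExp (stageExponent 1)))

/-- The coefficients of the matrix exponential of `h M_0`. -/
def flowCoeff (m : ℕ) : Matrix (Fin d) (Fin d) ℂ :=
  matrixRep M (PowerSeries.coeff m (formalExp linearSeries))

/-- The linear vector field `x ↦ M_0ᵀ x`. -/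
def linearField (x : Fin d → ℝ) : Fin d → ℝ := (M 0).transpose.mulVec x

/-- The method `z ↦ exp(∑ h^{2k+1} M_k)ᵀ z`, where products of degree above `D` vanish. -/
def expStep (h : ℂ) (z : Fin d → ℂ) : Fin d → ℂ := linearStep (expCoeff M) (D + 1) (h, z)

/-- The complexified flow of the linear field. -/
def flowStep (h : ℂ) (z : Fin d → ℂ) : Fin d → ℂ := linearStep (flowCoeff M) (D + 1) (h, z)

theorem matrixRep_ι (k : ℕ) : matrixRep M (FreeAlgebra.ι ℂ k) = (M k).map Complex.ofReal :=
  FreeAlgebra.lift_ι_apply _ _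

theorem flowCoeff_eq (m : ℕ) :
    flowCoeff M m = ((m.factorial : ℂ)⁻¹) • ((M 0).map Complex.ofReal) ^ m := by
  rw [flowCoeff, coeff_formalExp_linearSeries, map_smul, map_pow, matrixRep_ι]

theorem flowCoeff_succ (m : ℕ) :
    ((m : ℂ) + 1) • flowCoeff M (m + 1) = flowCoeff M m * (M 0).map Complex.ofReal := by
  have h : ((m : ℂ) + 1) ≠ 0 := by exact_mod_cast m.succ_ne_zero
  rw [flowCoeff_eq, flowCoeff_eq, smul_smul, Nat.factorial_succ, smul_mul_assoc, ← pow_succ]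
  congr 1
  push_cast
  field_simp

theorem flowCoeff_zero : flowCoeff M 0 = 1 := by
  rw [flowCoeff, constantCoeff_formalExp, map_one]

theorem expCoeff_eq_flowCoeff {m : ℕ} (hm : m < 3) : expCoeff M m = flowCoeff M m := by
  have h : VanishesTo 3 (stageExponent 1 - linearSeries) := by
    intro m hm
    rw [map_sub, stageExponent, linearSeries, PowerSeries.coeff_mk, PowerSeries.coeff_mk]
    interval_cases m <;> simp
  have h1 := vanishesTo_formalExp_sub h m hm
  rw [map_sub, sub_eq_zero] at h1
  rw [expCoeff, flowCoeff, h1]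

theorem star_expCoeff (m : ℕ) (i j : Fin d) :
    (starRingEnd ℂ) (expCoeff M m i j) = expCoeff M m i j := by
  let R : FreeAlgebra ℂ ℕ →+* Matrix (Fin d) (Fin d) ℂ := matrixRep M
  let Φ : FreeAlgebra ℂ ℕ →+* Matrix (Fin d) (Fin d) ℂ := (starRingEnd ℂ).mapMatrix.comp R
  have h : PowerSeries.map Φ (stageExponent 1) = PowerSeries.map R (stageExponent 1) := by
    ext1 m
    rw [PowerSeries.coeff_map, PowerSeries.coeff_map, stageExponent, PowerSeries.coeff_mk]
    split_ifs
    · rw [one_pow, one_smul]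
      change (starRingEnd ℂ).mapMatrix (matrixRep M _) = matrixRep M _
      rw [matrixRep_ι]
      ext i j
      simp
    · rw [map_zero, map_zero]
  have h1 := congrArg (fun P : PowerSeries (Matrix (Fin d) (Fin d) ℂ) =>
    PowerSeries.coeff m P i j) ((map_formalExp Φ (stageExponent 1)).trans
    ((congrArg formalExp h).trans (map_formalExp R (stageExponent 1)).symm))
  simpa [PowerSeries.coeff_map, Φ, R, expCoeff] using h1

/-- The matrices `M k` raise a degree with values in `0, …, D` by `2k+1`. -/
structure IsGradedFamily (M : ℕ → Matrix (Fin d) (Fin d) ℝ) (deg : Fin d → ℕ) (D : ℕ) : Prop where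
  eq_add : ∀ k i j, M k i j ≠ 0 → deg i = deg j + (2 * k + 1)
  le : ∀ i, deg i ≤ D

variable {M D} {deg : Fin d → ℕ}

theorem IsGradedFamily.isGraded_ι (hM : IsGradedFamily M deg D) (k : ℕ) :
    IsGraded deg (2 * k + 1) (matrixRep M (FreeAlgebra.ι ℂ k)) := fun i j hij => by
  rw [matrixRep_ι, Matrix.map_apply] at hij
  exact hM.eq_add k i j fun h0 => hij (by rw [h0, Complex.ofReal_zero])

theorem isGraded_coeff_map_formalExp {V : PowerSeries (FreeAlgebra ℂ ℕ)}
    (hV : ∀ m, IsGraded deg m (matrixRep M (PowerSeries.coeff m V))) (m : ℕ) :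
    IsGraded deg m (matrixRep M (PowerSeries.coeff m (formalExp V))) := by
  let R : FreeAlgebra ℂ ℕ →+* Matrix (Fin d) (Fin d) ℂ := matrixRep M
  have h1 := congrArg (PowerSeries.coeff m) (map_formalExp R V)
  rw [PowerSeries.coeff_map] at h1
  change matrixRep M _ = _ at h1
  rw [h1]
  exact isGraded_coeff_formalExp (fun m => by rw [PowerSeries.coeff_map]; exact hV m) m

theorem IsGradedFamily.isGraded_expCoeff (hM : IsGradedFamily M deg D) (m : ℕ) :
    IsGraded deg m (expCoeff M m) := by
  refine isGraded_coeff_map_formalExp (fun m => ?_) m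
  rw [stageExponent, PowerSeries.coeff_mk]
  split_ifs with h
  · rw [one_pow, one_smul]
    have h2 : 2 * (m / 2) + 1 = m := by obtain ⟨k, rfl⟩ := h; omega
    have h3 := hM.isGraded_ι (m / 2)
    rwa [h2] at h3
  · rw [map_zero]; exact isGraded_zero m

theorem IsGradedFamily.isGraded_flowCoeff (hM : IsGradedFamily M deg D) (m : ℕ) :
    IsGraded deg m (flowCoeff M m) := by
  refine isGraded_coeff_map_formalExp (fun m => ?_) m
  rw [linearSeries, PowerSeries.coeff_mk]
  split_ifs with h
  · rw [h]; exact hM.isGraded_ι 0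
  · rw [map_zero]; exact isGraded_zero m

theorem IsGradedFamily.expStep_symmetric (hM : IsGradedFamily M deg D) (h : ℂ)
    (z : Fin d → ℂ) : expStep M D h (expStep M D (-h) z) = z := by
  let g : ℕ × ℕ → (Fin d → ℂ) := fun x =>
    ((-h) ^ x.1 * h ^ x.2) • ((expCoeff M x.1 * expCoeff M x.2).transpose.mulVec z)
  have hg : ∀ x : ℕ × ℕ, D + 1 ≤ x.1 + x.2 → g x = 0 := fun x hx => by
    have h1 : expCoeff M x.1 * expCoeff M x.2 = 0 :=
      ((hM.isGraded_expCoeff x.1).mul (hM.isGraded_expCoeff x.2)).eq_zero hM.le hx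
    simp only [g, h1, Matrix.transpose_zero, Matrix.zero_mulVec, smul_zero]
  have h1 : expStep M D h (expStep M D (-h) z)
      = ∑ i ∈ Finset.range (D + 1), ∑ k ∈ Finset.range (D + 1), g (i, k) := by
    rw [Finset.sum_comm]
    simp only [expStep, linearStep]
    refine Finset.sum_congr rfl fun k _ => ?_
    rw [Matrix.mulVec_sum, Finset.smul_sum]
    refine Finset.sum_congr rfl fun i _ => ?_
    rw [Matrix.mulVec_smul, Matrix.mulVec_mulVec, ← Matrix.transpose_mul, smul_smul, mul_comm]
  have hinv := scale_stageProd_reverse_mul [1]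
  simp only [List.reverse_singleton, stageProd, List.map_cons, List.map_nil, List.prod_cons,
    List.prod_nil, mul_one] at hinv
  have h2 : ∀ n, ∑ x ∈ Finset.HasAntidiagonal.antidiagonal n, g x
      = h ^ n • ((matrixRep M (PowerSeries.coeff n
        (1 : PowerSeries (FreeAlgebra ℂ ℕ)))).transpose.mulVec z) := by
    intro n
    rw [← hinv, PowerSeries.coeff_mul, map_sum, Matrix.transpose_sum, Matrix.sum_mulVec,
      Finset.smul_sum]
    refine Finset.sum_congr rfl fun x hx => ?_
    rw [Finset.HasAntidiagonal.mem_antidiagonal] at hx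
    rw [coeff_scale, smul_mul_assoc, map_smul, map_mul, Matrix.transpose_smul, Matrix.smul_mulVec,
      smul_smul]
    simp only [g, expCoeff]
    rw [neg_pow, mul_assoc, ← pow_add, hx, mul_comm]
  rw [h1, ← sum_range_antidiagonal (D + 1) g hg, Finset.sum_congr rfl fun n _ => h2 n,
    Finset.sum_range_succ']
  simp [PowerSeries.coeff_one]

theorem IsGradedFamily.isLocalFlow (hM : IsGradedFamily M deg D) (x₀ : Fin d → ℝ) :
    IsLocalFlow (linearField M) x₀ (realPart (flowStep M D)) := by
  refine ⟨?_, Eventually.of_forall fun x => ?_, Eventually.of_forall fun p => ?_⟩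
  · refine continuousAt_pi.2 fun i => ?_
    have h1 : ContinuousAt (fun p : ℝ × (Fin d → ℝ) =>
        linearStep (flowCoeff M) (D + 1) (realPoint p)) (0, x₀) :=
      (analyticAt_linearStep _ _ _).continuousAt.comp continuous_realPoint.continuousAt
    exact Complex.continuous_re.continuousAt.comp (continuousAt_pi.1 h1 i)
  · funext i
    rw [realPart, flowStep, Complex.ofReal_zero, linearStep_zero (flowCoeff_zero M)]
    rfl
  · obtain ⟨t, x⟩ := p
    have hlast : flowCoeff M (D + 1) = 0 :=
      (hM.isGraded_flowCoeff (D + 1)).eq_zero hM.le (Nat.lt_succ_self D)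
    have hfield : ∀ i, (linearField M (realPart (flowStep M D) t x) i)
        = (∑ m ∈ Finset.range (D + 1), ((m : ℂ) * (t : ℂ) ^ (m - 1))
          * ((flowCoeff M m).transpose.mulVec (complexify x)) i).re := by
      intro i
      have h1 : linearField M (realPart (flowStep M D) t x) i
          = (((M 0).map Complex.ofReal).transpose.mulVec
            (flowStep M D t (complexify x)) i).re := by
        simp [linearField, Matrix.mulVec, dotProduct, realPart]
      rw [h1, flowStep, linearStep, Matrix.mulVec_sum, Finset.sum_apply, Finset.sum_range_succ,
        Finset.sum_range_succ']
      have h2 : flowCoeff M D * (M 0).map Complex.ofReal = 0 := by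
        rw [← flowCoeff_succ, hlast, smul_zero]
      rw [Matrix.mulVec_smul, Matrix.mulVec_mulVec, ← Matrix.transpose_mul, h2]
      simp only [Matrix.transpose_zero, Matrix.zero_mulVec, smul_zero, Pi.zero_apply, add_zero,
        Nat.cast_zero, zero_mul]
      congr 1
      refine Finset.sum_congr rfl fun m _ => ?_
      rw [Matrix.mulVec_smul, Matrix.mulVec_mulVec, ← Matrix.transpose_mul, ← flowCoeff_succ,
        Matrix.transpose_smul, Matrix.smul_mulVec, Pi.smul_apply, Pi.smul_apply, smul_eq_mul,
        smul_eq_mul, Nat.add_sub_cancel, Nat.cast_succ]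
      ring
    refine hasDerivAt_pi.2 fun i => ?_
    rw [hfield]
    have h5 : HasDerivAt (fun s : ℝ => (s : ℂ)) 1 t := Complex.ofRealCLM.hasDerivAt
    have h6 : HasDerivAt (fun s : ℝ => ∑ m ∈ Finset.range (D + 1), (s : ℂ) ^ m
          * ((flowCoeff M m).transpose.mulVec (complexify x)) i)
        (∑ m ∈ Finset.range (D + 1), ((m : ℂ) * (t : ℂ) ^ (m - 1))
          * ((flowCoeff M m).transpose.mulVec (complexify x)) i) t := by
      refine HasDerivAt.fun_sum fun m _ => ?_
      have h7 := (h5.fun_pow m).mul_const (((flowCoeff M m).transpose.mulVec (complexify x)) i)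
      rwa [mul_one] at h7
    have h8 := (Complex.reCLM.hasFDerivAt.comp_hasDerivAt t h6)
    refine h8.congr_of_eventuallyEq (Eventually.of_forall fun s => ?_)
    simp [realPart, flowStep, linearStep]

theorem IsGradedFamily.isTimeSymmetricOrderTwo (hM : IsGradedFamily M deg D)
    (x₀ : Fin d → ℝ) : IsTimeSymmetricOrderTwo (linearField M) x₀ (expStep M D) := by
  have hexp0 : ∀ m, D + 1 ≤ m → expCoeff M m = 0 := fun m hm =>
    (hM.isGraded_expCoeff m).eq_zero hM.le hm
  have hflow0 : ∀ m, D + 1 ≤ m → flowCoeff M m = 0 := fun m hm =>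
    (hM.isGraded_flowCoeff m).eq_zero hM.le hm
  refine ⟨?_, analyticAt_linearStep _ _ _, Eventually.of_forall fun p i => ?_,
    ⟨realPart (flowStep M D), hM.isLocalFlow x₀, isBigO_pi.2 fun i => ?_⟩,
    Eventually.of_forall fun p => hM.expStep_symmetric p.1 p.2⟩
  · exact (Matrix.mulVecLin (M 0).transpose).toContinuousLinearMap.analyticAt x₀
  · rw [← Complex.conj_eq_iff_im, expStep, linearStep_apply]
    simp only [map_sum, map_mul, map_pow, Complex.conj_ofReal, star_expCoeff, complexify]
  · let w : Fin d → ℂ := Pi.single i 1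
    have h1 := (hasExpansion_linearStep hexp0 (complexify x₀) w).add
      ((hasExpansion_linearStep hflow0 (complexify x₀) w).smul (-1))
    have h2 := (h1.isDivisible (N := 3) fun m hm => by
      rw [Pi.add_apply, Pi.smul_apply, expCoeff_eq_flowCoeff M hm]
      exact (congrArg _ (neg_one_smul ℂ _)).trans (add_neg_cancel _)).isBigO_realPoint
    refine IsBigO.trans (IsBigO.of_bound 1 (Eventually.of_forall fun p => ?_)) h2
    simp only [w, single_dotProduct, one_mul]
    rw [neg_one_mul, ← sub_eq_add_neg, Pi.sub_apply, realPart, realPart, ← Complex.sub_re,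
      Real.norm_eq_abs]
    exact Complex.abs_re_le_norm _

end Nilpotent

end SymConj

end

noncomputable section

namespace SymConj

/-! ### Operators on linear forms -/

section Intertwining

variable {d : ℕ} {z₀ : Fin d → ℂ}

theorem linearGerm_add (w w' : Fin d → ℂ) :
    linearGerm z₀ (w + w') = linearGerm z₀ w + linearGerm z₀ w' :=
  (toGerm_eq_iff (hg' := (analyticAt_dotProduct w z₀).fun_add (analyticAt_dotProduct w' z₀))).2
    (Eventually.of_forall fun z => add_dotProduct w w' z)

theorem linearGerm_smul (c : ℂ) (w : Fin d → ℂ) :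
    linearGerm z₀ (c • w) = c • linearGerm z₀ w :=
  (toGerm_eq_iff (hg' := analyticAt_const.fun_mul (analyticAt_dotProduct w z₀))).2
    (Eventually.of_forall fun z => smul_dotProduct c w z)

/-- The operator `T` maps linear forms to linear forms, by means of the matrix `Y`. -/
def Intertwines (T : GermOps z₀) (Y : Matrix (Fin d) (Fin d) ℂ) : Prop :=
  ∀ w, applyOp (linearGerm z₀ w) T = linearGerm z₀ (Y.mulVec w)

theorem Intertwines.add {T U : GermOps z₀} {Y Z : Matrix (Fin d) (Fin d) ℂ}
    (h : Intertwines T Y) (h' : Intertwines U Z) : Intertwines (T + U) (Y + Z) := fun w => by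
  rw [map_add, h w, h' w, Matrix.add_mulVec, linearGerm_add]

theorem Intertwines.smul {T : GermOps z₀} {Y : Matrix (Fin d) (Fin d) ℂ} (c : ℂ)
    (h : Intertwines T Y) : Intertwines (c • T) (c • Y) := fun w => by
  rw [map_smul, h w, Matrix.smul_mulVec, linearGerm_smul]

theorem intertwines_zero : Intertwines (0 : GermOps z₀) 0 := fun w => by
  have h := linearGerm_smul (z₀ := z₀) 0 (0 : Fin d → ℂ)
  rw [zero_smul, zero_smul] at h
  rw [map_zero, Matrix.zero_mulVec, h]

theorem intertwines_one : Intertwines (1 : GermOps z₀) 1 := fun w => by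
  rw [applyOp_one, Matrix.one_mulVec]

theorem Intertwines.mul {T U : GermOps z₀} {Y Z : Matrix (Fin d) (Fin d) ℂ}
    (h : Intertwines T Y) (h' : Intertwines U Z) : Intertwines (T * U) (Y * Z) := fun w => by
  rw [applyOp_mul, h' w, h, Matrix.mulVec_mulVec]

theorem Intertwines.sub {T U : GermOps z₀} {Y Z : Matrix (Fin d) (Fin d) ℂ}
    (h : Intertwines T Y) (h' : Intertwines U Z) : Intertwines (T - U) (Y - Z) := by
  have h1 := h.add (h'.smul (-1))
  rwa [neg_smul, neg_smul, one_smul, one_smul, ← sub_eq_add_neg, ← sub_eq_add_neg] at h1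

theorem intertwines_sum {ι : Type*} (s : Finset ι) {T : ι → GermOps z₀}
    {Y : ι → Matrix (Fin d) (Fin d) ℂ} (h : ∀ a ∈ s, Intertwines (T a) (Y a)) :
    Intertwines (∑ a ∈ s, T a) (∑ a ∈ s, Y a) := by
  classical
  induction s using Finset.induction_on with
  | empty => exact intertwines_zero
  | insert a s ha ih =>
    rw [Finset.sum_insert ha, Finset.sum_insert ha]
    exact (h a (Finset.mem_insert_self _ _)).add
      (ih fun i hi => h i (Finset.mem_insert_of_mem hi))

theorem intertwines_coeff_one (m : ℕ) :
    Intertwines (PowerSeries.coeff m (1 : PowerSeries (GermOps z₀)))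
      (PowerSeries.coeff m (1 : PowerSeries (Matrix (Fin d) (Fin d) ℂ))) := by
  rw [PowerSeries.coeff_one, PowerSeries.coeff_one]
  split_ifs
  exacts [intertwines_one, intertwines_zero]

theorem intertwines_coeff_formalLog {P : PowerSeries (GermOps z₀)}
    {Q : PowerSeries (Matrix (Fin d) (Fin d) ℂ)}
    (h : ∀ m, Intertwines (PowerSeries.coeff m P) (PowerSeries.coeff m Q)) (m : ℕ) :
    Intertwines (PowerSeries.coeff m (formalLog P)) (PowerSeries.coeff m (formalLog Q)) := by
  have hpow : ∀ k m, Intertwines (PowerSeries.coeff m ((P - 1) ^ k))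
      (PowerSeries.coeff m ((Q - 1) ^ k)) := by
    intro k
    induction k with
    | zero => intro m; rw [pow_zero, pow_zero]; exact intertwines_coeff_one m
    | succ k ih =>
      intro m
      rw [pow_succ, pow_succ, PowerSeries.coeff_mul, PowerSeries.coeff_mul]
      refine intertwines_sum _ fun x _ => (ih x.1).mul ?_
      rw [map_sub, map_sub]
      exact (h x.2).sub (intertwines_coeff_one x.2)
  rw [formalLog, formalLog, PowerSeries.coeff_mk, PowerSeries.coeff_mk]
  exact intertwines_sum _ fun k _ => (hpow k m).smul _

end Intertwining

/-! ### Vanishing of the coefficients of a linear expansion -/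

theorem eq_zero_of_eventually_norm_sum_le {N : ℕ} {b : ℕ → ℂ} {C : ℝ}
    (h : ∀ᶠ t : ℝ in 𝓝 0, ‖∑ m ∈ Finset.range N, (t : ℂ) ^ m * b m‖ ≤ C * ‖t ^ N‖) :
    ∀ m < N, b m = 0 := by
  induction N generalizing C with
  | zero => intro m hm; omega
  | succ N ih =>
    have h1 : ∀ m < N, b m = 0 := by
      refine ih (C := ‖b N‖ + |C|) ?_
      filter_upwards [h, Metric.ball_mem_nhds (0 : ℝ) one_pos] with t ht ht1
      rw [mem_ball_zero_iff] at ht1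
      rw [Finset.sum_range_succ] at ht
      have h2 := (norm_le_norm_add_norm_sub' (∑ m ∈ Finset.range N, (t : ℂ) ^ m * b m)
        (∑ m ∈ Finset.range N, (t : ℂ) ^ m * b m + (t : ℂ) ^ N * b N))
      rw [sub_add_cancel_left, norm_neg, norm_mul, norm_pow, Complex.norm_real] at h2
      refine h2.trans ((add_le_add_left ht _).trans ?_)
      rw [norm_pow, norm_pow, pow_succ]
      have h3 : C * (‖t‖ ^ N * ‖t‖) ≤ |C| * ‖t‖ ^ N := by
        calc C * (‖t‖ ^ N * ‖t‖) ≤ |C| * (‖t‖ ^ N * 1) := by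
              gcongr
              exact le_abs_self C
          _ = |C| * ‖t‖ ^ N := by rw [mul_one]
      linarith
    intro m hm
    rcases Nat.lt_succ_iff_lt_or_eq.1 hm with hm | rfl
    · exact h1 m hm
    · have h5 : ∀ᶠ t in 𝓝[≠] (0 : ℝ), ‖b m‖ ≤ C * ‖t‖ := by
        filter_upwards [h.filter_mono nhdsWithin_le_nhds, self_mem_nhdsWithin] with t ht ht0
        rw [Finset.sum_range_succ, Finset.sum_eq_zero fun j hj => by
          rw [h1 j (Finset.mem_range.1 hj), mul_zero], zero_add, norm_mul, norm_pow, norm_pow,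
          Complex.norm_real, pow_succ, ← mul_assoc, mul_right_comm, mul_comm] at ht
        exact le_of_mul_le_mul_right ht (pow_pos (norm_pos_iff.2 ht0) m)
      have h6 : Tendsto (fun t : ℝ => C * ‖t‖) (𝓝[≠] 0) (𝓝 0) := by
        have : Tendsto (fun t : ℝ => C * ‖t‖) (𝓝 0) (𝓝 (C * ‖(0 : ℝ)‖)) :=
          (continuous_const.mul continuous_norm).tendsto 0
        rw [norm_zero, mul_zero] at this
        exact this.mono_left nhdsWithin_le_nhds
      exact norm_le_zero_iff.1 (ge_of_tendsto h6 h5)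

theorem eq_zero_of_isBigO_dotProduct {d N : ℕ} {u : ℕ → Fin d → ℂ}
    (h : (fun p : ℝ × (Fin d → ℝ) => ∑ m ∈ Finset.range N,
      (p.1 : ℂ) ^ m * dotProduct (u m) (complexify p.2)) =O[𝓝 (0, 0)] fun p => p.1 ^ N) :
    ∀ m < N, u m = 0 := by
  obtain ⟨C, hC⟩ := h.bound
  have h1 : ∀ᶠ x in 𝓝 (0 : Fin d → ℝ), ∀ m < N, dotProduct (u m) (complexify x) = 0 :=
    (eventually_slice hC).mono fun x hx =>
      eq_zero_of_eventually_norm_sum_le (b := fun m => dotProduct (u m) (complexify x)) hx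
  intro m hm
  funext i
  have t : Tendsto (fun r : ℝ => Pi.single (M := fun _ : Fin d => ℝ) i r) (𝓝[≠] 0) (𝓝 0) := by
    have h2 : Continuous fun r : ℝ => Pi.single (M := fun _ : Fin d => ℝ) i r :=
      (ContinuousLinearMap.single ℝ (fun _ : Fin d => ℝ) i).continuous
    have h3 := h2.tendsto 0
    rw [Pi.single_zero] at h3
    exact h3.mono_left nhdsWithin_le_nhds
  obtain ⟨r, hr, hr0⟩ := ((t.eventually h1).and self_mem_nhdsWithin).exists
  have h4 := hr m hm
  have h5 : complexify (Pi.single i r) = Pi.single i (r : ℂ) := by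
    funext j
    rw [complexify, Pi.single_apply, Pi.single_apply]
    split_ifs <;> simp
  rw [h5, dotProduct_single] at h4
  have hr1 : (r : ℂ) ≠ 0 := by simpa using hr0
  exact (mul_eq_zero.1 h4).resolve_right hr1

/-! ### Consequences of the orders of a projected composition -/

/-- Pseudo-symmetry in terms of two consecutive steps. -/
theorem IsPseudoSymmetric.isBigO {d : ℕ} {x₀ : Fin d → ℝ} {R : ℝ → (Fin d → ℝ) → (Fin d → ℝ)}
    {R' : (ℝ × (Fin d → ℝ)) →L[ℝ] (Fin d → ℝ)} {M : ℕ} (h : IsPseudoSymmetric x₀ R M)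
    (hR : HasStrictFDerivAt (fun p : ℝ × (Fin d → ℝ) => R p.1 p.2) R' (0, x₀))
    (ht : Tendsto (fun p : ℝ × (Fin d → ℝ) => (-p.1, R p.1 p.2)) (𝓝 (0, x₀)) (𝓝 (0, x₀))) :
    (fun p : ℝ × (Fin d → ℝ) => R (-p.1) (R p.1 p.2) - p.2) =O[𝓝 (0, x₀)]
      fun p => p.1 ^ (M + 1) := by
  obtain ⟨ψ', hadj, hO⟩ := h
  obtain ⟨K, s, hs, hlip⟩ := hR.exists_lipschitzOnWith
  have t2 : Tendsto (fun p : ℝ × (Fin d → ℝ) => -p.1) (𝓝 (0, x₀)) (𝓝 0) := by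
    have h : Continuous fun p : ℝ × (Fin d → ℝ) => -p.1 := by fun_prop
    simpa using h.tendsto (0, x₀)
  have t3 := t2.prodMk_nhds hadj.continuousAt
  refine IsBigO.trans (IsBigO.of_bound K ?_) hO
  filter_upwards [ht.eventually hs, t3.eventually hs, hadj.right_inv] with p h1 h2 h3
  have h4 := hlip.norm_sub_le h1 h2
  simp only [h3] at h4
  refine h4.trans (mul_le_mul_of_nonneg_left ?_ K.coe_nonneg)
  rw [Prod.mk_sub_mk, sub_self, Prod.norm_mk, norm_zero, max_eq_right (norm_nonneg _),
    norm_sub_rev]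

theorem stepList_append_map_neg {E : Type*} (S : ℂ × E → E) (l l' : List ℂ) (p : ℂ × E) :
    stepList S (l ++ l'.map Neg.neg) p = stepList S l' (-p.1, stepList S l p) := by
  simp [stepList, List.foldl_map]

theorem stageProd_append_map_neg (l l' : List ℂ) :
    stageProd (l ++ l'.map Neg.neg) = stageProd l * scale (-1) (stageProd l') := by
  rw [stageProd, stageProd, stageProd, List.map_append, List.prod_append, scale_list_prod,
    List.map_map, List.map_map]
  congr 3
  funext a
  simp only [Function.comp_apply]
  rw [scale_formalExp, scale_neg_one_stageExponent]
  congr 1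
  ext1 m
  rw [map_neg, stageExponent, stageExponent, PowerSeries.coeff_mk, PowerSeries.coeff_mk]
  split_ifs with h
  · rw [h.neg_pow, neg_smul]
  · rw [neg_zero]

section Nilpotent

variable {d D : ℕ} {M : ℕ → Matrix (Fin d) (Fin d) ℝ} {deg : Fin d → ℕ}

theorem IsGradedFamily.intertwines (hM : IsGradedFamily M deg D) (p : FreeAlgebra ℂ ℕ) :
    Intertwines (operatorHom (hM.isTimeSymmetricOrderTwo 0).isAnalyticStep p)
      (matrixRep M p) := by
  set hS := (hM.isTimeSymmetricOrderTwo 0).isAnalyticStep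
  have hexp0 : ∀ m, D + 1 ≤ m → expCoeff M m = 0 := fun m hm =>
    (hM.isGraded_expCoeff m).eq_zero hM.le hm
  let R : FreeAlgebra ℂ ℕ →+* Matrix (Fin d) (Fin d) ℂ := matrixRep M
  have h1 : ∀ m, Intertwines (PowerSeries.coeff m (stepSeries hS))
      (PowerSeries.coeff m (PowerSeries.map R (formalExp (stageExponent 1)))) := by
    intro m w
    rw [applyOp_coeff_stepSeries, PowerSeries.coeff_map]
    have h2 := hasExpansion_stepOp hS (analyticAt_dotProduct w (complexify 0))
    have h3 : HasExpansion (fun p => dotProduct w (Function.uncurry (expStep M D) p))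
        fun m => linearGerm (complexify 0) ((expCoeff M m).mulVec w) :=
      hasExpansion_linearStep hexp0 (complexify 0) w
    exact congrFun (h2.unique h3) m
  have h2 : formalLog (PowerSeries.map R (formalExp (stageExponent 1)))
      = PowerSeries.map R (stageExponent 1) := by
    have hv : VanishesTo 1 (PowerSeries.map R (stageExponent 1)) :=
      vanishesTo_one_iff.2 (by
        rw [PowerSeries.coeff_map, vanishesTo_one_iff.1 (vanishesTo_stageExponent 1), map_zero])
    refine formalExp_injective (vanishesTo_formalLog _) hv ?_
    rw [map_formalExp, formalExp_formalLog (constantCoeff_formalExp _)]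
  induction p using FreeAlgebra.induction with
  | grade0 r =>
    rw [AlgHom.commutes, AlgHom.commutes, Algebra.algebraMap_eq_smul_one,
      Algebra.algebraMap_eq_smul_one]
    exact intertwines_one.smul r
  | grade1 k =>
    have h3 := intertwines_coeff_formalLog h1 (2 * k + 1)
    rw [h2, PowerSeries.coeff_map, stageExponent, PowerSeries.coeff_mk,
      if_pos (odd_two_mul_add_one k), one_pow, one_smul,
      show (2 * k + 1) / 2 = k by omega] at h3
    rw [operatorHom, FreeAlgebra.lift_ι_apply]
    exact h3
  | mul p q hp hq => rw [map_mul, map_mul]; exact hp.mul hq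
  | add p q hp hq => rw [map_add, map_add]; exact hp.add hq

theorem IsGradedFamily.hasExpansion_mean (hM : IsGradedFamily M deg D) (w : Fin d → ℂ)
    (l l' : List ℂ) (c c' : ℂ) :
    HasExpansion (fun p => c * dotProduct w (stepList (Function.uncurry (expStep M D)) l p)
        + c' * dotProduct w (stepList (Function.uncurry (expStep M D)) l' p))
      fun m => linearGerm (complexify 0)
        ((matrixRep M (PowerSeries.coeff m (c • stageProd l + c' • stageProd l'))).mulVec w) :=
  ((hM.isTimeSymmetricOrderTwo 0).hasExpansion_mean
    (analyticAt_dotProduct w (complexify 0)) l l' c c').of_eq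
      fun _ => (hM.intertwines _ w).symm

variable {s : ℕ} {α : Fin s → ℂ}

theorem IsGradedFamily.matrixRep_eq_of_hasOrder (hM : IsGradedFamily M deg D)
    (hα : IsSymmetricConjugate α) {r : ℕ}
    (h : HasOrder (linearField M) 0 (realPart (composition (expStep M D) α)) r) {m : ℕ}
    (hm : m < r + 1) :
    matrixRep M (PowerSeries.coeff m (stageProd (List.ofFn α) + stageProd (List.ofFn α).reverse
      - (formalExp linearSeries + formalExp linearSeries))) = 0 := by
  obtain ⟨φ, hφ, hO⟩ := h
  let Q : PowerSeries (FreeAlgebra ℂ ℕ) :=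
    (1 / 2 : ℂ) • stageProd (List.ofFn α) + (1 / 2 : ℂ) • stageProd (List.ofFn α).reverse
  have key : matrixRep M (PowerSeries.coeff m Q) - flowCoeff M m = 0 := by
    suffices H : ∀ i, (matrixRep M (PowerSeries.coeff m Q) - flowCoeff M m).mulVec
        (Pi.single i 1) = 0 by
      ext j i
      have := congrFun (H i) j
      rwa [Matrix.mulVec_single_one] at this
    intro i
    set w : Fin d → ℂ := Pi.single i 1 with hw
    let B := (M 0).map Complex.ofReal
    let g : ℕ → (Fin d → ℝ) → ℂ := fun m x => dotProduct ((B ^ m).mulVec w) (complexify x)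
    let L : (Fin d → ℂ) → ((Fin d → ℝ) →L[ℝ] ℂ) := fun u => LinearMap.toContinuousLinearMap
      { toFun := fun x => dotProduct u (complexify x)
        map_add' := fun x y => by
          rw [← dotProduct_add]
          congr 1
          funext i
          simp [complexify]
        map_smul' := fun a x => by
          simp [complexify, dotProduct, Finset.mul_sum, mul_left_comm] }
    have hB : ∀ x, complexify (linearField M x) = B.transpose.mulVec (complexify x) := by
      intro x
      funext i
      simp [complexify, linearField, Matrix.mulVec, dotProduct, B]
    have taylor := hφ.taylor (g := g)
      (fun m => (L ((B ^ m).mulVec w)).continuous.continuousAt)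
      (fun m => Eventually.of_forall fun x => ⟨L ((B ^ m).mulVec w),
        (L ((B ^ m).mulVec w)).hasFDerivAt, by
          change dotProduct _ (complexify (linearField M x)) = dotProduct _ _
          rw [hB, Matrix.dotProduct_mulVec, Matrix.vecMul_transpose, Matrix.mulVec_mulVec,
            ← pow_succ']⟩) (r + 1) 0
    have hdiv := ((hM.hasExpansion_mean w (List.ofFn α) (List.ofFn α).reverse (1 / 2)
      (1 / 2)).isDivisible_sub (N := r + 1) (fun m => analyticAt_dotProduct _ _)
      fun m _ => rfl).isBigO_realPoint
    refine eq_zero_of_isBigO_dotProduct (N := r + 1) (u := fun m =>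
      (matrixRep M (PowerSeries.coeff m Q) - flowCoeff M m).mulVec w) ?_ m hm
    have hOi := isBigO_pi.1 hO i
    have hOc : (fun p : ℝ × (Fin d → ℝ) =>
        ((realPart (composition (expStep M D) α) p.1 p.2 i : ℝ) : ℂ) - ((φ p.1 p.2 i : ℝ) : ℂ))
        =O[𝓝 (0, 0)] fun p => p.1 ^ (r + 1) := by
      refine IsBigO.trans (IsBigO.of_bound 1 (Eventually.of_forall fun p => ?_)) hOi
      rw [← Complex.ofReal_sub, Complex.norm_real, one_mul]
      rfl
    refine ((hOc.add taylor).sub hdiv).congr' ?_ EventuallyEq.rfl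
    filter_upwards [(hM.isTimeSymmetricOrderTwo 0).complexify_realPart hα] with p hp
    have h3 := congrFun hp i
    change ((realPart (composition (expStep M D) α) p.1 p.2 i : ℝ) : ℂ) = _ at h3
    rw [h3]
    have h4 : g 0 (φ p.1 p.2) = ((φ p.1 p.2 i : ℝ) : ℂ) := by
      simp only [g]
      rw [pow_zero, Matrix.one_mulVec, hw, single_dotProduct, one_mul]
      rfl
    have h5 : ∀ m, ((p.1 : ℂ) ^ m / (m.factorial : ℂ)) * g (0 + m) p.2
        = (p.1 : ℂ) ^ m * dotProduct ((flowCoeff M m).mulVec w) (complexify p.2) := fun m => by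
      rw [flowCoeff_eq, Matrix.smul_mulVec, smul_dotProduct, zero_add, smul_eq_mul,
        div_eq_mul_inv, mul_assoc]
    simp only [h4, h5, Matrix.sub_mulVec, sub_dotProduct, mul_sub, Finset.sum_sub_distrib,
      realPoint, hw, single_dotProduct, one_mul, Pi.smul_apply, Pi.add_apply, smul_eq_mul, Q]
    ring
  have h2 : PowerSeries.coeff m (stageProd (List.ofFn α) + stageProd (List.ofFn α).reverse
      - (formalExp linearSeries + formalExp linearSeries))
      = (2 : ℂ) • (PowerSeries.coeff m Q - PowerSeries.coeff m (formalExp linearSeries)) := by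
    simp only [Q, map_sub, map_add, PowerSeries.coeff_smul]
    module
  rw [h2, map_smul, map_sub]
  change (2 : ℂ) • (matrixRep M (PowerSeries.coeff m Q) - flowCoeff M m) = 0
  rw [key, smul_zero]

theorem expStep_add (h : ℂ) (z z' : Fin d → ℂ) :
    expStep M D h (z + z') = expStep M D h z + expStep M D h z' := by
  simp only [expStep, linearStep, Matrix.mulVec_add, smul_add, Finset.sum_add_distrib]

theorem expStep_smul (h c : ℂ) (z : Fin d → ℂ) :
    expStep M D h (c • z) = c • expStep M D h z := by
  simp only [expStep, linearStep, Matrix.mulVec_smul, Finset.smul_sum, smul_comm c]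

theorem stepList_expStep_mean (l : List ℂ) (h : ℂ) (z z' : Fin d → ℂ) :
    stepList (Function.uncurry (expStep M D)) l (h, (1 / 2 : ℂ) • (z + z'))
      = (1 / 2 : ℂ) • (stepList (Function.uncurry (expStep M D)) l (h, z)
        + stepList (Function.uncurry (expStep M D)) l (h, z')) := by
  induction l generalizing z z' with
  | nil => rfl
  | cons a l ih =>
    simp only [stepList_cons, Function.uncurry_apply_pair, expStep_smul, expStep_add]
    exact ih _ _

theorem IsGradedFamily.matrixRep_eq_of_isPseudoSymmetric (hM : IsGradedFamily M deg D)
    (hα : IsSymmetricConjugate α) {r : ℕ}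
    (h : IsPseudoSymmetric 0 (realPart (composition (expStep M D) α)) r) {m : ℕ}
    (hm : m < r + 1) :
    matrixRep M (PowerSeries.coeff m
      ((stageProd (List.ofFn α) + stageProd (List.ofFn α).reverse)
        * scale (-1) (stageProd (List.ofFn α) + stageProd (List.ofFn α).reverse) - 4)) = 0 := by
  have hS := hM.isTimeSymmetricOrderTwo 0
  have hO := h.isBigO (hS.analyticAt_realPart α).hasStrictFDerivAt (hS.tendsto_neg_realPart α)
  set l := List.ofFn α with hl
  let Q : PowerSeries (FreeAlgebra ℂ ℕ) :=
    (1 / 4 : ℂ) • ((stageProd l + stageProd l.reverse)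
        * scale (-1) (stageProd l + stageProd l.reverse))
  have hQ : Q = ((1 / 4 : ℂ) • stageProd (l ++ l.map Neg.neg)
        + (1 / 4 : ℂ) • stageProd (l ++ l.reverse.map Neg.neg))
      + ((1 / 4 : ℂ) • stageProd (l.reverse ++ l.map Neg.neg)
        + (1 / 4 : ℂ) • stageProd (l.reverse ++ l.reverse.map Neg.neg)) := by
    simp only [stageProd_append_map_neg, Q, scale_add, mul_add, add_mul, smul_add]
    abel
  have key : matrixRep M (PowerSeries.coeff m (Q - 1)) = 0 := by
    suffices H : ∀ i, (matrixRep M (PowerSeries.coeff m (Q - 1))).mulVec (Pi.single i 1) = 0 by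
      ext j i
      have := congrFun (H i) j
      rwa [Matrix.mulVec_single_one] at this
    intro i
    set w : Fin d → ℂ := Pi.single i 1 with hw
    have hexp := ((hM.hasExpansion_mean w (l ++ l.map Neg.neg) (l ++ l.reverse.map Neg.neg)
      (1 / 4) (1 / 4)).add (hM.hasExpansion_mean w (l.reverse ++ l.map Neg.neg)
      (l.reverse ++ l.reverse.map Neg.neg) (1 / 4) (1 / 4))).of_eq
      (b' := fun m => linearGerm (complexify 0)
        ((matrixRep M (PowerSeries.coeff m Q)).mulVec w)) fun m => by
        rw [hQ, map_add (PowerSeries.coeff m), map_add (matrixRep M), Matrix.add_mulVec,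
          linearGerm_add]
        rfl
    have hdiv := (hexp.isDivisible_sub (N := r + 1) (fun m => analyticAt_dotProduct _ _)
      fun m _ => rfl).isBigO_realPoint
    refine eq_zero_of_isBigO_dotProduct (N := r + 1) (u := fun m =>
      (matrixRep M (PowerSeries.coeff m (Q - 1))).mulVec w) ?_ m hm
    have hOi := isBigO_pi.1 hO i
    have hOc : (fun p : ℝ × (Fin d → ℝ) =>
        complexify (realPart (composition (expStep M D) α) (-p.1)
          (realPart (composition (expStep M D) α) p.1 p.2)) i - ((p.2 i : ℝ) : ℂ))
        =O[𝓝 (0, 0)] fun p => p.1 ^ (r + 1) := by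
      refine IsBigO.trans (IsBigO.of_bound 1 (Eventually.of_forall fun p => ?_)) hOi
      rw [complexify, ← Complex.ofReal_sub, Complex.norm_real, one_mul]
      rfl
    refine (hOc.sub hdiv).congr' ?_ EventuallyEq.rfl
    have hreal := hS.complexify_realPart hα
    filter_upwards [hreal, (hS.tendsto_neg_realPart α).eventually hreal] with p h1 h2
    have h3 := congrFun h2 i
    simp only [realPoint] at h1 h3
    rw [h1] at h3
    rw [h3]
    have h5 : ∑ m ∈ Finset.range (r + 1), (p.1 : ℂ) ^ m * dotProduct
        ((matrixRep M (PowerSeries.coeff m (1 : PowerSeries (FreeAlgebra ℂ ℕ)))).mulVec w)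
          (complexify p.2) = ((p.2 i : ℝ) : ℂ) := by
      rw [Finset.sum_range_succ', Finset.sum_eq_zero fun m _ => by
        rw [PowerSeries.coeff_one, if_neg m.succ_ne_zero, map_zero, Matrix.zero_mulVec,
          zero_dotProduct, mul_zero], zero_add, pow_zero, one_mul, PowerSeries.coeff_one, if_pos rfl,
        map_one, Matrix.one_mulVec, hw, single_dotProduct, one_mul]
      rfl
    rw [hw] at h5
    simp only [← hl, stepList_append_map_neg, stepList_expStep_mean, map_sub, Matrix.sub_mulVec,
      sub_dotProduct, mul_sub, Finset.sum_sub_distrib, h5,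
      realPoint, hw, single_dotProduct, one_mul, Pi.smul_apply, Pi.add_apply, smul_eq_mul,
      Complex.ofReal_neg]
    ring
  have h2 : (stageProd l + stageProd l.reverse) * scale (-1) (stageProd l + stageProd l.reverse)
      - 4 = (4 : ℂ) • (Q - 1) := by
    simp only [Q, smul_sub, smul_smul]
    norm_num
    rw [← Nat.cast_ofNat (R := ℂ), Nat.cast_smul_eq_nsmul, nsmul_one]
    norm_num
  rw [h2, PowerSeries.coeff_smul, map_smul, key, smul_zero]

end Nilpotent

theorem isGradedFamily_wordMatrix (v : List ℕ) :
    IsGradedFamily (wordMatrix v) (fun i => wordDegree (v.drop i)) (wordDegree v) := by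
  refine ⟨fun k i j => wordMatrix_ne_zero, fun i => ?_⟩
  conv_rhs => rw [← List.take_append_drop i v]
  rw [wordDegree, wordDegree, List.map_append, List.sum_append]
  exact Nat.le_add_left _ _

end SymConj

end

noncomputable section

namespace SymConj

/-- The conditions on the series of operators that are equivalent to the orders of all projected
compositions. -/
theorem forall_hasOrder_and_isPseudoSymmetric_iff {s : ℕ} {α : Fin s → ℂ}
    (hα : IsSymmetricConjugate α) {r M N : ℕ} (hM : M + 1 = 2 * N) :
    (∀ (d : ℕ) (f : (Fin d → ℝ) → (Fin d → ℝ)) (x₀ : Fin d → ℝ)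
        (S : ℂ → (Fin d → ℂ) → (Fin d → ℂ)), IsTimeSymmetricOrderTwo f x₀ S →
        HasOrder f x₀ (realPart (composition S α)) r ∧
        IsPseudoSymmetric x₀ (realPart (composition S α)) M) ↔
      VanishesTo N (stageProd (List.ofFn α) - stageProd (List.ofFn α).reverse) ∧
      VanishesTo (r + 1) (stageProd (List.ofFn α) + stageProd (List.ofFn α).reverse
        - (formalExp linearSeries + formalExp linearSeries)) := by
  refine ⟨fun h => ?_, fun h d f x₀ S hS =>
    ⟨hS.hasOrder_composition hα h.2, hS.isPseudoSymmetric_composition hα hM h.1⟩⟩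
  have hw := fun v => h _ _ _ _ ((isGradedFamily_wordMatrix v).isTimeSymmetricOrderTwo 0)
  constructor
  · refine vanishesTo_of_mul_scale ?_
    rw [← hM]
    have h1 : VanishesTo (M + 1) ((stageProd (List.ofFn α) + stageProd (List.ofFn α).reverse)
        * scale (-1) (stageProd (List.ofFn α) + stageProd (List.ofFn α).reverse) - 4) :=
      vanishesTo_of_matrixRep_wordMatrix fun v m hm =>
        (isGradedFamily_wordMatrix v).matrixRep_eq_of_isPseudoSymmetric hα (hw v).2 hm
    rwa [← mean_mul_scale_sub_difference_mul_scale, sub_sub_cancel] at h1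
  · exact vanishesTo_of_matrixRep_wordMatrix fun v m hm =>
      (isGradedFamily_wordMatrix v).matrixRep_eq_of_hasOrder hα (hw v).1 hm

end SymConj

end

theorem proposition3 {s : ℕ} (α : Fin s → ℂ) (hα : SymConj.IsSymmetricConjugate α)
    (n q : ℕ) (hnq : 4 * q + 1 < 2 * n)
    (E : (m : ℕ) → Module.Basis (Fin (SymConj.c m)) ℝ (SymConj.component m))
    (hE : ∀ k, ((E 1 k : SymConj.component 1) : FreeLieAlgebra ℝ ℕ) = FreeLieAlgebra.of ℝ 0) :
    -- the coefficients `w_{m,k}` of `V(h)` exist and are unique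
    (∃! w : (m : ℕ) → Fin (SymConj.c m) → ℂ, SymConj.IsCoordinates E α w) ∧
    ∀ w : (m : ℕ) → Fin (SymConj.c m) → ℂ, SymConj.IsCoordinates E α w →
      -- those at `h^{2n}, h^{2n-2}, …, h^{2n-2q}` are purely imaginary
      (∀ j ≤ q, ∀ k, (w (2 * n - 2 * j) k).re = 0) ∧
      -- the remaining order conditions are what is needed, and enough, to get order `2n` and
      -- pseudo-symmetry order `4n-(4q+1)` after projection
      ((∀ i ∈ SymConj.retained n q, SymConj.OrderCondition w i) ↔
        ∀ (d : ℕ) (f : (Fin d → ℝ) → (Fin d → ℝ)) (x₀ : Fin d → ℝ)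
          (S : ℂ → (Fin d → ℂ) → (Fin d → ℂ)), SymConj.IsTimeSymmetricOrderTwo f x₀ S →
          SymConj.HasOrder f x₀ (SymConj.realPart (SymConj.composition S α)) (2 * n) ∧
          SymConj.IsPseudoSymmetric x₀ (SymConj.realPart (SymConj.composition S α))
            (4 * n - (4 * q + 1))) ∧
      -- and this is their number
      ((SymConj.retained n q).card : ℤ) =
        (SymConj.numConditions (2 * n) : ℤ)
          - ∑ j ∈ Finset.range (q + 1), (SymConj.c (2 * n - 2 * j) : ℤ) := by
  refine ⟨SymConj.existsUnique_isCoordinates α E, fun w hw => ⟨fun j _ k => ?_, ?_,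
    SymConj.card_retained hnq⟩⟩
  · refine hw.re_eq_zero hα ?_ k
    exact ⟨n - j, by omega⟩
  · rw [SymConj.orderConditions_iff hE hw, SymConj.retainedConditions_stageLog_iff hnq]
    exact (SymConj.forall_hasOrder_and_isPseudoSymmetric_iff hα (by omega)).symm
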